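/- All rings are commutative with unit. A topological ring is \emph{linearly topologized} (here) if some descending sequence of ideals $I_1\supseteq I_2\supseteq\cdots$ is a basis of neighbourhoods of $0$. An open ideal is an \emph{ideal of definition} if all its elements are topologically nilpotent. A linearly topologized ring is \emph{admissible} if it is separated and complete and has an ideal of definition. For an admissible ring $A$, $\mathrm{Spf}\,A$ is the set of open prime ideals with the Zariski topology and the sheaf of topological rings $\varprojlim \mathcal O_{\mathrm{Spec}\,A/I}$, the limit over the ideals of definition $I$ of sheaves of pseudo-discrete rings. A \emph{formal scheme} is a locally topologically ringed space that is locally isomorphic to some $\mathrm{Spf}\,A$ with $A$ admissible; morphisms are morphisms of locally topologically ringed spaces. An \emph{ordinary scheme} is a scheme, its structure sheaf being regarded as a sheaf of pseudo-discrete rings. An \emph{open immersion} is an isomorphism onto an open subscheme. A \emph{closed immersion} is a morphism $\mathcal Z\to\mathcal X$ such that every point of $\mathcal X$ has an affine open neighbourhood $\mathrm{Spf}\,A$ over which the morphism is isomorphic to $\mathrm{Spf}\,A/I\to \mathrm{Spf}\,A$ for some closed ideal $I\subseteq A$ ($A/I$ with the quotient topology). An \emph{immersion} is a closed immersion into an open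 subscheme. A \emph{pseudo-immersion} is a morphism $\iota:\mathcal Y\to\mathcal X$ of formal schemes such that for every immersion $W\hookrightarrow\mathcal Y$ with $W$ an ordinary scheme, the composition $W\hookrightarrow\mathcal Y\to\mathcal X$ is an immersion. A \emph{pseudo-subscheme} of $\mathcal X$ is an equivalence class of pseudo-immersions into $\mathcal X$, where $f_i:\mathcal Y_i\to\mathcal X$ ($i=1,2$) are equivalent if $f_1=f_2\circ g$ for some isomorphism $g:\mathcal Y_1\to\mathcal Y_2$; it is \emph{closed} if the map of underlying spaces is a homeomorphism onto a closed subset. For pseudo-subschemes, $\mathcal Y\le\mathcal Z$ means that $\mathcal Y\to\mathcal X$ factors through $\mathcal Z\to\mathcal X$, and $\mathcal Z$ \emph{contains $\mathcal Y$ as an open subscheme} if there is such a factorization in which $\mathcal Y\to\mathcal Z$ is an open immersion. \textbf{Proposition.} Let $\mathcal X$ be a formal scheme and $\mathcal Y$ a pseudo-subscheme of $\mathcal X$ such that the inclusion map of the underlying topological spaces is quasi-compact (preimages of quasi-compact open subsets are quasi-compact). Then among the closed pseudo-subschemes of $\mathcal X$ that contain $\mathcal Y$ as an open subscheme there is a smallest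 one $\bar{\mathcal Y}$ with respect to $\le$, and it is unique. It is called the \emph{pseudo-closure} of $\mathcal Y$ in $\mathcal X$. -/

import Mathlib

universe u
open CategoryTheory TopologicalSpace Opposite Topology
open AlgebraicGeometry

namespace FormalGeometry

/-- An ideal of definition: an open ideal all of whose elements are topologically nilpotent. -/
def IsIdealOfDefinition {A : Type*} [CommRing A] [TopologicalSpace A] (I : Ideal A) : Prop :=
  IsOpen (I : Set A) ∧ ∀ f ∈ I, IsTopologicallyNilpotent f

/-- Admissible rings: topological rings with a descending sequence of ideals as a basis of
neighbourhoods of `0`, separated and complete, and possessing an ideal of definition. -/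
class IsAdmissibleRing (A : Type*) [CommRing A] [TopologicalSpace A] : Prop
    extends IsTopologicalRing A, T2Space A where
  exists_basis : ∃ I : ℕ → Ideal A, Antitone I ∧
    (𝓝 (0 : A)).HasBasis (fun _ => True) (fun n => (I n : Set A))
  complete : @CompleteSpace A (IsTopologicalAddGroup.rightUniformSpace A)
  exists_isIdealOfDefinition : ∃ I : Ideal A, IsIdealOfDefinition I

lemma continuous_quotientMk {A : Type*} [CommRing A] [TopologicalSpace A] (I : Ideal A) :
    Continuous (Ideal.Quotient.mk I) := continuous_quot_mk

/-- The quotient of an admissible ring by a closed ideal, with the quotient topology, is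
admissible. -/
theorem IsAdmissibleRing.quotient {A : Type*} [CommRing A] [TopologicalSpace A]
    [IsAdmissibleRing A] (I : Ideal A) (hI : IsClosed (I : Set A)) : IsAdmissibleRing (A ⧸ I) := by
  have hcont : Continuous (Ideal.Quotient.mk I) := continuous_quotientMk I
  have hopen : IsOpenMap (Ideal.Quotient.mk I) := QuotientRing.isOpenMap_coe I
  obtain ⟨J, hJ, hb⟩ := IsAdmissibleRing.exists_basis (A := A)
  obtain ⟨K, hK⟩ := IsAdmissibleRing.exists_isIdealOfDefinition (A := A)
  have himg (J : Ideal A) : ((J.map (Ideal.Quotient.mk I) : Ideal (A ⧸ I)) : Set (A ⧸ I)) =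
      Ideal.Quotient.mk I '' J := by
    ext x
    exact Ideal.mem_map_iff_of_surjective _ Ideal.Quotient.mk_surjective
  have ht : IsTopologicalRing (A ⧸ I) := inferInstance
  have h2 : T2Space (A ⧸ I) := by
    have : T3Space (A ⧸ I.toAddSubgroup) := by
      have : IsClosed (I.toAddSubgroup : Set A) := hI
      infer_instance
    have h : T2Space (A ⧸ I.toAddSubgroup) := inferInstance
    exact h
  refine { ht, h2 with exists_basis := ?_, complete := ?_, exists_isIdealOfDefinition := ?_ }
  · refine ⟨fun n => (J n).map (Ideal.Quotient.mk I), fun m n h => Ideal.map_mono (hJ h), ?_⟩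
    have h3 : 𝓝 (0 : A ⧸ I) = (𝓝 (0 : A)).map (Ideal.Quotient.mk I) := by
      rw [hopen.map_nhds_eq hcont.continuousAt, map_zero]
    rw [h3]
    simp only [himg]
    exact hb.map _
  · have : FirstCountableTopology A := by
      have h4 : (𝓝 (0 : A)).IsCountablyGenerated := hb.isCountablyGenerated
      let := IsTopologicalAddGroup.rightUniformSpace A
      have : IsUniformAddGroup A := isUniformAddGroup_of_addCommGroup
      have : (uniformity A).IsCountablyGenerated :=
        IsUniformAddGroup.uniformity_countably_generated
      infer_instance
    have h5 := @QuotientAddGroup.completeSpace_right' A _ _ _ _ I.toAddSubgroup _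
      (IsAdmissibleRing.complete (A := A))
    exact h5
  · refine ⟨K.map (Ideal.Quotient.mk I), ?_, fun f hf => ?_⟩
    · rw [himg]; exact hopen _ hK.1
    · obtain ⟨g, hg, rfl⟩ := (Ideal.mem_map_iff_of_surjective _ Ideal.Quotient.mk_surjective).mp hf
      have := (hcont.tendsto 0).comp (hK.2 g hg)
      simpa [IsTopologicallyNilpotent, Function.comp_def] using this

/-- Locally topologically ringed spaces: locally ringed spaces whose structure sheaf is a sheaf of
topological rings. The latter means that all rings of sections are topological rings, restrictions
are continuous, and for every open covering `U = ⋃ V k` the topology of `𝒪(U)` is the coarsest one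
making the restrictions `𝒪(U) → 𝒪(V k)` continuous. -/
structure LocallyTopRingedSpace : Type (u + 1) extends LocallyRingedSpace.{u} where
  sectionTop : ∀ U : Opens carrier, TopologicalSpace (presheaf.obj (op U))
  isTopologicalRing : ∀ U : Opens carrier,
    @IsTopologicalRing (presheaf.obj (op U)) (sectionTop U) _
  continuous_map : ∀ {U V : Opens carrier} (i : V ⟶ U),
    @Continuous _ _ (sectionTop U) (sectionTop V) (presheaf.map i.op)
  iInf_induced_le : ∀ {ι : Type u} (V : ι → Opens carrier) (U : Opens carrier)
    (i : ∀ k, V k ⟶ U), U ≤ iSup V →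
    ⨅ k, (sectionTop (V k)).induced (presheaf.map (i k).op) ≤ sectionTop U

namespace LocallyTopRingedSpace

/-- Morphisms of locally topologically ringed spaces: morphisms of locally ringed spaces whose maps
on rings of sections are continuous. -/
structure Hom (X Y : LocallyTopRingedSpace.{u}) where
  toLRSHom : X.toLocallyRingedSpace ⟶ Y.toLocallyRingedSpace
  continuous_app : ∀ U : Opens Y.carrier,
    @Continuous _ _ (Y.sectionTop U) (X.sectionTop ((Opens.map toLRSHom.base).obj U))
      (toLRSHom.c.app (op U))

instance : Category LocallyTopRingedSpace.{u} where
  Hom := Hom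
  id X := ⟨𝟙 X.toLocallyRingedSpace, fun U => @continuous_id _ (X.sectionTop U)⟩
  comp {X Y Z} f g := ⟨f.toLRSHom ≫ g.toLRSHom, fun U =>
    @Continuous.comp _ _ _ (Z.sectionTop U)
      (Y.sectionTop ((Opens.map g.toLRSHom.base).obj U)) (X.sectionTop _) _ _
      (f.continuous_app _) (g.continuous_app U)⟩

/-- Isomorphisms onto an open subspace with the restricted structure sheaf of topological rings. -/
structure IsOpenImmersion {X Y : LocallyTopRingedSpace.{u}} (f : X ⟶ Y) : Prop where
  isOpenImmersion : LocallyRingedSpace.IsOpenImmersion f.toLRSHom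
  isInducing : ∀ U : Opens Y.carrier, (U : Set Y.carrier) ⊆ Set.range f.toLRSHom.base →
    @IsInducing _ _ (Y.sectionTop U) (X.sectionTop ((Opens.map f.toLRSHom.base).obj U))
      (f.toLRSHom.c.app (op U))

end LocallyTopRingedSpace

noncomputable section Spf

variable (A : Type u) [CommRing A] [TopologicalSpace A]

/-- The open ideals of `A`, ordered by inclusion. -/
abbrev OpenIdeal : Type u := {I : Ideal A // IsOpen (I : Set A)}

/-- The underlying space of the formal spectrum: the open prime ideals. -/
def SpfTop : TopCat.{u} := TopCat.of {p : PrimeSpectrum A // IsOpen (p.asIdeal : Set A)}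

variable {A}

namespace Spf

/-- The scheme `Spec (A ⧸ I)`. -/
abbrev specQuot (I : OpenIdeal A) : Scheme.{u} := Spec (CommRingCat.of (A ⧸ I.1))

/-- The transition map `Spec (A ⧸ J) ⟶ Spec (A ⧸ I)` for `I ≤ J`. -/
def specTrans {I J : OpenIdeal A} (h : I ≤ J) : specQuot J ⟶ specQuot I :=
  Spec.map (CommRingCat.ofHom (Ideal.Quotient.factor h))

variable [IsTopologicalRing A]

/-- The map of topological spaces `Spec (A ⧸ I) ⟶ Spf A`. -/
def ofQuot (I : OpenIdeal A) : TopCat.of (PrimeSpectrum (A ⧸ I.1)) ⟶ SpfTop A :=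
  TopCat.ofHom ⟨fun p => ⟨PrimeSpectrum.comap (Ideal.Quotient.mk I.1) p,
    AddSubgroup.isOpen_mono (H₁ := I.1.toAddSubgroup)
      (H₂ := (PrimeSpectrum.comap (Ideal.Quotient.mk I.1) p).asIdeal.toAddSubgroup)
      (fun x hx => by
        change Ideal.Quotient.mk I.1 x ∈ p.asIdeal
        rw [Ideal.Quotient.eq_zero_iff_mem.mpr hx]
        exact p.asIdeal.zero_mem) I.2⟩,
    Continuous.subtype_mk (PrimeSpectrum.continuous_comap _) _⟩

/-- The preimage in `Spec (A ⧸ I)` of an open subset of `Spf A`. -/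
def preim (I : OpenIdeal A) (U : Opens (SpfTop A)) : (specQuot I).Opens :=
  (Opens.map (ofQuot I)).obj U

lemma preim_mono (I : OpenIdeal A) {U V : Opens (SpfTop A)} (h : V ≤ U) :
    preim I V ≤ preim I U := fun _ hx => h hx

lemma preim_le {I J : OpenIdeal A} (h : I ≤ J) (U : Opens (SpfTop A)) :
    preim J U ≤ specTrans h ⁻¹ᵁ preim I U := le_refl _

lemma map_appLE_comm {I J : OpenIdeal A} (h : I ≤ J) {U V : Opens (SpfTop A)} (hVU : V ≤ U)
    (x : Γ(specQuot I, preim I U)) :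
    (specQuot J).presheaf.map (homOfLE (preim_mono J hVU)).op
      ((specTrans h).appLE (preim I U) (preim J U) (preim_le h U) x) =
    (specTrans h).appLE (preim I V) (preim J V) (preim_le h V)
      ((specQuot I).presheaf.map (homOfLE (preim_mono I hVU)).op x) := by
  simp only [← CommRingCat.comp_apply]
  rw [Scheme.Hom.map_appLE, Scheme.Hom.appLE_map]

/-- The sections over `U` of the limit of the (direct images of the) sheaves `𝒪_{Spec (A ⧸ I)}`.
The limit is taken over all open ideals; the ideals of definition, and any basis of ideals of
definition, are cofinal among them. -/
def sections (U : Opens (SpfTop A)) :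
    Subring (∀ I : OpenIdeal A, Γ(specQuot I, preim I U)) where
  carrier := {s | ∀ (I J : OpenIdeal A) (h : I ≤ J),
    (specTrans h).appLE (preim I U) (preim J U) (preim_le h U) (s I) = s J}
  mul_mem' hs ht I J h := by simp only [Pi.mul_apply, map_mul, hs I J h, ht I J h]
  one_mem' I J h := by simp only [Pi.one_apply, map_one]
  add_mem' hs ht I J h := by simp only [Pi.add_apply, map_add, hs I J h, ht I J h]
  zero_mem' I J h := by simp only [Pi.zero_apply, map_zero]
  neg_mem' hs I J h := by simp only [Pi.neg_apply, map_neg, hs I J h]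

/-- Restriction of sections. -/
def res {U V : Opens (SpfTop A)} (h : V ≤ U) : sections U →+* sections V :=
  RingHom.codRestrict
    (RingHom.pi fun I => ((specQuot I).presheaf.map (homOfLE (preim_mono I h)).op).hom.comp
      ((Pi.evalRingHom _ I).comp (sections U).subtype)) (sections V) (by
    intro s I J hIJ
    have hs := s.2 I J hIJ
    simp only [RingHom.pi_apply, RingHom.comp_apply, Pi.evalRingHom_apply, Subring.subtype_apply]
    rw [← hs]
    exact (map_appLE_comm hIJ h (s.1 I)).symm)

/-- The component of a section along the open ideal `I`. -/
def eval (U : Opens (SpfTop A)) (I : OpenIdeal A) : sections U →+* Γ(specQuot I, preim I U) :=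
  (Pi.evalRingHom _ I).comp (sections U).subtype

@[simp] lemma res_apply {U V : Opens (SpfTop A)} (h : V ≤ U) (s : sections U) (I : OpenIdeal A) :
    (res h s).1 I = (specQuot I).presheaf.map (homOfLE (preim_mono I h)).op (s.1 I) := rfl

lemma res_refl (U : Opens (SpfTop A)) (s : sections U) : res (le_refl U) s = s := by
  refine Subtype.ext (funext fun I => ?_)
  rw [res_apply]
  exact congr($((specQuot I).presheaf.map_id _) (s.1 I))

lemma res_res {U V W : Opens (SpfTop A)} (h : V ≤ U) (h' : W ≤ V) (s : sections U) :
    res h' (res h s) = res (h'.trans h) s := by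
  refine Subtype.ext (funext fun I => ?_)
  simp only [res_apply, ← CommRingCat.comp_apply, ← Functor.map_comp]
  rfl

/-- The structure sheaf of `Spf A`. -/
def presheaf : TopCat.Presheaf CommRingCat.{u} (SpfTop A) where
  obj U := CommRingCat.of (sections U.unop)
  map i := CommRingCat.ofHom (res i.unop.le)
  map_id _ := CommRingCat.hom_ext (RingHom.ext (res_refl _))
  map_comp i j := CommRingCat.hom_ext (RingHom.ext fun s => (res_res i.unop.le j.unop.le s).symm)

lemma isSheaf : (presheaf (A := A)).IsSheaf := by
  rw [TopCat.Presheaf.isSheaf_iff_isSheafUniqueGluing]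
  intro ι U sf hsf
  have hcov (I : OpenIdeal A) : preim I (iSup U) ≤ ⨆ k, preim I (U k) := by
    intro x hx
    obtain ⟨k, hk⟩ := Opens.mem_iSup.mp hx
    exact Opens.mem_iSup.mpr ⟨k, hk⟩
  have key (I : OpenIdeal A) := (specQuot I).sheaf.existsUnique_gluing'
    (fun k => preim I (U k)) (preim I (iSup U)) (fun k => homOfLE (preim_mono I (le_iSup U k)))
    (hcov I) (fun k => (sf k).1 I) (fun k l => congr($(hsf k l).1 I))
  choose s hs hs' using key
  refine ⟨⟨s, fun I J h => ?_⟩, fun k => Subtype.ext (funext fun I => hs I k), fun t ht => ?_⟩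
  · refine hs' J _ fun k => ?_
    exact (map_appLE_comm h (le_iSup U k) (s I)).trans
      ((congrArg _ (hs I k)).trans ((sf k).2 I J h))
  · exact Subtype.ext (funext fun I => hs' I _ fun k => congr($(ht k).1 I))

/-- The topology of the limit of the sheaves of pseudo-discrete rings `𝒪_{Spec (A ⧸ I)}`: the
coarsest one for which all the maps to `𝒪_{Spec (A ⧸ I)}(V)`, with `V` quasi-compact and this ring
discrete, are continuous. -/
@[reducible]
def sectionTop (U : Opens (SpfTop A)) : TopologicalSpace (sections U) :=
  ⨅ (V : {V : Opens (SpfTop A) // V ≤ U ∧ IsCompact (V : Set (SpfTop A))}) (I : OpenIdeal A),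
    TopologicalSpace.induced (fun s => (res V.2.1 s).1 I) ⊥


lemma continuous_eval {U V : Opens (SpfTop A)} (h : V ≤ U) (hV : IsCompact (V : Set (SpfTop A)))
    (I : OpenIdeal A) :
    Continuous[sectionTop U, ⊥] (fun s => (res h s).1 I) := by
  rw [continuous_iff_le_induced]
  exact (iInf_le _ (⟨V, h, hV⟩ : {V : Opens (SpfTop A) // V ≤ U ∧ IsCompact (V : Set (SpfTop A))})).trans
    (iInf_le _ I)

lemma continuous_rng {T : Type*} (t : TopologicalSpace T) {U : Opens (SpfTop A)}
    (f : T → sections U)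
    (H : ∀ (V : Opens (SpfTop A)) (h : V ≤ U), IsCompact (V : Set (SpfTop A)) →
      ∀ I : OpenIdeal A, Continuous[t, ⊥] (fun x => (res h (f x)).1 I)) :
    Continuous[t, sectionTop U] f := by
  refine continuous_iInf_rng.mpr fun V => continuous_iInf_rng.mpr fun I =>
    continuous_induced_rng.mpr (H V.1 V.2.1 V.2.2 I)

lemma isTopologicalRing (U : Opens (SpfTop A)) :
    @IsTopologicalRing (sections U) (sectionTop U) _ := by
  have key (V : {V : Opens (SpfTop A) // V ≤ U ∧ IsCompact (V : Set (SpfTop A))})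
      (I : OpenIdeal A) : @IsTopologicalRing (sections U)
      (TopologicalSpace.induced (fun s => (res V.2.1 s).1 I) ⊥) _ := by
    let : TopologicalSpace Γ(specQuot I, preim I V.1) := ⊥
    have : DiscreteTopology Γ(specQuot I, preim I V.1) := ⟨rfl⟩
    let f : sections U →+* Γ(specQuot I, preim I V.1) :=
      (Pi.evalRingHom _ I).comp ((sections V.1).subtype.comp (res V.2.1))
    let : TopologicalSpace (sections U) := TopologicalSpace.induced f ⊥
    have h1 : ContinuousAdd (sections U) := continuousAdd_induced f
    have h2 : ContinuousMul (sections U) := continuousMul_induced f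
    have h3 : IsTopologicalAddGroup (sections U) := topologicalAddGroup_induced f
    exact { h1, h2, h3 with }
  have h1 : @ContinuousAdd (sections U) (sectionTop U) _ :=
    continuousAdd_iInf fun V => continuousAdd_iInf fun I => (key V I).toContinuousAdd
  have h2 : @ContinuousMul (sections U) (sectionTop U) _ :=
    continuousMul_iInf fun V => continuousMul_iInf fun I => (key V I).toContinuousMul
  have h3 : @IsTopologicalAddGroup (sections U) (sectionTop U) _ :=
    topologicalAddGroup_iInf fun V => topologicalAddGroup_iInf fun I =>
      @IsTopologicalRing.to_topologicalAddGroup _ _ (_) (key V I)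
  let := sectionTop U
  exact { h1, h2, h3 with }

lemma continuous_res {U V : Opens (SpfTop A)} (h : V ≤ U) :
    Continuous[sectionTop U, sectionTop V] (res h) := by
  refine continuous_rng _ _ fun W hW hWc I => ?_
  simp only [res_res]
  exact continuous_eval _ hWc I

end Spf

end Spf

noncomputable section Spf

variable {A : Type u} [CommRing A] [TopologicalSpace A]

lemma IsIdealOfDefinition.le_of_isOpen {K : Ideal A} (hK : IsIdealOfDefinition K)
    {p : Ideal A} [p.IsPrime] (hp : IsOpen (p : Set A)) : K ≤ p := fun f hf => by
  have h := (hK.2 f hf).eventually (hp.mem_nhds p.zero_mem)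
  obtain ⟨n, hn⟩ := h.exists
  exact Ideal.IsPrime.mem_of_pow_mem ‹_› n hn

namespace Spf

variable [IsAdmissibleRing A]

lemma ofQuot_isInducing (I : OpenIdeal A) : IsInducing (ofQuot I) := by
  have h := (PrimeSpectrum.isClosedEmbedding_comap_of_surjective _ (Ideal.Quotient.mk I.1)
    Ideal.Quotient.mk_surjective).isInducing
  exact IsInducing.of_comp (ofQuot I).hom.continuous
    (continuous_subtype_val : Continuous (Subtype.val : SpfTop A → PrimeSpectrum A)) h

lemma exists_ofQuot_eq (I : OpenIdeal A) (x : SpfTop A) (h : I.1 ≤ x.1.asIdeal) :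
    ∃ q : PrimeSpectrum (A ⧸ I.1), ofQuot I q = x := by
  have hx : x.1 ∈ Set.range (PrimeSpectrum.comap (Ideal.Quotient.mk I.1)) := by
    rw [_root_.range_comap_of_surjective _ _ Ideal.Quotient.mk_surjective, Ideal.mk_ker]
    exact h
  obtain ⟨q, hq⟩ := hx
  exact ⟨q, Subtype.ext hq⟩

lemma prespectralSpace : PrespectralSpace (SpfTop A) := by
  obtain ⟨K, hK⟩ := IsAdmissibleRing.exists_isIdealOfDefinition (A := A)
  have h : IsClosedEmbedding (Subtype.val : SpfTop A → PrimeSpectrum A) := by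
    refine IsClosed.isClosedEmbedding_subtypeVal ?_
    have : {p : PrimeSpectrum A | IsOpen (p.asIdeal : Set A)} = PrimeSpectrum.zeroLocus K := by
      ext p
      exact ⟨fun hp => hK.le_of_isOpen hp, fun hp => AddSubgroup.isOpen_mono
        (H₁ := K.toAddSubgroup) (H₂ := p.asIdeal.toAddSubgroup) hp hK.1⟩
    have h2 := PrimeSpectrum.isClosed_zeroLocus (K : Set A)
    rw [← this] at h2
    exact h2
  exact .of_isClosedEmbedding _ h

lemma iInf_induced_le {ι : Type u} (V : ι → Opens (SpfTop A)) (U : Opens (SpfTop A))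
    (hV : ∀ k, V k ≤ U) (hU : U ≤ iSup V) :
    ⨅ k, (sectionTop (V k)).induced (res (hV k)) ≤ sectionTop U := by
  have := prespectralSpace (A := A)
  set t : TopologicalSpace (sections U) := ⨅ k, (sectionTop (V k)).induced (res (hV k)) with ht
  refine continuous_id_iff_le.mp (continuous_rng t id fun W hWU hW I => ?_)
  have h1 (x : SpfTop A) (hx : x ∈ W) : ∃ (N : Opens (SpfTop A)) (k : ι),
      IsCompact (N : Set (SpfTop A)) ∧ x ∈ N ∧ N ≤ W ∧ N ≤ V k := by
    obtain ⟨k, hk⟩ := Opens.mem_iSup.mp (hU (hWU hx))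
    obtain ⟨N, hN, hNo, hxN, hNW⟩ := PrespectralSpace.exists_isCompact_and_isOpen_between
      (isCompact_singleton (x := x)) (W ⊓ V k).isOpen (Set.singleton_subset_iff.mpr ⟨hx, hk⟩)
    exact ⟨⟨N, hNo⟩, k, hN, hxN rfl, fun y hy => (hNW hy).1, fun y hy => (hNW hy).2⟩
  choose! N hk using h1
  choose k hNc hxN hNW hNV using hk
  obtain ⟨T, hT, hcov⟩ := hW.elim_nhds_subcover (fun x => (N x : Set (SpfTop A)))
    fun x hx => (N x).isOpen.mem_nhds (hxN x hx)
  let r (y : Γ(specQuot I, preim I W)) (x : T) : Γ(specQuot I, preim I (N x)) :=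
    (specQuot I).presheaf.map (homOfLE (preim_mono I (hNW x (hT x x.2)))).op y
  have hr : Function.Injective r := by
    intro y z hyz
    refine (specQuot I).sheaf.eq_of_locally_eq' (fun x : T => preim I (N x)) (preim I W)
      (fun x => homOfLE (preim_mono I (hNW x (hT x x.2)))) ?_ y z fun x => congrFun hyz x
    intro q hq
    obtain ⟨x, hx, hqx⟩ := Set.mem_iUnion₂.mp (hcov hq)
    exact Opens.mem_iSup.mpr ⟨⟨x, hx⟩, hqx⟩
  let (x : T) : TopologicalSpace Γ(specQuot I, preim I (N x)) := ⊥
  have (x : T) : DiscreteTopology Γ(specQuot I, preim I (N x)) := ⟨rfl⟩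
  have hP : Continuous fun s : sections U => r ((res hWU s).1 I) := by
    refine continuous_pi fun x => ?_
    have h2 : Continuous[t, sectionTop (V (k x (hT x x.2)))] (res (hV (k x (hT x x.2)))) :=
      continuous_iInf_dom (i := k x.1 (hT x x.2)) continuous_induced_dom
    have h3 := @Continuous.comp _ _ _ t (sectionTop _) ⊥ _ _ (continuous_eval (hNV x (hT x x.2)) (hNc x (hT x x.2)) I) h2
    convert h3 using 2 with s
    change (res (hNW x (hT x x.2)) (res hWU s)).1 I = (res _ (res _ s)).1 I
    rw [res_res, res_res]
  let : TopologicalSpace Γ(specQuot I, preim I W) := ⊥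
  refine continuous_def.mpr fun S _ => ?_
  have h4 := (isOpen_discrete (r '' S)).preimage hP
  convert h4 using 1
  ext s
  simp [hr.eq_iff]

/-- The projection of the structure sheaf to its component along `I`. -/
def evalHom (U : (Opens (SpfTop A))ᵒᵖ) (I : OpenIdeal A) :
    presheaf.obj U ⟶ Γ(specQuot I, preim I U.unop) :=
  let f : CommRingCat.of (sections U.unop) ⟶ CommRingCat.of Γ(specQuot I, preim I U.unop) :=
    CommRingCat.ofHom (eval U.unop I)
  f

/-- The canonical morphism `Spec (A ⧸ I) ⟶ Spf A` of ringed spaces. -/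
def projHom (I : OpenIdeal A) : (specQuot I).toPresheafedSpace ⟶
    (⟨SpfTop A, presheaf⟩ : PresheafedSpace CommRingCat.{u}) where
  base := ofQuot I
  c := { app := fun U => evalHom U I
         naturality := fun _ _ _ => CommRingCat.hom_ext (RingHom.ext fun _ => rfl) }

/-- A section is invertible near every point at which one component is invertible. -/
lemma exists_isUnit_res (I : OpenIdeal A) (U : Opens (SpfTop A)) (s : sections U)
    (p : specQuot I) (hp : p ∈ (specQuot I).basicOpen (s.1 I)) :
    ∃ (V : Opens (SpfTop A)) (h : V ≤ U), ofQuot I p ∈ V ∧ IsUnit (res h s) := by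
  obtain ⟨K, hK⟩ := IsAdmissibleRing.exists_isIdealOfDefinition (A := A)
  let K' : OpenIdeal A := ⟨K, hK.1⟩
  -- compare components through the intersection of two open ideals
  have key (J : OpenIdeal A) (q : specQuot J) (q' : specQuot K')
      (hq : ofQuot K' q' = ofQuot J q) :
      q ∈ (specQuot J).basicOpen (s.1 J) ↔ q' ∈ (specQuot K').basicOpen (s.1 K') := by
    let L : OpenIdeal A := ⟨J.1 ⊓ K, J.2.inter hK.1⟩
    have hJ : L ≤ J := inf_le_left (a := J.1)
    have hK' : L ≤ K' := inf_le_right (a := J.1)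
    have e : specTrans hJ q = specTrans hK' q' := by
      apply PrimeSpectrum.comap_injective_of_surjective (Ideal.Quotient.mk L.1)
        Ideal.Quotient.mk_surjective
      exact congrArg Subtype.val hq.symm
    have hqU : q ∈ preim J U ↔ q' ∈ preim K' U := by
      change ofQuot J q ∈ U ↔ ofQuot K' q' ∈ U
      rw [hq]
    rw [← s.2 L J hJ, ← s.2 L K' hK', Scheme.basicOpen_appLE, Scheme.basicOpen_appLE]
    change q ∈ preim J U ∧ specTrans hJ q ∈ (specQuot L).basicOpen (s.1 L) ↔
      q' ∈ preim K' U ∧ specTrans hK' q' ∈ (specQuot L).basicOpen (s.1 L)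
    rw [hqU, e]
  obtain ⟨V, hVo, hV⟩ := (ofQuot_isInducing K').isOpen_iff.mp
    ((specQuot K').basicOpen (s.1 K')).isOpen
  have hlift (x : SpfTop A) : ∃ q' : specQuot K', ofQuot K' q' = x :=
    exists_ofQuot_eq K' x (hK.le_of_isOpen x.2)
  have hmem (J : OpenIdeal A) (q : specQuot J) :
      ofQuot J q ∈ V ↔ q ∈ (specQuot J).basicOpen (s.1 J) := by
    obtain ⟨q', hq'⟩ := hlift (ofQuot J q)
    rw [key J q q' hq', ← hq']
    exact Set.ext_iff.mp hV q'
  have hVU : (⟨V, hVo⟩ : Opens (SpfTop A)) ≤ U := by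
    intro x hx
    obtain ⟨q', rfl⟩ := hlift x
    exact (specQuot K').basicOpen_le _ ((hmem K' q').mp hx)
  refine ⟨⟨V, hVo⟩, hVU, (hmem I p).mpr hp, ?_⟩
  have hunit (J : OpenIdeal A) : IsUnit ((res hVU s).1 J) := by
    rw [res_apply]
    refine RingedSpace.isUnit_of_isUnit_germ (specQuot J).toRingedSpace _ _ fun q hq => ?_
    have h1 := (hmem J q).mp hq
    rw [Scheme.mem_basicOpen _ _ _ (preim_mono J hVU hq)] at h1
    convert h1 using 1
    exact TopCat.Presheaf.germ_res_apply _ _ _ _ _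
  choose g hg using fun J => (hunit J).exists_right_inv
  refine IsUnit.of_mul_eq_one ⟨g, fun J L h => ?_⟩ (Subtype.ext (funext hg))
  have h1 := congrArg ((specTrans h).appLE _ _ (preim_le h ⟨V, hVo⟩)) (hg J)
  rw [map_mul, map_one, (res hVU s).2 J L h] at h1
  exact (hunit L).mul_left_cancel (h1.trans (hg L).symm)

lemma isLocalHom_projHom (I : OpenIdeal A) (p : specQuot I) :
    IsLocalHom ((projHom I).stalkMap p).hom := by
  refine ⟨fun a ha => ?_⟩
  obtain ⟨U, hU, s, rfl⟩ := TopCat.Presheaf.exists_germ_eq _ a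
  have h1 := PresheafedSpace.stalkMap_germ_apply (projHom I) U p hU s
  rw [h1] at ha
  obtain ⟨V, hVU, hpV, hs⟩ := exists_isUnit_res I U s p
    ((Scheme.mem_basicOpen (specQuot I) (U := preim I U) (eval U I s) p
      (show p ∈ preim I U from hU)).mpr ha)
  have h2 := hs.map (TopCat.Presheaf.germ (presheaf (A := A)) V (ofQuot I p) hpV).hom
  have h3 := TopCat.Presheaf.germ_res_apply (presheaf (A := A)) (homOfLE hVU) (ofQuot I p) hpV s
  exact (congrArg IsUnit h3).mp h2

lemma isLocalRing_stalk (x : SpfTop A) : IsLocalRing ((presheaf (A := A)).stalk x) := by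
  obtain ⟨K, hK⟩ := IsAdmissibleRing.exists_isIdealOfDefinition (A := A)
  obtain ⟨p, rfl⟩ := exists_ofQuot_eq ⟨K, hK.1⟩ x (hK.le_of_isOpen x.2)
  have := isLocalHom_projHom ⟨K, hK.1⟩ p
  have h : IsLocalRing ((specQuot ⟨K, hK.1⟩).presheaf.stalk p) :=
    (specQuot ⟨K, hK.1⟩).isLocalRing p
  have := RingHom.domain_isLocalRing ((projHom ⟨K, hK.1⟩).stalkMap p).hom
  exact this

end Spf

/-- The formal spectrum of an admissible ring. -/
def Spf (A : Type u) [CommRing A] [TopologicalSpace A] [IsAdmissibleRing A] :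
    LocallyTopRingedSpace.{u} where
  carrier := SpfTop A
  presheaf := Spf.presheaf
  IsSheaf := Spf.isSheaf
  isLocalRing := Spf.isLocalRing_stalk
  sectionTop := Spf.sectionTop
  isTopologicalRing := Spf.isTopologicalRing
  continuous_map i := Spf.continuous_res i.le
  iInf_induced_le V U i hU := Spf.iInf_induced_le V U (fun k => (i k).le) hU

namespace Spf

variable {B : Type u} [CommRing B] [TopologicalSpace B] (φ : A →+* B) (hφ : Continuous φ)

/-- The preimage of an open ideal under a continuous homomorphism. -/
def comapIdeal (J : OpenIdeal B) : OpenIdeal A := ⟨J.1.comap φ, J.2.preimage hφ⟩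

/-- The map of underlying spaces. -/
def mapBase : SpfTop B ⟶ SpfTop A :=
  TopCat.ofHom ⟨fun p => ⟨PrimeSpectrum.comap φ p.1, p.2.preimage hφ⟩,
    ((PrimeSpectrum.continuous_comap φ).comp continuous_subtype_val).subtype_mk _⟩

/-- The morphism `Spec (B ⧸ J) ⟶ Spec (A ⧸ φ⁻¹ J)`. -/
def specMap (J : OpenIdeal B) : specQuot J ⟶ specQuot (comapIdeal φ hφ J) :=
  Spec.map (CommRingCat.ofHom (Ideal.quotientMap J.1 φ le_rfl))

lemma specMap_specTrans {J K : OpenIdeal B} (h : J ≤ K) :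
    specTrans h ≫ specMap φ hφ J = specMap φ hφ K ≫
      specTrans (I := comapIdeal φ hφ J) (J := comapIdeal φ hφ K) (Ideal.comap_mono h) := by
  simp only [specTrans, specMap]
  rw [← Spec.map_comp, ← Spec.map_comp]
  congr 1
  ext x
  rfl

variable [IsAdmissibleRing A] [IsAdmissibleRing B]

lemma preim_mapBase_le (J : OpenIdeal B) (U : Opens (SpfTop A)) :
    preim J ((Opens.map (mapBase φ hφ)).obj U) ≤
      specMap φ hφ J ⁻¹ᵁ preim (comapIdeal φ hφ J) U := le_refl _

/-- The map on sections: the `J`-component is the pullback of the `φ⁻¹ J`-component. -/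
def mapSections (U : Opens (SpfTop A)) :
    sections U →+* sections ((Opens.map (mapBase φ hφ)).obj U) :=
  RingHom.codRestrict
    (RingHom.pi fun J => ((specMap φ hφ J).appLE _ _ (preim_mapBase_le φ hφ J U)).hom.comp
      (eval U (comapIdeal φ hφ J))) _ (by
    intro s J K h
    have hs := s.2 (comapIdeal φ hφ J) (comapIdeal φ hφ K) (Ideal.comap_mono h)
    change (specTrans h).appLE _ _ _ ((specMap φ hφ J).appLE _ _ (preim_mapBase_le φ hφ J U)
      (s.1 (comapIdeal φ hφ J))) = (specMap φ hφ K).appLE _ _ (preim_mapBase_le φ hφ K U)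
        (s.1 (comapIdeal φ hφ K))
    rw [← hs]
    simp only [← CommRingCat.comp_apply]
    rw [Scheme.Hom.appLE_comp_appLE, Scheme.Hom.appLE_comp_appLE]
    simp only [specMap_specTrans])

lemma mapSections_apply (U : Opens (SpfTop A)) (s : sections U) (J : OpenIdeal B) :
    (mapSections φ hφ U s).1 J = (specMap φ hφ J).appLE _ _ (preim_mapBase_le φ hφ J U)
      (s.1 (comapIdeal φ hφ J)) := rfl

lemma mapSections_res {U V : Opens (SpfTop A)} (h : V ≤ U)
    (h' : (Opens.map (mapBase φ hφ)).obj V ≤ (Opens.map (mapBase φ hφ)).obj U) (s : sections U) :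
    mapSections φ hφ V (res h s) = res h' (mapSections φ hφ U s) := by
  refine Subtype.ext (funext fun J => ?_)
  rw [mapSections_apply, res_apply, res_apply, mapSections_apply]
  simp only [← CommRingCat.comp_apply]
  rw [Scheme.Hom.map_appLE, Scheme.Hom.appLE_map]

lemma mem_basicOpen_of_mapSections (U : Opens (SpfTop A)) (s : sections U) (J : OpenIdeal B)
    (p : specQuot J) (hp : p ∈ (specQuot J).basicOpen ((mapSections φ hφ U s).1 J)) :
    specMap φ hφ J p ∈ (specQuot (comapIdeal φ hφ J)).basicOpen (s.1 (comapIdeal φ hφ J)) := by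
  rw [mapSections_apply, Scheme.basicOpen_appLE] at hp
  exact hp.2

lemma continuous_mapSections (U : Opens (SpfTop A)) :
    Continuous[sectionTop U, sectionTop _] (mapSections φ hφ U) := by
  have := prespectralSpace (A := A)
  refine continuous_rng _ _ fun V hV hVc J => ?_
  obtain ⟨W, hWc, hWo, hVW, hWU⟩ := PrespectralSpace.exists_isCompact_and_isOpen_between
    (hVc.image (mapBase φ hφ).hom.continuous) U.isOpen (Set.image_subset_iff.mpr hV)
  let W' : Opens (SpfTop A) := ⟨W, hWo⟩
  have h1 : V ≤ (Opens.map (mapBase φ hφ)).obj W' := fun x hx => hVW ⟨x, hx, rfl⟩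
  have hWU' : W' ≤ U := hWU
  have h2 (s : sections U) : (res hV (mapSections φ hφ U s)).1 J =
      (res h1 (mapSections φ hφ W' (res hWU' s))).1 J := by
    have h3 : (Opens.map (mapBase φ hφ)).obj W' ≤ (Opens.map (mapBase φ hφ)).obj U :=
      fun x hx => hWU' hx
    rw [mapSections_res φ hφ hWU' h3, res_res]
  simp only [h2]
  exact @Continuous.comp _ _ _ (sectionTop U) ⊥ ⊥
    (fun s => (res hWU' s).1 (comapIdeal φ hφ J))
    (fun y : Γ(specQuot (comapIdeal φ hφ J), preim (comapIdeal φ hφ J) W') =>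
      (specQuot J).presheaf.map (homOfLE (preim_mono J h1)).op
        ((specMap φ hφ J).appLE _ _ (preim_mapBase_le φ hφ J W') y)) continuous_bot
    (continuous_eval hWU' hWc (comapIdeal φ hφ J))

/-- The map on sections as a morphism of rings. -/
def mapSectionsHom (U : (Opens (SpfTop A))ᵒᵖ) :
    presheaf.obj U ⟶ presheaf.obj (op ((Opens.map (mapBase φ hφ)).obj U.unop)) :=
  CommRingCat.ofHom (mapSections φ hφ U.unop)

/-- The underlying morphism of ringed spaces. -/
def mapPresheafedSpace : (⟨SpfTop B, presheaf⟩ : PresheafedSpace CommRingCat.{u}) ⟶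
    (⟨SpfTop A, presheaf⟩ : PresheafedSpace CommRingCat.{u}) where
  base := mapBase φ hφ
  c := { app := mapSectionsHom φ hφ
         naturality := fun _ _ i => CommRingCat.hom_ext
          (RingHom.ext fun s => mapSections_res φ hφ i.unop.le (fun _ hx => i.unop.le hx) s) }

lemma isLocalHom_mapPresheafedSpace (x : SpfTop B) :
    IsLocalHom ((mapPresheafedSpace φ hφ).stalkMap x).hom := by
  obtain ⟨K, hK⟩ := IsAdmissibleRing.exists_isIdealOfDefinition (A := B)
  let K' : OpenIdeal B := ⟨K, hK.1⟩
  obtain ⟨p, rfl⟩ := exists_ofQuot_eq K' x (hK.le_of_isOpen x.2)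
  refine ⟨fun a ha => ?_⟩
  obtain ⟨U, hU, s, rfl⟩ := TopCat.Presheaf.exists_germ_eq _ a
  have h1 := PresheafedSpace.stalkMap_germ_apply (mapPresheafedSpace φ hφ) U (ofQuot K' p) hU s
  rw [h1] at ha
  have h2 := ha.map ((projHom K').stalkMap p).hom
  have h3 := PresheafedSpace.stalkMap_germ_apply (projHom K')
    ((Opens.map (mapBase φ hφ)).obj U) p hU (mapSections φ hφ U s)
  replace h2 := (congrArg IsUnit h3).mp h2
  have h4 := (Scheme.mem_basicOpen (specQuot K')
    (U := preim K' ((Opens.map (mapBase φ hφ)).obj U)) ((mapSections φ hφ U s).1 K') p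
    (show p ∈ preim K' ((Opens.map (mapBase φ hφ)).obj U) from hU)).mpr h2
  obtain ⟨V, hVU, hpV, hs⟩ := exists_isUnit_res (comapIdeal φ hφ K') U s (specMap φ hφ K' p)
    (mem_basicOpen_of_mapSections φ hφ U s K' p h4)
  replace hpV : mapBase φ hφ (ofQuot K' p) ∈ V := hpV
  have h5 := hs.map (TopCat.Presheaf.germ (presheaf (A := A)) V (mapBase φ hφ (ofQuot K' p)) hpV).hom
  have h6 := TopCat.Presheaf.germ_res_apply (presheaf (A := A)) (homOfLE hVU)
    (mapBase φ hφ (ofQuot K' p)) hpV s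
  exact (congrArg IsUnit h6).mp h5

end Spf

/-- The morphism `Spf B ⟶ Spf A` induced by a continuous homomorphism `A → B`. -/
def Spf.map [IsAdmissibleRing A] {B : Type u} [CommRing B] [TopologicalSpace B]
    [IsAdmissibleRing B] (φ : A →+* B) (hφ : Continuous φ) : Spf B ⟶ Spf A where
  toLRSHom := ⟨Spf.mapPresheafedSpace φ hφ, Spf.isLocalHom_mapPresheafedSpace φ hφ⟩
  continuous_app := Spf.continuous_mapSections φ hφ

end Spf

namespace LocallyTopRingedSpace

/-- Closed immersions: every point of the target has an affine neighbourhood `Spf A` over which the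
morphism is `Spf (A ⧸ I) ⟶ Spf A` for a closed ideal `I` of `A`. -/
def IsClosedImmersion {Y X : LocallyTopRingedSpace.{u}} (f : Y ⟶ X) : Prop :=
  ∀ x : X.carrier, ∃ (A : Type u) (_ : CommRing A) (_ : TopologicalSpace A)
    (_ : IsAdmissibleRing A) (I : Ideal A) (hI : IsClosed (I : Set A)),
    haveI : IsAdmissibleRing (A ⧸ I) := IsAdmissibleRing.quotient I hI
    ∃ (a : Spf A ⟶ X) (b : Spf (A ⧸ I) ⟶ Y),
      IsOpenImmersion a ∧ IsOpenImmersion b ∧ x ∈ Set.range a.toLRSHom.base ∧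
      Set.range b.toLRSHom.base = f.toLRSHom.base ⁻¹' Set.range a.toLRSHom.base ∧
      b ≫ f = Spf.map (Ideal.Quotient.mk I) (continuous_quotientMk I) ≫ a

/-- Immersions: isomorphisms onto a closed subscheme of an open subscheme. -/
def IsImmersion {Y X : LocallyTopRingedSpace.{u}} (f : Y ⟶ X) : Prop :=
  ∃ (U : LocallyTopRingedSpace.{u}) (i : Y ⟶ U) (j : U ⟶ X),
    IsClosedImmersion i ∧ IsOpenImmersion j ∧ i ≫ j = f

/-- Ordinary schemes: schemes whose structure sheaf is regarded as a sheaf of pseudo-discrete rings,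
that is, the sections over a quasi-compact open subset carry the discrete topology. -/
def IsOrdinaryScheme (Y : LocallyTopRingedSpace.{u}) : Prop :=
  (∃ S : Scheme.{u}, Nonempty (Y.toLocallyRingedSpace ≅ S.toLocallyRingedSpace)) ∧
  ∀ U : Opens Y.carrier, IsCompact (U : Set Y.carrier) → Y.sectionTop U = ⊥

end LocallyTopRingedSpace

open LocallyTopRingedSpace

/-- Formal schemes: locally topologically ringed spaces covered by open subspaces isomorphic to
formal spectra of admissible rings. The morphisms of formal schemes are the morphisms of locally
topologically ringed spaces. -/
structure FormalScheme : Type (u + 1) extends LocallyTopRingedSpace.{u} where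
  exists_affine : ∀ x : carrier, ∃ (A : Type u) (_ : CommRing A) (_ : TopologicalSpace A)
    (_ : IsAdmissibleRing A) (j : Spf A ⟶ toLocallyTopRingedSpace),
    IsOpenImmersion j ∧ x ∈ Set.range j.toLRSHom.base

/-- Pseudo-immersions `𝒴 ⟶ 𝒳`: for every immersion `W ⟶ 𝒴` with `W` an ordinary scheme, the
composition `W ⟶ 𝒴 ⟶ 𝒳` is an immersion. -/
structure PseudoImmersion (X : FormalScheme.{u}) where
  dom : FormalScheme.{u}
  hom : dom.toLocallyTopRingedSpace ⟶ X.toLocallyTopRingedSpace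
  isImmersion_comp : ∀ (W : LocallyTopRingedSpace.{u}) (i : W ⟶ dom.toLocallyTopRingedSpace),
    IsOrdinaryScheme W → IsImmersion i → IsImmersion (i ≫ hom)

/-- Two pseudo-immersions are equivalent if they differ by an isomorphism of their sources. -/
instance PseudoImmersion.setoid (X : FormalScheme.{u}) : Setoid (PseudoImmersion X) where
  r f g := ∃ e : f.dom.toLocallyTopRingedSpace ≅ g.dom.toLocallyTopRingedSpace,
    e.hom ≫ g.hom = f.hom
  iseqv :=
    { refl := fun f => ⟨Iso.refl _, Category.id_comp _⟩
      symm := fun ⟨e, he⟩ => ⟨e.symm, by rw [← he]; exact e.inv_hom_id_assoc _⟩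
      trans := fun ⟨e, he⟩ ⟨e', he'⟩ => ⟨e ≪≫ e', by rw [← he, ← he']; exact Category.assoc _ _ _⟩ }

/-- Pseudo-subschemes of `X`: equivalence classes of pseudo-immersions into `X`. -/
def PseudoSubscheme (X : FormalScheme.{u}) : Type (u + 1) := Quotient (PseudoImmersion.setoid X)

namespace PseudoSubscheme

variable {X : FormalScheme.{u}}

/-- The pseudo-subscheme represented by a pseudo-immersion. -/
def mk (f : PseudoImmersion X) : PseudoSubscheme X := Quotient.mk _ f

/-- `Y` is closed: the map of underlying spaces is a homeomorphism onto a closed subset. -/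
def IsClosed (Y : PseudoSubscheme X) : Prop :=
  ∃ f : PseudoImmersion X, mk f = Y ∧ IsClosedEmbedding f.hom.toLRSHom.base

/-- The inclusion map of the underlying spaces is quasi-compact: preimages of quasi-compact open
subsets are quasi-compact. -/
def IsQuasiCompact (Y : PseudoSubscheme X) : Prop :=
  ∃ f : PseudoImmersion X, mk f = Y ∧ ∀ U : Opens X.carrier, IsCompact (U : Set X.carrier) →
    IsCompact (f.hom.toLRSHom.base ⁻¹' (U : Set X.carrier))

/-- `Z` contains `Y` as an open subscheme: the inclusion of `Y` into `X` is the composition of an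
open immersion `Y ⟶ Z` and the inclusion of `Z` into `X`. -/
def IsOpenSubschemeOf (Y Z : PseudoSubscheme X) : Prop :=
  ∃ f g : PseudoImmersion X, mk f = Y ∧ mk g = Z ∧
    ∃ h : f.dom.toLocallyTopRingedSpace ⟶ g.dom.toLocallyTopRingedSpace,
      IsOpenImmersion h ∧ h ≫ g.hom = f.hom

/-- `Y ≤ Z`: the inclusion of `Y` into `X` factors through the inclusion of `Z` into `X`. -/
instance : LE (PseudoSubscheme X) where
  le Y Z := ∃ f g : PseudoImmersion X, mk f = Y ∧ mk g = Z ∧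
    ∃ h : f.dom.toLocallyTopRingedSpace ⟶ g.dom.toLocallyTopRingedSpace, h ≫ g.hom = f.hom

end PseudoSubscheme

end FormalGeometry

/-! Let `f : 𝒴 → 𝒳` be a quasi-compact pseudo-immersion. The pseudo-closure is the closed set
`closure (f 𝒴)` with the subsheaf of `f_* 𝒪_𝒴` of sections that are locally limits of sections of
`𝒪_𝒳` (`ImageClosure.sub`, `ImageClosure.space`). Over an affine open `Spf A` of `𝒳` it is `Spf B`,
where `B` is the closure of the image of `A` in the ring of sections of `𝒴` over the preimage of
`Spf A`. Quasi-compactness makes that ring of sections, and with it the closed subring `B`,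
admissible, the nowhere invertible sections forming an ideal of definition. Modulo this open ideal
every element of `B` comes from `A`, so the points of `Spf B` are the points of `closure (f 𝒴)` in
`Spf A`.

To recognise a formal spectrum inside a given sheaf `G` of topological rings, `Spf.IsChart` collects
conditions under which the completed localizations of `B` embed topologically into the sections of
`G` over basic open subsets, the image being the closure of the fractions. The decisive condition is
a topological version of the fact that, on a quasi-compact scheme, a section vanishing where `s` is
invertible is killed by a power of `s` (`IsFormal.exists_nhds_pow_mul_mem`).

Pseudo-immersions are controlled through ordinary schemes. A morphism from an ordinary scheme to a
formal scheme is an immersion if and only if it is a strict embedding: an embedding with locally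
closed image, surjective on stalks (`IsImmersion.isStrictEmbedding`,
`IsStrictEmbedding.isImmersion`). Applied to the reduced space, which has the same points as the
formal scheme, this shows that pseudo-immersions are topological embeddings with locally closed
image. Applied to the quotients of an affine open `Spf C` of the source by open ideals of `C`, it
shows that the sections of the target are locally dense in those of the source
(`IsPseudoImmersion.denseRange_toPre`, `IsPseudoImmersion.exists_approx`).

The rest follows from this density. Over the open part `f 𝒴` of its closure the subsheaf is all of
`𝒪_𝒴`, so `𝒴` is an open subscheme of the pseudo-closure. If `f` factors through a closed
pseudo-subscheme `𝒵`, then sections of `𝒵` pull back to local limits of sections of `𝒪_𝒳`, so the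
pseudo-closure maps to `𝒵` (`ImageClosure.exists_factor`). An endomorphism of a pseudo-subscheme
over `𝒳` is the identity, hence `≤` is antisymmetric and the least element is unique. Finally the
pseudo-closure is itself a pseudo-subscheme because limits in discrete rings are attained, so that
surjectivity on stalks persists for ordinary subschemes. -/

namespace FormalGeometry

/-! ### Complete linearly topologized rings. -/

section TopologicalAlgebra

/-- Separated and complete topological rings with a basis of neighbourhoods of `0` consisting of
ideals. -/
class IsCompleteLinear (R : Type*) [CommRing R] [TopologicalSpace R] : Prop
    extends IsTopologicalRing R, T2Space R where
  exists_ideal_subset : ∀ N ∈ 𝓝 (0 : R), ∃ I : Ideal R, IsOpen (I : Set R) ∧ (I : Set R) ⊆ N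
  complete : @CompleteSpace R (IsTopologicalAddGroup.rightUniformSpace R)

lemma isOpen_ideal_of_le {R : Type*} [CommRing R] [TopologicalSpace R] [IsTopologicalRing R]
    {I J : Ideal R} (h : I ≤ J) (hI : IsOpen (I : Set R)) : IsOpen (J : Set R) :=
  AddSubgroup.isOpen_mono (H₁ := I.toAddSubgroup) (H₂ := J.toAddSubgroup) h hI

lemma isOpen_ideal_of_mem_nhds {R : Type*} [CommRing R] [TopologicalSpace R] [IsTopologicalRing R]
    {I : Ideal R} (hI : (I : Set R) ∈ 𝓝 0) : IsOpen (I : Set R) :=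
  AddSubgroup.isOpen_of_mem_nhds I.toAddSubgroup hI

/-- A closed subring of a complete ring is complete, and ideals pull back to ideals. Limits and
rings of sections are treated in this way, as closed subrings of products. -/
lemma IsCompleteLinear.of_isInducing {R S : Type*} [CommRing R] [TopologicalSpace R]
    [IsTopologicalRing R] [CommRing S] [TopologicalSpace S] [IsCompleteLinear S] (f : R →+* S)
    (hf : IsInducing f) (hinj : Function.Injective f) (hcl : IsClosed (Set.range f)) :
    IsCompleteLinear R where
  toT2Space := T2Space.of_injective_continuous hinj hf.continuous
  exists_ideal_subset N hN := by
    rw [hf.nhds_eq_comap, map_zero] at hN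
    obtain ⟨M, hM, hMN⟩ := hN
    obtain ⟨I, hI, hIM⟩ := IsCompleteLinear.exists_ideal_subset M hM
    exact ⟨I.comap f, hI.preimage hf.continuous, fun x hx => hMN (hIM hx)⟩
  complete := by
    let := IsTopologicalAddGroup.rightUniformSpace R
    let := IsTopologicalAddGroup.rightUniformSpace S
    have : IsUniformAddGroup R := isUniformAddGroup_of_addCommGroup
    have : IsUniformAddGroup S := isUniformAddGroup_of_addCommGroup
    have : CompleteSpace S := IsCompleteLinear.complete
    have h := AddMonoidHom.isUniformInducing_of_isInducing (f := f) hf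
    exact h.completeSpace hcl.isComplete

lemma IsCompleteLinear.of_discrete {R : Type*} [CommRing R] [TopologicalSpace R]
    [DiscreteTopology R] : IsCompleteLinear R where
  exists_ideal_subset N hN := ⟨⊥, isOpen_discrete _, by simpa using mem_of_mem_nhds hN⟩
  complete := by
    let := IsTopologicalAddGroup.rightUniformSpace R
    have h : IsUniformAddGroup R := isUniformAddGroup_of_addCommGroup
    have : DiscreteUniformity R := by
      rw [discreteUniformity_iff_setRelId_mem_uniformity, uniformity_eq_comap_nhds_zero,
        nhds_discrete]
      refine ⟨{0}, by simp, fun x hx => ?_⟩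
      have hx' : x.2 - x.1 = 0 := hx
      exact (sub_eq_zero.mp hx').symm
    infer_instance

instance IsCompleteLinear.pi {ι : Type*} (R : ι → Type*) [∀ i, CommRing (R i)]
    [∀ i, TopologicalSpace (R i)] [∀ i, IsCompleteLinear (R i)] :
    IsCompleteLinear (∀ i, R i) where
  exists_ideal_subset N hN := by
    rw [nhds_pi, Filter.mem_pi] at hN
    obtain ⟨s, hs, t, ht, hN⟩ := hN
    choose I hI hI' using fun i => IsCompleteLinear.exists_ideal_subset (t i) (ht i)
    refine ⟨⨅ i ∈ s, (I i).comap (Pi.evalRingHom R i), ?_, ?_⟩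
    · have : ((⨅ i ∈ s, (I i).comap (Pi.evalRingHom R i) : Ideal (∀ i, R i)) : Set (∀ i, R i)) =
          ⋂ i ∈ s, (fun x => x i) ⁻¹' (I i : Set (R i)) := by
        ext x; simp
      rw [this]
      exact hs.isOpen_biInter fun i _ => (hI i).preimage (continuous_apply i)
    · intro x hx
      refine hN fun i hi => hI' i ?_
      have := (Submodule.mem_iInf _).mp hx i
      exact (Submodule.mem_iInf _).mp this hi
  complete := by
    let (i : ι) := IsTopologicalAddGroup.rightUniformSpace (R i)
    have (i : ι) : IsUniformAddGroup (R i) := isUniformAddGroup_of_addCommGroup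
    have (i : ι) : CompleteSpace (R i) := IsCompleteLinear.complete
    have h : CompleteSpace (∀ i, R i) := inferInstance
    convert h
    exact IsUniformAddGroup.rightUniformSpace_eq

instance (priority := 100) IsAdmissibleRing.isCompleteLinear (A : Type*) [CommRing A]
    [TopologicalSpace A] [IsAdmissibleRing A] : IsCompleteLinear A where
  exists_ideal_subset N hN := by
    obtain ⟨I, -, hb⟩ := IsAdmissibleRing.exists_basis (A := A)
    obtain ⟨n, -, hn⟩ := hb.mem_iff.mp hN
    exact ⟨I n, isOpen_ideal_of_mem_nhds (hb.mem_of_mem trivial), hn⟩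
  complete := IsAdmissibleRing.complete

/-- A complete linearly topologized ring is admissible if it has a countable basis of
neighbourhoods of `0` and an ideal of definition. -/
lemma IsCompleteLinear.isAdmissibleRing {R : Type*} [CommRing R] [TopologicalSpace R]
    [IsCompleteLinear R] [(𝓝 (0 : R)).IsCountablyGenerated]
    (h : ∃ I : Ideal R, IsIdealOfDefinition I) : IsAdmissibleRing R where
  exists_basis := by
    obtain ⟨x, hx⟩ := (𝓝 (0 : R)).exists_antitone_basis
    choose I hI hIx using fun n => IsCompleteLinear.exists_ideal_subset (x n) (hx.1.mem_of_mem trivial)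
    have hop (n : ℕ) : IsOpen ((⨅ k ∈ Finset.range (n + 1), I k : Ideal R) : Set R) := by
      have : ((⨅ k ∈ Finset.range (n + 1), I k : Ideal R) : Set R) =
          ⋂ k ∈ Finset.range (n + 1), (I k : Set R) := by ext; simp
      rw [this]
      exact isOpen_biInter_finset fun k _ => hI k
    -- Intersecting the first `n + 1` ideals makes the sequence descending; the bound `n + 1`
    -- ensures that the `n`-th term lies in `I n`.
    refine ⟨fun n => ⨅ k ∈ Finset.range (n + 1), I k, fun m n h => ?_, ⟨fun N => ?_⟩⟩
    · refine biInf_mono fun k hk => ?_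
      simp only [Finset.mem_range] at hk ⊢
      omega
    · refine ⟨fun hN => ?_, fun ⟨n, _, hn⟩ =>
        Filter.mem_of_superset ((hop n).mem_nhds (Submodule.zero_mem _)) hn⟩
      obtain ⟨n, -, hn⟩ := hx.1.mem_iff.mp hN
      refine ⟨n, trivial, fun y hy => hn (hIx n ?_)⟩
      exact (iInf₂_le n (by simp) : (⨅ k ∈ Finset.range (n + 1), I k) ≤ I n) hy
  complete := IsCompleteLinear.complete
  exists_isIdealOfDefinition := h

lemma mem_closure_of_forall_sub_mem {G : Type*} [AddGroup G] [TopologicalSpace G]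
    [IsTopologicalAddGroup G] {S : Set G} {y : G} (h : ∀ N ∈ 𝓝 (0 : G), ∃ s ∈ S, s - y ∈ N) :
    y ∈ closure S := by
  rw [mem_closure_iff_nhds]
  intro t ht
  have h1 : (fun x => x + y) ⁻¹' t ∈ 𝓝 (0 : G) :=
    (continuous_add_const y).continuousAt.preimage_mem_nhds (by simpa using ht)
  obtain ⟨s, hs, hsy⟩ := h _ h1
  exact ⟨s, by simpa using hsy, hs⟩

lemma exists_sub_mem_of_mem_closure {G : Type*} [AddGroup G] [TopologicalSpace G]
    [IsTopologicalAddGroup G] {S : Set G} {y : G} (h : y ∈ closure S) {N : Set G}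
    (hN : N ∈ 𝓝 (0 : G)) : ∃ s ∈ S, s - y ∈ N := by
  rw [mem_closure_iff_nhds] at h
  obtain ⟨s, hs, hs'⟩ := h ((fun x => x - y) ⁻¹' N)
    ((continuous_sub_right y).continuousAt.preimage_mem_nhds (by simpa using hN))
  exact ⟨s, hs', hs⟩

/-- Extension by continuity to a ring in which the source is dense. -/
lemma exists_isInducing_extension {L P Q : Type*} [CommRing L] [CommRing P] [TopologicalSpace P]
    [IsCompleteLinear P] [CommRing Q] [TopologicalSpace Q] [IsCompleteLinear Q]
    (i : L →+* P) (f : L →+* Q) (hd : DenseRange i)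
    (h : (𝓝 (0 : P)).comap i = (𝓝 (0 : Q)).comap f) :
    ∃ θ : P →+* Q, θ.comp i = f ∧ IsInducing θ := by
  let : TopologicalSpace L := TopologicalSpace.induced i inferInstance
  have h1 : ContinuousAdd L := continuousAdd_induced i
  have h2 : ContinuousMul L := continuousMul_induced i
  have h3 : IsTopologicalAddGroup L := topologicalAddGroup_induced i
  have hi : IsInducing i := ⟨rfl⟩
  -- The topologies pulled back along `i` and `f` are both group topologies, so they agree as soon
  -- as their neighbourhoods of zero do, which is the hypothesis.
  have hf : IsInducing f := by
    refine ⟨IsTopologicalAddGroup.ext h3 (topologicalAddGroup_induced f) ?_⟩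
    rw [hi.nhds_eq_comap, nhds_induced, map_zero, map_zero, h]
  let := IsTopologicalAddGroup.rightUniformSpace L
  let := IsTopologicalAddGroup.rightUniformSpace P
  let := IsTopologicalAddGroup.rightUniformSpace Q
  have : IsUniformAddGroup L := isUniformAddGroup_of_addCommGroup
  have : IsUniformAddGroup P := isUniformAddGroup_of_addCommGroup
  have : IsUniformAddGroup Q := isUniformAddGroup_of_addCommGroup
  have : CompleteSpace P := IsCompleteLinear.complete
  have : CompleteSpace Q := IsCompleteLinear.complete
  have hi' := AddMonoidHom.isUniformInducing_of_isInducing (f := i) hi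
  have hf' := AddMonoidHom.isUniformInducing_of_isInducing (f := f) hf
  refine ⟨IsDenseInducing.extendRingHom hi' hd hf'.uniformContinuous, ?_, ?_⟩
  · ext x
    exact IsDenseInducing.extend_eq (hi'.isDenseInducing hd) hf'.uniformContinuous.continuous x
  · exact ((hi'.isDenseInducing hd).isUniformInducing_extend hi' hf').isInducing

end TopologicalAlgebra

end FormalGeometry

/-! ### Sections of the structure sheaf of `Spf A` as a limit of discrete rings. -/

namespace FormalGeometry

section AffineOpens

lemma exists_pow_mul_eq_zero_of_res_basicOpen {S : Scheme.{u}} {U : S.Opens} (hU : IsAffineOpen U)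
    (b c : Γ(S, U)) (h : S.presheaf.map (homOfLE (S.basicOpen_le b)).op c = 0) :
    ∃ k : ℕ, b ^ k * c = 0 := by
  have := hU.isLocalization_basicOpen b
  have h' : algebraMap Γ(S, U) Γ(S, S.basicOpen b) c = 0 := h
  obtain ⟨⟨_, k, rfl⟩, hk⟩ := (IsLocalization.map_eq_zero_iff (Submonoid.powers b) _ c).mp h'
  exact ⟨k, hk⟩

lemma exists_pow_mul_eq_res_basicOpen {S : Scheme.{u}} {U : S.Opens} (hU : IsAffineOpen U)
    (b : Γ(S, U)) (y : Γ(S, S.basicOpen b)) : ∃ (c : Γ(S, U)) (k : ℕ),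
    S.presheaf.map (homOfLE (S.basicOpen_le b)).op b ^ k * y =
      S.presheaf.map (homOfLE (S.basicOpen_le b)).op c := by
  have := hU.isLocalization_basicOpen b
  obtain ⟨⟨c, _, k, rfl⟩, hk⟩ := IsLocalization.surj (Submonoid.powers b) y
  refine ⟨c, k, ?_⟩
  rw [mul_comm, ← map_pow]
  exact hk

end AffineOpens

namespace Spf

set_option linter.unusedSectionVars false

noncomputable section

variable {A : Type u} [CommRing A] [TopologicalSpace A]

/-- The basic open subset of `Spf A` on which `a` does not vanish. -/
def basicOpen (a : A) : Opens (SpfTop A) :=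
  ⟨{p | a ∉ p.1.asIdeal}, (PrimeSpectrum.basicOpen a).isOpen.preimage continuous_subtype_val⟩

lemma isBasis_basicOpen : Opens.IsBasis (Set.range (basicOpen (A := A))) := by
  rw [Opens.isBasis_iff_nbhd]
  intro U p hp
  obtain ⟨V, hV, hVU⟩ := isOpen_induced_iff.mp U.isOpen
  obtain ⟨_, ⟨_, ⟨a, rfl⟩, rfl⟩, hpa, haV⟩ :=
    PrimeSpectrum.isBasis_basic_opens.exists_subset_of_mem_open
      (show p.1 ∈ V from by rw [← SetLike.mem_coe, ← hVU] at hp; exact hp) hV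
  refine ⟨_, ⟨a, rfl⟩, hpa, fun q hq => ?_⟩
  rw [← SetLike.mem_coe, ← hVU]
  exact haV hq

lemma exists_basicOpen_le {U : Opens (SpfTop A)} {p : SpfTop A} (hp : p ∈ U) :
    ∃ a : A, p ∈ basicOpen a ∧ basicOpen a ≤ U := by
  obtain ⟨_, ⟨a, rfl⟩, h1, h2⟩ := Opens.isBasis_iff_nbhd.mp isBasis_basicOpen hp
  exact ⟨a, h1, h2⟩

variable [IsTopologicalRing A]

/-- The global section of `Spec (A ⧸ I)` given by an element of `A`. -/
def toΓ (I : OpenIdeal A) : A →+* Γ(specQuot I, ⊤) :=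
  (Scheme.ΓSpecIso (CommRingCat.of (A ⧸ I.1))).inv.hom.comp (Ideal.Quotient.mk I.1)

lemma toΓ_surjective (I : OpenIdeal A) : Function.Surjective (toΓ I) := by
  intro x
  obtain ⟨a, ha⟩ := Ideal.Quotient.mk_surjective ((Scheme.ΓSpecIso (CommRingCat.of (A ⧸ I.1))).hom x)
  refine ⟨a, ?_⟩
  change (Scheme.ΓSpecIso (CommRingCat.of (A ⧸ I.1))).inv (Ideal.Quotient.mk I.1 a) = x
  rw [ha, Iso.hom_inv_id_apply]

lemma toΓ_eq_zero_iff (I : OpenIdeal A) (a : A) : toΓ I a = 0 ↔ a ∈ I.1 := by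
  rw [← Ideal.Quotient.eq_zero_iff_mem]
  refine ⟨fun h => ?_, fun h => ?_⟩
  · have h2 := congrArg (Scheme.ΓSpecIso (CommRingCat.of (A ⧸ I.1))).hom h
    rw [map_zero] at h2
    rw [← h2]
    exact (Iso.inv_hom_id_apply (Scheme.ΓSpecIso (CommRingCat.of (A ⧸ I.1)))
      (Ideal.Quotient.mk I.1 a)).symm
  · change (Scheme.ΓSpecIso (CommRingCat.of (A ⧸ I.1))).inv (Ideal.Quotient.mk I.1 a) = 0
    rw [h, map_zero]

lemma basicOpen_toΓ (I : OpenIdeal A) (a : A) :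
    (specQuot I).basicOpen (toΓ I a) = preim I (basicOpen a) := by
  refine (basicOpen_eq_of_affine (R := CommRingCat.of (A ⧸ I.1)) (Ideal.Quotient.mk I.1 a)).trans ?_
  rfl

lemma specTrans_toΓ {I J : OpenIdeal A} (h : I ≤ J) (a : A) :
    (specTrans h).appTop (toΓ I a) = toΓ J a := by
  have h2 := congr($(Scheme.ΓSpecIso_inv_naturality
    (CommRingCat.ofHom (Ideal.Quotient.factor h))) (Ideal.Quotient.mk I.1 a))
  exact h2.symm

/-- The section of the structure sheaf of `Spf A` given by an element of `A`. -/
def toSections (U : Opens (SpfTop A)) : A →+* sections U :=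
  RingHom.codRestrict (RingHom.pi fun I =>
    ((specQuot I).presheaf.map (homOfLE (le_top : preim I U ≤ ⊤)).op).hom.comp (toΓ I))
    (sections U) (by
      intro a I J h
      change (specTrans h).appLE _ _ _ ((specQuot I).presheaf.map _ (toΓ I a)) =
        (specQuot J).presheaf.map _ (toΓ J a)
      rw [← specTrans_toΓ h]
      simp only [← CommRingCat.comp_apply]
      rw [Scheme.Hom.map_appLE]
      rfl)

lemma toSections_apply (U : Opens (SpfTop A)) (a : A) (I : OpenIdeal A) :
    (toSections U a).1 I = (specQuot I).presheaf.map (homOfLE (le_top : preim I U ≤ ⊤)).op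
      (toΓ I a) := rfl

@[simp] lemma res_toSections {U V : Opens (SpfTop A)} (h : V ≤ U) (a : A) :
    res h (toSections U a) = toSections V a := by
  refine Subtype.ext (funext fun I => ?_)
  rw [res_apply, toSections_apply, toSections_apply, ← CommRingCat.comp_apply, ← Functor.map_comp]
  rfl

lemma toSections_top_apply (a : A) (I : OpenIdeal A) :
    (toSections ⊤ a).1 I = toΓ I a := by
  rw [toSections_apply]
  exact congr($((specQuot I).presheaf.map_id _) (toΓ I a))

lemma apply_eq_zero_of_le {U : Opens (SpfTop A)} (s : sections U) {I J : OpenIdeal A} (h : I ≤ J)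
    (hs : s.1 I = 0) : s.1 J = 0 := by
  rw [← s.2 I J h, hs, map_zero]

instance (U : Opens (SpfTop A)) : TopologicalSpace (sections U) := sectionTop U

instance (U : Opens (SpfTop A)) : IsTopologicalRing (sections U) := isTopologicalRing U

/-- The ideal of the sections whose `I`-component vanishes. -/
def kerEval (U : Opens (SpfTop A)) (I : OpenIdeal A) : Ideal (sections U) :=
  RingHom.ker (eval U I)

@[simp] lemma mem_kerEval {U : Opens (SpfTop A)} {I : OpenIdeal A} {s : sections U} :
    s ∈ kerEval U I ↔ s.1 I = 0 := Iff.rfl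

/-- When `U` is quasi-compact it occurs itself among the `V` defining the topology, and the
conditions for smaller `V` follow from the one for `U`. Hence the topology is that of a subspace of
a product of discrete rings. -/
lemma isInducing_eval {U : Opens (SpfTop A)} (hU : IsCompact (U : Set (SpfTop A))) :
    @IsInducing _ _ (sectionTop U) (@Pi.topologicalSpace _ _ fun _ => ⊥)
      (fun s : sections U => fun I => s.1 I) := by
  refine @IsInducing.mk _ _ (_) (_) _ (le_antisymm ?_ ?_)
  · rw [← continuous_iff_le_induced]
    refine @continuous_pi _ _ _ (_) (fun _ => ⊥) _ fun I => ?_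
    have := continuous_eval (le_refl U) hU I
    simpa only [res_refl] using this
  · refine le_iInf fun V => le_iInf fun I => ?_
    rw [← continuous_iff_le_induced]
    refine @Continuous.comp _ _ _ (_) ⊥ ⊥ (fun s : sections U => s.1 I)
      (fun x : Γ(specQuot I, preim I U) =>
        (specQuot I).presheaf.map (homOfLE (preim_mono I V.2.1)).op x) continuous_bot ?_
    refine @Continuous.comp _ _ _ (_) (@Pi.topologicalSpace _ _ fun _ => ⊥) ⊥ _ (fun y => y I)
      (@continuous_apply _ _ (fun _ => ⊥) I) continuous_induced_dom

lemma isOpen_kerEval {U : Opens (SpfTop A)} (hU : IsCompact (U : Set (SpfTop A)))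
    (I : OpenIdeal A) : IsOpen (kerEval U I : Set (sections U)) := by
  have h := continuous_eval (le_refl U) hU I
  simp only [res_refl] at h
  exact @IsOpen.preimage _ _ (_) ⊥ _ h {0} trivial

lemma nhds_zero_hasBasis {U : Opens (SpfTop A)} (hU : IsCompact (U : Set (SpfTop A))) :
    (𝓝 (0 : sections U)).HasBasis (fun _ : OpenIdeal A => True) fun I => (kerEval U I : Set _) := by
  refine ⟨fun N => ⟨fun hN => ?_, fun ⟨I, _, hI⟩ => Filter.mem_of_superset
    ((isOpen_kerEval hU I).mem_nhds (Submodule.zero_mem _)) hI⟩⟩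
  rw [@IsInducing.nhds_eq_comap _ _ (_) (@Pi.topologicalSpace _ _ fun _ => ⊥) _
    (isInducing_eval hU)] at hN
  obtain ⟨M, hM, hMN⟩ := hN
  rw [@nhds_pi _ _ (fun _ => ⊥), Filter.mem_pi] at hM
  obtain ⟨F, hF, t, ht, hM⟩ := hM
  lift F to Finset (OpenIdeal A) using hF
  -- A neighbourhood in the product restricts only finitely many components; the intersection of the
  -- corresponding ideals is again open and controls all of them.
  let K : OpenIdeal A := ⟨F.inf Subtype.val, by
    have : ((F.inf Subtype.val : Ideal A) : Set A) = ⋂ I ∈ F, (I.1 : Set A) := by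
      ext x; simp
    rw [this]
    exact isOpen_biInter_finset fun I _ => I.2⟩
  refine ⟨K, trivial, fun s hs => hMN (hM fun I hI => ?_)⟩
  have h1 : s.1 I = 0 := apply_eq_zero_of_le s (I := K) (J := I)
    (show F.inf Subtype.val ≤ I.1 from Finset.inf_le hI) hs
  change s.1 I ∈ t I
  rw [h1]
  exact @mem_of_mem_nhds _ ⊥ _ _ (ht I)

/-- The compatibility conditions cut out a closed subring of a product of discrete rings. -/
lemma isCompleteLinear_sections {U : Opens (SpfTop A)} (hU : IsCompact (U : Set (SpfTop A))) :
    IsCompleteLinear (sections U) := by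
  let (I : OpenIdeal A) : TopologicalSpace Γ(specQuot I, preim I U) := ⊥
  have (I : OpenIdeal A) : DiscreteTopology Γ(specQuot I, preim I U) := ⟨rfl⟩
  have (I : OpenIdeal A) : IsCompleteLinear Γ(specQuot I, preim I U) := .of_discrete
  refine IsCompleteLinear.of_isInducing (sections U).subtype (isInducing_eval hU)
    Subtype.val_injective ?_
  have : Set.range (sections U).subtype = ⋂ (I : OpenIdeal A) (J : OpenIdeal A) (h : I ≤ J),
      {s | (specTrans h).appLE (preim I U) (preim J U) (preim_le h U) (s I) = s J} := by
    ext s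
    simp only [Set.mem_iInter]
    exact ⟨by rintro ⟨t, rfl⟩; exact t.2, fun h => ⟨⟨s, h⟩, rfl⟩⟩
  rw [this]
  refine isClosed_iInter fun I => isClosed_iInter fun J => isClosed_iInter fun h => ?_
  exact isClosed_eq (continuous_of_discreteTopology.comp (continuous_apply I)) (continuous_apply J)

end

end Spf

end FormalGeometry

/-! ### Basic open subsets of `Spf A` and completed localization. -/

namespace FormalGeometry

namespace Spf

set_option linter.unusedSectionVars false

noncomputable section

variable {A : Type u} [CommRing A] [TopologicalSpace A] [IsAdmissibleRing A]

/-- The canonical morphism `Spec (A ⧸ I) ⟶ Spf A` of locally ringed spaces. -/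
def proj (I : OpenIdeal A) : (specQuot I).toLocallyRingedSpace ⟶ (Spf A).toLocallyRingedSpace :=
  ⟨projHom I, isLocalHom_projHom I⟩

/-- The open subset where a section is invertible. -/
def nonvanishing {U : Opens (SpfTop A)} (s : sections U) : Opens (SpfTop A) :=
  RingedSpace.basicOpen (X := (Spf A).toRingedSpace) (U := U) s

lemma nonvanishing_le {U : Opens (SpfTop A)} (s : sections U) : nonvanishing s ≤ U :=
  RingedSpace.basicOpen_le (X := (Spf A).toRingedSpace) (U := U) s

lemma isUnit_res_nonvanishing {U : Opens (SpfTop A)} (s : sections U) :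
    IsUnit (res (nonvanishing_le s) s) :=
  RingedSpace.isUnit_res_basicOpen (X := (Spf A).toRingedSpace) (U := U) s

lemma preim_nonvanishing (I : OpenIdeal A) {U : Opens (SpfTop A)} (s : sections U) :
    preim I (nonvanishing s) = (specQuot I).basicOpen (s.1 I) :=
  LocallyRingedSpace.preimage_basicOpen (proj I) (U := U) s

/-- An ideal of definition lies in every open prime, so `Spec (A ⧸ I)` already has all the points of
`Spf A`. -/
lemma ext_preim {I : OpenIdeal A} (hI : IsIdealOfDefinition I.1) {U V : Opens (SpfTop A)}
    (h : preim I U = preim I V) : U = V := by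
  ext p
  obtain ⟨q, rfl⟩ := exists_ofQuot_eq I p (hI.le_of_isOpen p.2)
  exact SetLike.ext_iff.mp h q

variable (A) in
lemma exists_openIdeal_isIdealOfDefinition : ∃ I : OpenIdeal A, IsIdealOfDefinition I.1 := by
  obtain ⟨K, hK⟩ := IsAdmissibleRing.exists_isIdealOfDefinition (A := A)
  exact ⟨⟨K, hK.1⟩, hK⟩

lemma nonvanishing_toSections (U : Opens (SpfTop A)) (a : A) :
    nonvanishing (toSections U a) = basicOpen a ⊓ U := by
  obtain ⟨I, hI⟩ := exists_openIdeal_isIdealOfDefinition A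
  refine ext_preim hI ?_
  rw [preim_nonvanishing, toSections_apply, Scheme.basicOpen_res, basicOpen_toΓ, inf_comm]
  rfl

/-- Open subsets meeting all the `Spec (A ⧸ I)` in affine open subsets. -/
def IsAff (U : Opens (SpfTop A)) : Prop := ∀ I : OpenIdeal A, IsAffineOpen (preim I U)

lemma isAff_top : IsAff (⊤ : Opens (SpfTop A)) := fun I => isAffineOpen_top (specQuot I)

lemma IsAff.isAff_nonvanishing {U : Opens (SpfTop A)} (hU : IsAff U) (s : sections U) :
    IsAff (nonvanishing s) := fun I => by
  rw [preim_nonvanishing]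
  exact (hU I).basicOpen _

lemma isAff_basicOpen (a : A) : IsAff (basicOpen a) := by
  have := (isAff_top (A := A)).isAff_nonvanishing (toSections ⊤ a)
  rwa [nonvanishing_toSections, inf_top_eq] at this

lemma IsAff.isCompact {U : Opens (SpfTop A)} (hU : IsAff U) : IsCompact (U : Set (SpfTop A)) := by
  obtain ⟨I, hI⟩ := exists_openIdeal_isIdealOfDefinition A
  have h := (hU I).isCompact.image (ofQuot I).hom.continuous
  convert h
  ext p
  refine ⟨fun hp => ?_, ?_⟩
  · obtain ⟨q, rfl⟩ := exists_ofQuot_eq I p (hI.le_of_isOpen p.2)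
    exact ⟨q, hp, rfl⟩
  · rintro ⟨q, hq, rfl⟩
    exact hq

lemma isCompact_basicOpen (a : A) : IsCompact (basicOpen a : Set (SpfTop A)) :=
  (isAff_basicOpen a).isCompact

lemma IsAff.exists_pow_mul_apply_eq_zero {U : Opens (SpfTop A)} (hU : IsAff U) (s c : sections U)
    (I : OpenIdeal A) (h : (res (nonvanishing_le s) c).1 I = 0) :
    ∃ k : ℕ, (s ^ k * c).1 I = 0 := by
  refine exists_pow_mul_eq_zero_of_res_basicOpen (hU I) (s.1 I) (c.1 I) ?_
  have e := preim_nonvanishing I s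
  rw [res_apply] at h
  have h2 := congrArg ((specQuot I).presheaf.map (homOfLE e.ge).op) h
  rw [map_zero, ← CommRingCat.comp_apply, ← Functor.map_comp] at h2
  exact h2

lemma IsAff.exists_pow_mul_apply_eq {U : Opens (SpfTop A)} (hU : IsAff U) (s : sections U)
    (y : sections (nonvanishing s)) (I : OpenIdeal A) :
    ∃ (c : Γ(specQuot I, preim I U)) (k : ℕ), (res (nonvanishing_le s) s ^ k * y).1 I =
      (specQuot I).presheaf.map (homOfLE (preim_mono I (nonvanishing_le s))).op c := by
  have e := preim_nonvanishing I s
  obtain ⟨c, k, h⟩ := exists_pow_mul_eq_res_basicOpen (hU I) (s.1 I)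
    ((specQuot I).presheaf.map (homOfLE e.ge).op (y.1 I))
  refine ⟨c, k, ?_⟩
  have h2 := congrArg ((specQuot I).presheaf.map (homOfLE e.le).op) h
  simp only [map_mul, map_pow, ← CommRingCat.comp_apply, ← Functor.map_comp] at h2
  refine Eq.trans ?_ h2
  change (res (nonvanishing_le s) s).1 I ^ k * y.1 I = _
  rw [res_apply]
  congr 1

lemma toSections_top_apply_surjective (I : OpenIdeal A) (c : Γ(specQuot I, preim I ⊤)) :
    ∃ d : A, (toSections ⊤ d).1 I = c := by
  obtain ⟨d, hd⟩ := toΓ_surjective I c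
  exact ⟨d, (toSections_top_apply d I).trans hd⟩

lemma exists_pow_mul_sub_toSections_mem (s : sections (⊤ : Opens (SpfTop A)))
    (y : sections (nonvanishing s)) (I : OpenIdeal A) :
    ∃ (c : A) (k : ℕ), res (nonvanishing_le s) s ^ k * y - toSections _ c ∈
      kerEval (nonvanishing s) I := by
  obtain ⟨c, k, h⟩ := isAff_top.exists_pow_mul_apply_eq s y I
  obtain ⟨d, rfl⟩ := toSections_top_apply_surjective I c
  refine ⟨d, k, ?_⟩
  rw [← res_apply (nonvanishing_le s), res_toSections] at h
  rw [mem_kerEval]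
  exact sub_eq_zero.mpr h

/-- The open subset is a variable `W` with an equation because `basicOpen a` and `nonvanishing
(toSections ⊤ a)` are not definitionally equal; a variable can be substituted. The same device
recurs below. -/
lemma exists_pow_mul_sub_toSections_mem_of_eq (s : sections (⊤ : Opens (SpfTop A))) (a : A)
    {W : Opens (SpfTop A)} (hW : W = nonvanishing s) (hs : res le_top s = toSections W a)
    (y : sections W) (I : OpenIdeal A) :
    ∃ (c : A) (k : ℕ), toSections W a ^ k * y - toSections W c ∈ kerEval W I := by
  subst hW
  rw [← hs]
  exact exists_pow_mul_sub_toSections_mem s y I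

/-- Modulo an open ideal, the sections over a basic open subset are fractions. -/
lemma exists_pow_mul_apply_eq_toSections (a : A) (y : sections (basicOpen a)) (I : OpenIdeal A) :
    ∃ (c : A) (k : ℕ), toSections _ a ^ k * y - toSections _ c ∈ kerEval (basicOpen a) I :=
  exists_pow_mul_sub_toSections_mem_of_eq (toSections ⊤ a) a
    (by rw [nonvanishing_toSections, inf_top_eq]) (res_toSections _ a) y I

lemma exists_pow_mul_mem_of_toSections_mem_kerEval (a c : A) (I : OpenIdeal A)
    (h : toSections (basicOpen a) c ∈ kerEval (basicOpen a) I) : ∃ k : ℕ, a ^ k * c ∈ I.1 := by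
  have e : nonvanishing (toSections ⊤ a) = basicOpen a := by
    rw [nonvanishing_toSections, inf_top_eq]
  obtain ⟨k, hk⟩ := (isAff_top (A := A)).exists_pow_mul_apply_eq_zero (toSections ⊤ a)
    (toSections ⊤ c) I (by
      rw [res_toSections, ← res_toSections e.le, res_apply, mem_kerEval.mp h, map_zero])
  refine ⟨k, ?_⟩
  rw [← map_pow, ← map_mul, toSections_top_apply] at hk
  exact (toΓ_eq_zero_iff I _).mp hk

lemma isUnit_toSections_basicOpen (a : A) : IsUnit (toSections (basicOpen a) a) := by
  have e : nonvanishing (toSections ⊤ a) = basicOpen a := by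
    rw [nonvanishing_toSections, inf_top_eq]
  have h := (isUnit_res_nonvanishing (toSections ⊤ a)).map (res e.ge)
  rwa [res_res, res_toSections] at h

lemma toSections_mem_kerEval {U : Opens (SpfTop A)} {I : OpenIdeal A} {c : A} (hc : c ∈ I.1) :
    toSections U c ∈ kerEval U I := by
  rw [mem_kerEval, toSections_apply, (toΓ_eq_zero_iff I c).mpr hc, map_zero]

/-- The `I`-component is constant on the cosets of the open ideal `I`. -/
lemma continuous_toSections (U : Opens (SpfTop A)) : Continuous (toSections U) := by
  refine continuous_rng _ _ fun V hV hVc I => ?_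
  simp only [res_toSections]
  refine @Continuous.mk _ _ (_) ⊥ _ fun S _ => ?_
  rw [isOpen_iff_mem_nhds]
  intro x hx
  have h := (continuous_sub_right x).continuousAt (x := x) |>.preimage_mem_nhds
    (t := (I.1 : Set A)) (by simpa using I.2.mem_nhds I.1.zero_mem)
  filter_upwards [h] with y hy
  have h2 : (toSections V y).1 I = (toSections V x).1 I := by
    have h3 := toSections_mem_kerEval (U := V) hy
    rw [map_sub, mem_kerEval] at h3
    exact sub_eq_zero.mp h3
  change (toSections V y).1 I ∈ S
  rw [h2]
  exact hx

/-- Distinct sections differ in some component over some quasi-compact open subset, where that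
component is continuous with values in a discrete ring. -/
instance t2Space_sections (U : Opens (SpfTop A)) : T2Space (sections U) := by
  have := prespectralSpace (A := A)
  refine ⟨fun s t hst => ?_⟩
  obtain ⟨I, hI⟩ : ∃ I, s.1 I ≠ t.1 I := by
    by_contra! h
    exact hst (Subtype.ext (funext h))
  obtain ⟨V, hVU, hVc, hne⟩ : ∃ (V : Opens (SpfTop A)) (hV : V ≤ U),
      IsCompact (V : Set (SpfTop A)) ∧ (res hV s).1 I ≠ (res hV t).1 I := by
    by_contra! h
    let ι := {a : A // basicOpen a ≤ U}
    refine hI ((specQuot I).sheaf.eq_of_locally_eq' (fun a : ι => preim I (basicOpen a.1))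
      (preim I U) (fun a => homOfLE (preim_mono I a.2)) ?_ _ _
      fun a => h (basicOpen a.1) a.2 (isCompact_basicOpen _))
    intro q hq
    obtain ⟨a, ha, haU⟩ := exists_basicOpen_le (show ofQuot I q ∈ U from hq)
    exact Opens.mem_iSup.mpr ⟨⟨a, haU⟩, ha⟩
  have hc := continuous_eval hVU hVc I
  exact ⟨_, _, @IsOpen.preimage _ _ (_) ⊥ _ hc {(res hVU s).1 I} trivial,
    @IsOpen.preimage _ _ (_) ⊥ _ hc {(res hVU t).1 I} trivial, rfl, rfl,
    Set.disjoint_left.mpr fun x hx hx' => hne (hx.symm.trans hx')⟩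

lemma isCompact_top : IsCompact ((⊤ : Opens (SpfTop A)) : Set (SpfTop A)) := isAff_top.isCompact

/-- The localization of `A` at `a`, mapping to the sections over `basicOpen a`. -/
def awayToSections (a : A) : Localization.Away a →+* sections (basicOpen a) :=
  IsLocalization.Away.lift a (isUnit_toSections_basicOpen a)

@[simp] lemma awayToSections_algebraMap (a c : A) :
    awayToSections a (algebraMap A _ c) = toSections _ c :=
  IsLocalization.Away.lift_eq a _ c

lemma exists_pow_mul_eq_algebraMap (a : A) (x : Localization.Away a) :
    ∃ (c : A) (k : ℕ), algebraMap A _ a ^ k * x = algebraMap A (Localization.Away a) c := by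
  obtain ⟨⟨c, _, k, rfl⟩, hk⟩ := IsLocalization.surj (Submonoid.powers a) x
  exact ⟨c, k, by rw [mul_comm, ← map_pow]; exact hk⟩

/-- Modulo each open ideal, sections over the affine open subset `basicOpen a` are honest fractions
with denominator a power of `a`. -/
lemma denseRange_awayToSections (a : A) : DenseRange (awayToSections a) := by
  refine fun y => mem_closure_of_forall_sub_mem fun N hN => ?_
  obtain ⟨I, -, hI⟩ := (nhds_zero_hasBasis (isCompact_basicOpen a)).mem_iff.mp hN
  obtain ⟨c, k, hc⟩ := exists_pow_mul_apply_eq_toSections a y I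
  refine ⟨_, ⟨IsLocalization.mk' _ c (⟨a ^ k, k, rfl⟩ : Submonoid.powers a), rfl⟩, hI ?_⟩
  have h1 := (isUnit_toSections_basicOpen a).pow k
  have h2 : toSections (basicOpen a) a ^ k *
      awayToSections a (IsLocalization.mk' _ c (⟨a ^ k, k, rfl⟩ : Submonoid.powers a)) = toSections _ c := by
    rw [← awayToSections_algebraMap, ← awayToSections_algebraMap, ← map_pow, ← map_mul, ← map_pow]
    congr 1
    exact IsLocalization.mk'_spec' _ c (⟨a ^ k, k, rfl⟩ : Submonoid.powers a)
  rw [SetLike.mem_coe, ← Ideal.unit_mul_mem_iff_mem _ h1, mul_sub, h2, ← neg_mem_iff, neg_sub]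
  exact hc

/-- This describes the topology of the localization by numerators alone, without reference to the
structure sheaf, so that it can be compared with the topology induced from another sheaf. -/
lemma comap_awayToSections_nhds_zero (a : A) :
    ((𝓝 (0 : sections (basicOpen a))).comap (awayToSections a)).HasBasis
      (fun _ : OpenIdeal A => True)
      fun I => {x | ∃ (c : A) (k l : ℕ), algebraMap A _ a ^ k * x = algebraMap A _ c ∧
        a ^ l * c ∈ I.1} := by
  have h := (nhds_zero_hasBasis (isCompact_basicOpen a)).comap (awayToSections a)
  convert h using 2 with I
  ext x
  have h1 (k : ℕ) := (isUnit_toSections_basicOpen a).pow k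
  refine ⟨?_, fun hx => ?_⟩
  · rintro ⟨c, k, l, hx, hc⟩
    have h2 := congrArg (awayToSections a) hx
    rw [map_mul, map_pow, awayToSections_algebraMap, awayToSections_algebraMap] at h2
    rw [Set.mem_preimage, SetLike.mem_coe, ← Ideal.unit_mul_mem_iff_mem _ (h1 k), h2,
      ← Ideal.unit_mul_mem_iff_mem _ (h1 l), ← map_pow, ← map_mul]
    exact toSections_mem_kerEval hc
  · obtain ⟨c, k, hc⟩ := exists_pow_mul_eq_algebraMap a x
    have h2 := congrArg (awayToSections a) hc
    rw [map_mul, map_pow, awayToSections_algebraMap, awayToSections_algebraMap] at h2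
    obtain ⟨l, hl⟩ := exists_pow_mul_mem_of_toSections_mem_kerEval a c I (by
      rw [← h2]
      exact Ideal.mul_mem_left _ _ hx)
    exact ⟨c, k, l, hc, hl⟩

end

end Spf

end FormalGeometry

/-! ### Sheaves of topological rings and charts. -/

namespace FormalGeometry

/-- Sheaves of topological rings on a space. -/
structure TopSheaf (X : TopCat.{u}) where
  presheaf : TopCat.Presheaf CommRingCat.{u} X
  isSheaf : presheaf.IsSheaf
  sectionTop : ∀ U : Opens X, TopologicalSpace (presheaf.obj (op U))
  isTopologicalRing : ∀ U : Opens X, @IsTopologicalRing (presheaf.obj (op U)) (sectionTop U) _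
  continuous_map : ∀ {U V : Opens X} (i : V ⟶ U),
    @Continuous _ _ (sectionTop U) (sectionTop V) (presheaf.map i.op)
  iInf_induced_le : ∀ {ι : Type u} (V : ι → Opens X) (U : Opens X)
    (i : ∀ k, V k ⟶ U), U ≤ iSup V →
    ⨅ k, (sectionTop (V k)).induced (presheaf.map (i k).op) ≤ sectionTop U

namespace TopSheaf

variable {X : TopCat.{u}} (F : TopSheaf X)

/-- The ring of sections. -/
abbrev obj (U : Opens X) : CommRingCat.{u} := F.presheaf.obj (op U)

instance (U : Opens X) : TopologicalSpace (F.obj U) := F.sectionTop U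

instance (U : Opens X) : IsTopologicalRing (F.obj U) := F.isTopologicalRing U

/-- Restriction of sections. -/
def res {U V : Opens X} (h : V ≤ U) : F.obj U →+* F.obj V := (F.presheaf.map (homOfLE h).op).hom

lemma continuous_res {U V : Opens X} (h : V ≤ U) : Continuous (F.res h) :=
  F.continuous_map (homOfLE h)

@[simp] lemma res_res {U V W : Opens X} (h : V ≤ U) (h' : W ≤ V) (s : F.obj U) :
    F.res h' (F.res h s) = F.res (h'.trans h) s := by
  change (F.presheaf.map (homOfLE h).op ≫ F.presheaf.map (homOfLE h').op) s = _
  rw [← F.presheaf.map_comp]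
  rfl

@[simp] lemma res_refl {U : Opens X} (s : F.obj U) : F.res (le_refl U) s = s :=
  congr($(F.presheaf.map_id (op U)) s)

lemma eq_of_res_eq {ι : Type*} {U : Opens X} (V : ι → Opens X) (hV : ∀ k, V k ≤ U)
    (hU : U ≤ iSup V) {s t : F.obj U} (h : ∀ k, F.res (hV k) s = F.res (hV k) t) : s = t :=
  TopCat.Sheaf.eq_of_locally_eq' ⟨F.presheaf, F.isSheaf⟩ V U (fun k => homOfLE (hV k)) hU s t h

lemma exists_glue {ι : Type*} {U : Opens X} (V : ι → Opens X) (hV : ∀ k, V k ≤ U)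
    (hU : U ≤ iSup V) (s : ∀ k, F.obj (V k))
    (h : ∀ k l, F.res (inf_le_left : V k ⊓ V l ≤ V k) (s k) = F.res inf_le_right (s l)) :
    ∃ t : F.obj U, ∀ k, F.res (hV k) t = s k :=
  (TopCat.Sheaf.existsUnique_gluing' ⟨F.presheaf, F.isSheaf⟩ V U (fun k => homOfLE (hV k)) hU s
    h).exists

lemma sectionTop_eq_iInf {ι : Type u} {U : Opens X} (V : ι → Opens X) (hV : ∀ k, V k ≤ U)
    (hU : U ≤ iSup V) :
    F.sectionTop U = ⨅ k, (F.sectionTop (V k)).induced (F.res (hV k)) :=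
  le_antisymm (le_iInf fun k => continuous_iff_le_induced.mp (F.continuous_res (hV k)))
    (F.iInf_induced_le V U (fun k => homOfLE (hV k)) hU)

lemma isInducing_pi_res {ι : Type u} {U : Opens X} (V : ι → Opens X) (hV : ∀ k, V k ≤ U)
    (hU : U ≤ iSup V) : IsInducing fun (s : F.obj U) (k : ι) => F.res (hV k) s := by
  refine ⟨(F.sectionTop_eq_iInf V hV hU).trans ?_⟩
  rw [Pi.topologicalSpace, induced_iInf]
  simp only [induced_compose]
  rfl

lemma t2Space_of_cover {ι : Type*} {U : Opens X} (V : ι → Opens X) (hV : ∀ k, V k ≤ U)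
    (hU : U ≤ iSup V) (h : ∀ k, T2Space (F.obj (V k))) : T2Space (F.obj U) :=
  T2Space.of_injective_continuous (f := fun (s : F.obj U) (k : ι) => F.res (hV k) s)
    (fun _ _ hst => F.eq_of_res_eq V hV hU (congrFun hst))
    (continuous_pi fun k => F.continuous_res (hV k))

/-- By gluing, the image consists of the families that agree on overlaps, a closed condition when
the sections over overlaps are Hausdorff. -/
lemma isClosed_range_pi_res {ι : Type*} {U : Opens X} (V : ι → Opens X) (hV : ∀ k, V k ≤ U)
    (hU : U ≤ iSup V) (h2 : ∀ W : Opens X, T2Space (F.obj W)) :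
    IsClosed (Set.range (RingHom.pi fun k => F.res (hV k))) := by
  have : Set.range (RingHom.pi fun k => F.res (hV k)) = ⋂ (k : ι) (l : ι), {s : ∀ k, F.obj (V k) |
      F.res (inf_le_left : V k ⊓ V l ≤ V k) (s k) = F.res inf_le_right (s l)} := by
    ext s
    simp only [Set.mem_iInter]
    refine ⟨?_, fun hs => ?_⟩
    · rintro ⟨t, rfl⟩ k l
      change F.res _ (F.res _ t) = F.res _ (F.res _ t)
      rw [res_res, res_res]
    · obtain ⟨t, ht⟩ := F.exists_glue V hV hU s hs
      exact ⟨t, funext ht⟩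
  rw [this]
  exact isClosed_iInter fun k => isClosed_iInter fun l => isClosed_eq
    ((F.continuous_res _).comp (continuous_apply k)) ((F.continuous_res _).comp (continuous_apply l))

/-- Completeness of rings of sections is local. -/
lemma isCompleteLinear_of_cover {ι : Type u} {U : Opens X} (V : ι → Opens X) (hV : ∀ k, V k ≤ U)
    (hU : U ≤ iSup V) (h : ∀ k, IsCompleteLinear (F.obj (V k)))
    (h2 : ∀ W : Opens X, T2Space (F.obj W)) : IsCompleteLinear (F.obj U) :=
  IsCompleteLinear.of_isInducing (RingHom.pi fun k => F.res (hV k))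
    (F.isInducing_pi_res V hV hU) (fun _ _ hst => F.eq_of_res_eq V hV hU (congrFun hst))
    (F.isClosed_range_pi_res V hV hU h2)

/-- Discreteness of rings of sections over finite unions. -/
lemma discreteTopology_of_cover {ι : Type u} [Finite ι] {U : Opens X} (V : ι → Opens X)
    (hV : ∀ k, V k ≤ U) (hU : U ≤ iSup V) (h : ∀ k, DiscreteTopology (F.obj (V k))) :
    DiscreteTopology (F.obj U) := by
  have : DiscreteTopology (∀ k, F.obj (V k)) := inferInstance
  exact (IsEmbedding.mk (F.isInducing_pi_res V hV hU)
    fun _ _ hst => F.eq_of_res_eq V hV hU (congrFun hst)).discreteTopology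

end TopSheaf

namespace Spf

noncomputable section

variable {B : Type u} [CommRing B] [TopologicalSpace B] [IsAdmissibleRing B]

/-- The structure sheaf of `Spf B` as a sheaf of topological rings. -/
def topSheaf (B : Type u) [CommRing B] [TopologicalSpace B] [IsAdmissibleRing B] :
    TopSheaf (SpfTop B) where
  presheaf := presheaf
  isSheaf := isSheaf
  sectionTop := sectionTop
  isTopologicalRing := isTopologicalRing
  continuous_map i := continuous_res i.le
  iInf_induced_le V U i hU := iInf_induced_le V U (fun k => (i k).le) hU

lemma exists_glue {ι : Type*} {U : Opens (SpfTop B)} (V : ι → Opens (SpfTop B))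
    (hV : ∀ k, V k ≤ U) (hU : U ≤ iSup V) (s : ∀ k, sections (V k))
    (h : ∀ k l, res (inf_le_left : V k ⊓ V l ≤ V k) (s k) = res inf_le_right (s l)) :
    ∃ t : sections U, ∀ k, res (hV k) t = s k :=
  (topSheaf B).exists_glue V hV hU s h

/-- A homomorphism from `B` to the global sections of a sheaf of topological rings on `Spf B` that
identifies the structure sheaf of `Spf B` with a subsheaf. -/
structure IsChart (G : TopSheaf (SpfTop B)) (ψ : B →+* G.obj ⊤) : Prop where
  continuous : Continuous ψ
  isUnit : ∀ b : B, IsUnit (G.res (le_top : basicOpen b ≤ ⊤) (ψ b))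
  complete : ∀ b : B, IsCompleteLinear (G.obj (basicOpen b))
  exists_nhds : ∀ (b : B) (I : OpenIdeal B), ∃ N ∈ 𝓝 (0 : G.obj (basicOpen b)),
    ∀ c : B, G.res (le_top : basicOpen b ≤ ⊤) (ψ c) ∈ N → ∃ k : ℕ, b ^ k * c ∈ I.1

set_option linter.unusedSectionVars false

namespace IsChart

variable {G : TopSheaf (SpfTop B)} {ψ : B →+* G.obj ⊤} (h : IsChart G ψ)
include h

/-- The map from the localization at `b` to the sections over `basicOpen b`. -/
def awayTo (b : B) : Localization.Away b →+* G.obj (basicOpen b) :=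
  IsLocalization.Away.lift (g := (G.res (le_top : basicOpen b ≤ ⊤)).comp ψ) b (h.isUnit b)

lemma awayTo_algebraMap (b c : B) : h.awayTo b (algebraMap B _ c) =
    G.res (le_top : basicOpen b ≤ ⊤) (ψ c) :=
  IsLocalization.Away.lift_eq b _ c

/-- Both topologies on the localization are detected on numerators because `b` becomes invertible.
Continuity of `ψ` and a basis of ideals give one inclusion, `exists_nhds` is exactly what the other
one needs. -/
lemma comap_nhds_zero (b : B) : (𝓝 (0 : sections (basicOpen b))).comap (awayToSections b) =
    (𝓝 (0 : G.obj (basicOpen b))).comap (h.awayTo b) := by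
  have := h.complete b
  have hu (k : ℕ) := (h.isUnit b).pow k
  refine le_antisymm (fun S hS => ?_) (fun S hS => ?_)
  · obtain ⟨N, hN, hNS⟩ := hS
    obtain ⟨M, hM, hMN⟩ := IsCompleteLinear.exists_ideal_subset N hN
    refine (comap_awayToSections_nhds_zero b).mem_iff.mpr
      ⟨⟨M.comap ((G.res (le_top : basicOpen b ≤ ⊤)).comp ψ),
        hM.preimage ((G.continuous_res _).comp h.continuous)⟩, trivial, ?_⟩
    rintro x ⟨c, k, l, hx, hc⟩
    refine hNS (hMN ?_)
    have h2 := congrArg (h.awayTo b) hx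
    rw [map_mul, map_pow, awayTo_algebraMap, awayTo_algebraMap] at h2
    rw [SetLike.mem_coe, ← Ideal.unit_mul_mem_iff_mem _ (hu k), h2,
      ← Ideal.unit_mul_mem_iff_mem _ (hu l), ← map_pow, ← map_pow, ← map_mul, ← map_mul]
    exact hc
  · obtain ⟨I, -, hI⟩ := (comap_awayToSections_nhds_zero b).mem_iff.mp hS
    obtain ⟨N, hN, hNI⟩ := h.exists_nhds b I
    obtain ⟨M, hM, hMN⟩ := IsCompleteLinear.exists_ideal_subset N hN
    refine ⟨M, hM.mem_nhds M.zero_mem, fun x hx => hI ?_⟩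
    obtain ⟨c, k, hc⟩ := exists_pow_mul_eq_algebraMap b x
    have h2 := congrArg (h.awayTo b) hc
    rw [map_mul, map_pow, awayTo_algebraMap, awayTo_algebraMap] at h2
    obtain ⟨l, hl⟩ := hNI c (hMN (by rw [SetLike.mem_coe, ← h2]; exact M.mul_mem_left _ hx))
    exact ⟨c, k, l, hc, hl⟩

/-- The sections over `basicOpen b` are the completion of the localization at `b`, so the map from
the localization extends by continuity. -/
lemma exists_theta (b : B) : ∃ θ : sections (basicOpen b) →+* G.obj (basicOpen b),
    θ.comp (awayToSections b) = h.awayTo b ∧ IsInducing θ := by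
  have := h.complete b
  have := isCompleteLinear_sections (isCompact_basicOpen b)
  exact exists_isInducing_extension _ _ (denseRange_awayToSections b) (h.comap_nhds_zero b)

/-- The comparison map over a basic open subset. -/
def theta (b : B) : sections (basicOpen b) →+* G.obj (basicOpen b) := (h.exists_theta b).choose

lemma theta_comp (b : B) : (h.theta b).comp (awayToSections b) = h.awayTo b :=
  (h.exists_theta b).choose_spec.1

lemma isInducing_theta (b : B) : IsInducing (h.theta b) := (h.exists_theta b).choose_spec.2

lemma theta_toSections (b c : B) : h.theta b (toSections _ c) =
    G.res (le_top : basicOpen b ≤ ⊤) (ψ c) := by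
  rw [← awayToSections_algebraMap, ← awayTo_algebraMap h, ← theta_comp]
  rfl

/-- Both sides are continuous with Hausdorff target; by density of the localization they need only
agree on `B`. -/
lemma theta_res {b b' : B} (hb : basicOpen b' ≤ basicOpen b) (s : sections (basicOpen b)) :
    h.theta b' (res hb s) = G.res hb (h.theta b s) := by
  have := h.complete b'
  refine congrFun ((denseRange_awayToSections b).equalizer
    ((h.isInducing_theta b').continuous.comp (continuous_res hb))
    ((G.continuous_res hb).comp (h.isInducing_theta b).continuous) ?_) s
  refine DFunLike.coe_injective.eq_iff.mpr (?_ : ((h.theta b').comp (res hb)).comp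
    (awayToSections b) = ((G.res hb).comp (h.theta b)).comp (awayToSections b))
  refine IsLocalization.ringHom_ext (Submonoid.powers b) (RingHom.ext fun c => ?_)
  change h.theta b' (res hb (awayToSections b (algebraMap _ _ c))) =
    G.res hb (h.theta b (awayToSections b (algebraMap _ _ c)))
  rw [awayToSections_algebraMap, res_toSections, theta_toSections, theta_toSections,
    TopSheaf.res_res]

/-- The comparison map on the basic open subsets. -/
def thetaNat : (inducedFunctor (basicOpen (A := B))).op ⋙ presheaf ⟶
    (inducedFunctor (basicOpen (A := B))).op ⋙ G.presheaf where
  app b := CommRingCat.ofHom (h.theta b.unop)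
  naturality _ _ i := CommRingCat.hom_ext (RingHom.ext fun s =>
    h.theta_res ((inducedFunctor (basicOpen (A := B))).map i.unop).le s)

/-- The comparison map from the structure sheaf. -/
def Theta : presheaf (A := B) ⟶ G.presheaf :=
  TopCat.Sheaf.restrictHomEquivHom presheaf ⟨G.presheaf, G.isSheaf⟩ isBasis_basicOpen h.thetaNat

/-- The comparison map on sections. -/
def ThetaHom (U : Opens (SpfTop B)) : sections U →+* G.obj U := (h.Theta.app (op U)).hom

lemma ThetaHom_basicOpen (b : B) : h.ThetaHom (basicOpen b) = h.theta b := by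
  have h1 : h.Theta.app (op (basicOpen b)) = CommRingCat.ofHom (h.theta b) :=
    TopCat.Sheaf.extend_hom_app presheaf ⟨G.presheaf, G.isSheaf⟩ isBasis_basicOpen h.thetaNat b
  exact congrArg CommRingCat.Hom.hom h1

lemma ThetaHom_res {U V : Opens (SpfTop B)} (hV : V ≤ U) (s : sections U) :
    h.ThetaHom V (res hV s) = G.res hV (h.ThetaHom U s) :=
  congr($(h.Theta.naturality (homOfLE hV).op) s)

/-- The basic open subsets contained in `U`. -/
abbrev Basics (_ : IsChart G ψ) (U : Opens (SpfTop B)) : Type u := {b : B // basicOpen b ≤ U}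

lemma le_iSup_basics (U : Opens (SpfTop B)) : U ≤ ⨆ b : h.Basics U, basicOpen b.1 := by
  intro p hp
  obtain ⟨b, hb, hbU⟩ := exists_basicOpen_le hp
  exact Opens.mem_iSup.mpr ⟨⟨b, hbU⟩, hb⟩

/-- Both topologies are the coarsest ones for restriction to the basic open subsets of `U`, where
the claim is known. -/
lemma isInducing_ThetaHom (U : Opens (SpfTop B)) : IsInducing (h.ThetaHom U) := by
  refine ⟨?_⟩
  have e1 := (topSheaf B).sectionTop_eq_iInf (fun b : h.Basics U => basicOpen b.1) (fun b => b.2)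
    (h.le_iSup_basics U)
  have e2 := G.sectionTop_eq_iInf (fun b : h.Basics U => basicOpen b.1) (fun b => b.2)
    (h.le_iSup_basics U)
  change sectionTop U = TopologicalSpace.induced _ (G.sectionTop U)
  rw [e2]
  refine e1.trans ?_
  rw [induced_iInf]
  refine iInf_congr fun b => ?_
  have e3 := (h.isInducing_theta b.1).eq_induced
  change TopologicalSpace.induced (res b.2) (sectionTop _) = _
  change sectionTop _ = _ at e3
  rw [e3, induced_compose, induced_compose]
  congr 1
  ext s
  change h.theta b.1 (res b.2 s) = G.res b.2 (h.ThetaHom U s)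
  rw [← ThetaHom_basicOpen, ThetaHom_res]

/-- An inducing map from a Hausdorff space is injective. -/
lemma ThetaHom_injective (U : Opens (SpfTop B)) : Function.Injective (h.ThetaHom U) :=
  (h.isInducing_ThetaHom U).injective

lemma ThetaHom_toSections (U : Opens (SpfTop B)) (c : B) :
    h.ThetaHom U (toSections U c) = G.res le_top (ψ c) := by
  refine G.eq_of_res_eq (fun b : h.Basics U => basicOpen b.1) (fun b => b.2)
    (h.le_iSup_basics U) fun b => ?_
  rw [← ThetaHom_res, res_toSections, ThetaHom_basicOpen, theta_toSections, TopSheaf.res_res]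

/-- The sections over `basicOpen b` that are fractions of elements of `B`. -/
def fractions (G : TopSheaf (SpfTop B)) (ψ : B →+* G.obj ⊤) (b : B) : Set (G.obj (basicOpen b)) :=
  {w | ∃ (c : B) (m : ℕ), G.res (le_top : basicOpen b ≤ ⊤) (ψ b) ^ m * w =
    G.res (le_top : basicOpen b ≤ ⊤) (ψ c)}

/-- The localization is dense in the source, which gives one inclusion. For the other, the image
contains the fractions and is closed, being complete as the inducing image of a complete group. -/
lemma range_theta (b : B) : Set.range (h.theta b) = closure (fractions G ψ b) := by
  have := h.complete b
  have := isCompleteLinear_sections (isCompact_basicOpen b)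
  refine subset_antisymm ?_ (closure_minimal ?_ ?_)
  · rintro _ ⟨s, rfl⟩
    refine map_mem_closure (h.isInducing_theta b).continuous (denseRange_awayToSections b s) ?_
    rintro _ ⟨x, rfl⟩
    obtain ⟨c, k, hc⟩ := exists_pow_mul_eq_algebraMap b x
    refine ⟨c, k, ?_⟩
    have h2 := congrArg (h.awayTo b) hc
    rw [map_mul, map_pow, awayTo_algebraMap, awayTo_algebraMap] at h2
    rw [← h2, ← theta_comp]
    rfl
  · rintro w ⟨c, m, hw⟩
    obtain ⟨u, hu⟩ := ((isUnit_toSections_basicOpen b).pow m).exists_left_inv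
    refine ⟨u * toSections _ c, ?_⟩
    rw [map_mul, theta_toSections, ← hw, ← theta_toSections h, ← mul_assoc, ← map_pow, ← map_mul,
      hu, map_one, one_mul]
  · let := IsTopologicalAddGroup.rightUniformSpace (sections (basicOpen b))
    let := IsTopologicalAddGroup.rightUniformSpace (G.obj (basicOpen b))
    have : IsUniformAddGroup (sections (basicOpen b)) := isUniformAddGroup_of_addCommGroup
    have : IsUniformAddGroup (G.obj (basicOpen b)) := isUniformAddGroup_of_addCommGroup
    have : CompleteSpace (sections (basicOpen b)) := IsCompleteLinear.complete
    exact (AddMonoidHom.isUniformInducing_of_isInducing (f := h.theta b)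
      (h.isInducing_theta b)).isComplete_range.isClosed

lemma res_ThetaHom_mem_closure {U : Opens (SpfTop B)} (s : sections U) (b : B)
    (hb : basicOpen b ≤ U) : G.res hb (h.ThetaHom U s) ∈ closure (fractions G ψ b) := by
  rw [← range_theta h, ← ThetaHom_res, ThetaHom_basicOpen]
  exact ⟨_, rfl⟩

/-- Belonging to the image is a local condition: local preimages are unique by injectivity and
therefore glue. Over basic open subsets the image is the closure of the fractions, so this is the
test by which surjectivity is verified for all later charts. -/
lemma exists_ThetaHom_eq {U : Opens (SpfTop B)} (y : G.obj U)
    (hy : ∀ p ∈ U, ∃ (b : B) (hb : basicOpen b ≤ U), p ∈ basicOpen b ∧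
      G.res hb y ∈ closure (fractions G ψ b)) : ∃ s, h.ThetaHom U s = y := by
  choose b hb hpb hy using hy
  simp only [← range_theta h, ← ThetaHom_basicOpen] at hy
  choose s hs using hy
  have hcov : U ≤ ⨆ p : U, basicOpen (b p.1 p.2) :=
    fun p hp => Opens.mem_iSup.mpr ⟨⟨p, hp⟩, hpb p hp⟩
  obtain ⟨t, ht⟩ := exists_glue (fun p : U => basicOpen (b p.1 p.2))
    (fun p => hb p.1 p.2) hcov (fun p => s p.1 p.2) fun p q => by
      apply h.ThetaHom_injective
      rw [ThetaHom_res, ThetaHom_res, hs, hs, TopSheaf.res_res, TopSheaf.res_res]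
  refine ⟨t, G.eq_of_res_eq (fun p : U => basicOpen (b p.1 p.2)) (fun p => hb p.1 p.2) hcov
    fun p => ?_⟩
  rw [← ThetaHom_res, ht, hs]

end IsChart

end

end Spf

end FormalGeometry

/-! ### Restriction, direct image, subsheaves and open identifications. -/

namespace FormalGeometry

noncomputable section

namespace TopSheaf

variable {X : TopCat.{u}}

/-- The underlying presheafed space. -/
abbrev toPresheafedSpace (F : TopSheaf X) : PresheafedSpace CommRingCat.{u} := ⟨X, F.presheaf⟩

/-- Restriction along an open embedding. -/
def restrict (F : TopSheaf X) {Y : TopCat.{u}} {f : Y ⟶ X} (hf : IsOpenEmbedding f) :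
    TopSheaf Y where
  presheaf := hf.functor.op ⋙ F.presheaf
  isSheaf := TopCat.Presheaf.isSheaf_of_isOpenEmbedding hf F.isSheaf
  sectionTop U := F.sectionTop (hf.functor.obj U)
  isTopologicalRing U := F.isTopologicalRing (hf.functor.obj U)
  continuous_map i := F.continuous_map (hf.functor.map i)
  iInf_induced_le V U i hU := F.iInf_induced_le (fun k => hf.functor.obj (V k)) (hf.functor.obj U)
    (fun k => hf.functor.map (i k)) (by
      rintro _ ⟨y, hy, rfl⟩
      obtain ⟨k, hk⟩ := Opens.mem_iSup.mp (hU hy)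
      exact Opens.mem_iSup.mpr ⟨k, y, hk, rfl⟩)

/-- Direct image. -/
def pushforward (F : TopSheaf X) {Y : TopCat.{u}} (f : X ⟶ Y) : TopSheaf Y where
  presheaf := (TopCat.Presheaf.pushforward CommRingCat f).obj F.presheaf
  isSheaf := TopCat.Sheaf.pushforward_sheaf_of_sheaf f F.isSheaf
  sectionTop U := F.sectionTop ((Opens.map f).obj U)
  isTopologicalRing U := F.isTopologicalRing ((Opens.map f).obj U)
  continuous_map i := F.continuous_map ((Opens.map f).map i)
  iInf_induced_le V U i hU := F.iInf_induced_le (fun k => (Opens.map f).obj (V k))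
    ((Opens.map f).obj U) (fun k => (Opens.map f).map (i k)) (by
      intro y hy
      obtain ⟨k, hk⟩ := Opens.mem_iSup.mp (hU hy)
      exact Opens.mem_iSup.mpr ⟨k, hk⟩)

/-- A family of subrings of the rings of sections that forms a subsheaf. -/
structure Sub (F : TopSheaf X) where
  subring : ∀ U : Opens X, Subring (F.obj U)
  res_mem : ∀ {U V : Opens X} (h : V ≤ U) (s : F.obj U), s ∈ subring U → F.res h s ∈ subring V
  mem_of_local : ∀ {U : Opens X} (s : F.obj U),
    (∀ x ∈ U, ∃ (V : Opens X) (h : V ≤ U), x ∈ V ∧ F.res h s ∈ subring V) → s ∈ subring U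

namespace Sub

variable {F : TopSheaf X} (P : F.Sub)

/-- Restriction of sections of a subsheaf. -/
def res {U V : Opens X} (h : V ≤ U) : P.subring U →+* P.subring V :=
  ((F.res h).comp (P.subring U).subtype).codRestrict (P.subring V) fun s => P.res_mem h s.1 s.2

/-- A subsheaf as a presheaf. -/
def presheaf : TopCat.Presheaf CommRingCat.{u} X where
  obj U := CommRingCat.of (P.subring U.unop)
  map i := CommRingCat.ofHom (P.res i.unop.le)
  map_id _ := CommRingCat.hom_ext (RingHom.ext fun _ => Subtype.ext (F.res_refl _))
  map_comp i j := CommRingCat.hom_ext (RingHom.ext fun s =>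
    Subtype.ext (F.res_res i.unop.le j.unop.le s.1).symm)

lemma isSheaf : P.presheaf.IsSheaf := by
  rw [TopCat.Presheaf.isSheaf_iff_isSheafUniqueGluing]
  intro ι U sf hsf
  let sf' (k : ι) : P.subring (U k) := sf k
  obtain ⟨s, hs⟩ := F.exists_glue U (le_iSup U) le_rfl (fun k => (sf' k).1)
    fun k l => congr_arg Subtype.val (hsf k l)
  refine ⟨⟨s, P.mem_of_local s fun x hx => ?_⟩, fun k => Subtype.ext (hs k), fun t ht => ?_⟩
  · obtain ⟨k, hk⟩ := Opens.mem_iSup.mp hx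
    exact ⟨U k, le_iSup U k, hk, by rw [hs]; exact (sf' k).2⟩
  · refine Subtype.ext (F.eq_of_res_eq U (le_iSup U) le_rfl fun k => ?_)
    exact (congr_arg Subtype.val (ht k)).trans (hs k).symm

lemma continuous_res {U V : Opens X} (h : V ≤ U) : Continuous (P.res h) :=
  continuous_induced_rng.mpr ((F.continuous_res h).comp continuous_subtype_val)

lemma iInf_induced_le {ι : Type u} (V : ι → Opens X) (U : Opens X) (hV : ∀ k, V k ≤ U)
    (hU : U ≤ iSup V) :
    ⨅ k, TopologicalSpace.induced (P.res (hV k)) inferInstance ≤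
      (inferInstance : TopologicalSpace (P.subring U)) := by
  have h := F.sectionTop_eq_iInf V hV hU
  change _ ≤ TopologicalSpace.induced Subtype.val (F.sectionTop U)
  rw [h, induced_iInf]
  refine iInf_mono fun k => ?_
  rw [induced_compose]
  change TopologicalSpace.induced _ (TopologicalSpace.induced Subtype.val (F.sectionTop _)) ≤ _
  rw [induced_compose]
  rfl

/-- A subsheaf as a sheaf of topological rings. -/
def toTopSheaf : TopSheaf X where
  presheaf := P.presheaf
  isSheaf := P.isSheaf
  sectionTop U := (inferInstance : TopologicalSpace (P.subring U))
  isTopologicalRing U := (inferInstance : IsTopologicalRing (P.subring U))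
  continuous_map i := P.continuous_res i.le
  iInf_induced_le V U i hU := P.iInf_induced_le V U (fun k => (i k).le) hU

end Sub

/-- An identification of the restriction of `S` to an open subset with `O`. -/
structure OpenIso {P Z : TopCat.{u}} (O : TopSheaf P) (S : TopSheaf Z) where
  base : P ⟶ Z
  isOpenEmbedding : IsOpenEmbedding base
  hom : ∀ U : Opens P, O.obj U →+* S.obj (isOpenEmbedding.functor.obj U)
  hom_res : ∀ {U V : Opens P} (h : V ≤ U) (s : O.obj U),
    hom V (O.res h s) = S.res (isOpenEmbedding.functor.map (homOfLE h)).le (hom U s)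
  bijective : ∀ U, Function.Bijective (hom U)
  isInducing : ∀ U, IsInducing (hom U)

namespace OpenIso

variable {P Z : TopCat.{u}} {O : TopSheaf P} {S : TopSheaf Z} (e : OpenIso O S)

/-- The inverse on sections. -/
def equiv (U : Opens P) : O.obj U ≃+* S.obj (e.isOpenEmbedding.functor.obj U) :=
  RingEquiv.ofBijective (e.hom U) (e.bijective U)

lemma functor_map_le (U : Opens Z) :
    e.isOpenEmbedding.functor.obj ((Opens.map e.base).obj U) ≤ U := by
  rintro _ ⟨y, hy, rfl⟩
  exact hy

/-- The map on sections. -/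
def app (U : Opens Z) : S.obj U →+* O.obj ((Opens.map e.base).obj U) :=
  (e.equiv ((Opens.map e.base).obj U)).symm.toRingHom.comp (S.res (e.functor_map_le U))

lemma hom_app (U : Opens Z) (s : S.obj U) :
    e.hom _ (e.app U s) = S.res (e.functor_map_le U) s :=
  (e.equiv ((Opens.map e.base).obj U)).apply_symm_apply (S.res (e.functor_map_le U) s)

lemma app_res {U V : Opens Z} (h : V ≤ U) (s : S.obj U) :
    e.app V (S.res h s) = O.res ((Opens.map e.base).map (homOfLE h)).le (e.app U s) := by
  apply (e.bijective _).1
  rw [hom_res, hom_app, hom_app, res_res, res_res]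

lemma continuous_app (U : Opens Z) : Continuous (e.app U) := by
  rw [(e.isInducing _).continuous_iff]
  convert S.continuous_res (e.functor_map_le U) using 1
  ext s
  exact e.hom_app U s

/-- The morphism of presheafed spaces. -/
def toHom : O.toPresheafedSpace ⟶ S.toPresheafedSpace where
  base := e.base
  c := { app := fun U => CommRingCat.ofHom (e.app U.unop)
         naturality := fun _ _ i => CommRingCat.hom_ext (RingHom.ext fun s =>
          e.app_res i.unop.le s) }

lemma functor_map_eq {U : Opens Z} (hU : (U : Set Z) ⊆ Set.range e.base) :
    e.isOpenEmbedding.functor.obj ((Opens.map e.base).obj U) = U := by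
  refine le_antisymm (e.functor_map_le U) fun x hx => ?_
  obtain ⟨y, rfl⟩ := hU hx
  exact ⟨y, hx, rfl⟩

lemma app_bijective {U : Opens Z} (hU : (U : Set Z) ⊆ Set.range e.base) :
    Function.Bijective (e.app U) := by
  have h := e.functor_map_eq hU
  have h2 : Function.Bijective (S.res (e.functor_map_le U)) := by
    refine ⟨fun s t hst => ?_, fun s => ⟨S.res h.ge s, by simp⟩⟩
    simpa using congrArg (S.res h.ge) hst
  exact (e.equiv ((Opens.map e.base).obj U)).symm.bijective.comp h2

lemma isInducing_app {U : Opens Z} (hU : (U : Set Z) ⊆ Set.range e.base) :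
    IsInducing (e.app U) := by
  have h := e.functor_map_eq hU
  -- A continuous map with a continuous left inverse is inducing.
  refine IsInducing.of_comp (g := S.res h.ge ∘ e.hom _) (e.continuous_app U)
    ((S.continuous_res _).comp (e.isInducing _).continuous) ?_
  convert IsInducing.id using 1
  ext s
  change S.res h.ge (e.hom _ (e.app U s)) = s
  rw [hom_app, res_res, res_refl]

instance isOpenImmersion_toHom : PresheafedSpace.IsOpenImmersion e.toHom where
  base_open := e.isOpenEmbedding
  c_iso U := by
    have h := e.app_bijective (U := e.isOpenEmbedding.functor.obj U) (Set.image_subset_range _ _)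
    exact (RingEquiv.ofBijective _ h).toCommRingCatIso.isIso_hom

/-- An open identification is an isomorphism on stalks. Spaces built from a sheaf of topological
rings obtain their local stalks from their affine charts in this way. -/
lemma isLocalRing_stalk (hO : ∀ p : P, IsLocalRing (O.presheaf.stalk p)) (p : P) :
    IsLocalRing (S.presheaf.stalk (e.base p)) := by
  have h1 : IsIso (e.toHom.stalkMap p) := inferInstance
  have h2 : IsLocalRing (O.toPresheafedSpace.presheaf.stalk p) := hO p
  have := RingHom.domain_isLocalRing (e.toHom.stalkMap p).hom
  exact this

end OpenIso

end TopSheaf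

namespace LocallyTopRingedSpace

/-- The structure sheaf of topological rings. -/
def topSheaf (T : LocallyTopRingedSpace.{u}) : TopSheaf T.carrier where
  presheaf := T.presheaf
  isSheaf := T.IsSheaf
  sectionTop := T.sectionTop
  isTopologicalRing := T.isTopologicalRing
  continuous_map := T.continuous_map
  iInf_induced_le := T.iInf_induced_le

/-- A space with a sheaf of topological rings with local stalks. -/
def ofTopSheaf {Z : TopCat.{u}} (S : TopSheaf Z) (h : ∀ z : Z, IsLocalRing (S.presheaf.stalk z)) :
    LocallyTopRingedSpace.{u} where
  carrier := Z
  presheaf := S.presheaf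
  IsSheaf := S.isSheaf
  isLocalRing := h
  sectionTop := S.sectionTop
  isTopologicalRing := S.isTopologicalRing
  continuous_map := S.continuous_map
  iInf_induced_le := S.iInf_induced_le

/-- The morphism given by an identification with an open subspace. -/
def homOfOpenIso {T X : LocallyTopRingedSpace.{u}} (e : TopSheaf.OpenIso T.topSheaf X.topSheaf) :
    T ⟶ X where
  toLRSHom := ⟨e.toHom, fun p => by
    have h1 : IsIso (e.toHom.stalkMap p) := inferInstance
    exact isLocalHom_of_isIso (e.toHom.stalkMap p)⟩
  continuous_app := e.continuous_app

lemma isOpenImmersion_homOfOpenIso {T X : LocallyTopRingedSpace.{u}}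
    (e : TopSheaf.OpenIso T.topSheaf X.topSheaf) : IsOpenImmersion (homOfOpenIso e) where
  isOpenImmersion := e.isOpenImmersion_toHom
  isInducing _ hU := e.isInducing_app hU

end LocallyTopRingedSpace

end

end FormalGeometry

/-! ### Basic open subsets of a formal spectrum are formal spectra. -/

namespace FormalGeometry

namespace Spf

noncomputable section

set_option linter.unusedSectionVars false

variable {A : Type u} [CommRing A] [TopologicalSpace A] [IsAdmissibleRing A]

lemma nonvanishing_eq_bot_of_apply_eq_zero {U : Opens (SpfTop A)} {s : sections U}
    {I : OpenIdeal A} (hI : IsIdealOfDefinition I.1) (hs : s.1 I = 0) : nonvanishing s = ⊥ := by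
  refine ext_preim hI ?_
  rw [preim_nonvanishing, hs, Scheme.basicOpen_zero]
  rfl

/-- On a quasi-compact open subset of a scheme a nowhere invertible section is nilpotent; apply this
to every component. -/
lemma isTopologicallyNilpotent_of_nonvanishing_eq_bot {U : Opens (SpfTop A)}
    (hU : IsCompact (U : Set (SpfTop A))) {s : sections U} (hs : nonvanishing s = ⊥) :
    IsTopologicallyNilpotent s := by
  refine ((nhds_zero_hasBasis hU).tendsto_right_iff).mpr fun I _ => ?_
  have h1 : (specQuot I).basicOpen (s.1 I) = ⊥ := by
    rw [← preim_nonvanishing, hs]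
    rfl
  have h2 : IsCompact (preim I U : Set (specQuot I)) := by
    -- A closed embedding pulls quasi-compact subsets back to quasi-compact ones, which the
    -- nilpotence criterion requires.
    have hcl : IsClosedEmbedding (ofQuot I) := by
      have h := (PrimeSpectrum.isClosedEmbedding_comap_of_surjective _ (Ideal.Quotient.mk I.1)
        Ideal.Quotient.mk_surjective)
      exact ⟨IsEmbedding.of_comp (ofQuot I).hom.continuous continuous_subtype_val h.isEmbedding, by
        refine (congrArg IsClosed ?_).mpr (h.isClosed_range.preimage (continuous_subtype_val :
          Continuous (Subtype.val : SpfTop A → PrimeSpectrum A)))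
        refine Set.ext fun p => ?_
        exact ⟨fun ⟨q, hq⟩ => ⟨q, congrArg Subtype.val hq⟩,
          fun ⟨q, hq⟩ => ⟨q, Subtype.ext hq⟩⟩⟩
    exact hcl.isCompact_preimage hU
  obtain ⟨n, hn⟩ := (Scheme.isNilpotent_iff_basicOpen_eq_bot_of_isCompact h2 _).mpr h1
  filter_upwards [Filter.eventually_ge_atTop n] with m hm
  change (s.1 I) ^ m = 0
  exact pow_eq_zero_of_le hm hn

/-- A countable basis of open ideals of `A` is cofinal, so their evaluation kernels form a countable
basis here. The evaluation kernel of an ideal of definition consists of nowhere invertible sections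
and is thus an ideal of definition. -/
lemma isAdmissibleRing_sections {U : Opens (SpfTop A)} (hU : IsCompact (U : Set (SpfTop A))) :
    IsAdmissibleRing (sections U) := by
  have := isCompleteLinear_sections hU
  obtain ⟨I, hI, hb⟩ := IsAdmissibleRing.exists_basis (A := A)
  have hIo (n : ℕ) : IsOpen (I n : Set A) := isOpen_ideal_of_mem_nhds (hb.mem_of_mem trivial)
  have : (𝓝 (0 : sections U)).HasBasis (fun _ : ℕ => True)
      fun n => (kerEval U ⟨I n, hIo n⟩ : Set (sections U)) := by
    refine (nhds_zero_hasBasis hU).to_hasBasis (fun J _ => ?_) fun n _ => ⟨_, trivial, le_rfl⟩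
    obtain ⟨n, -, hn⟩ := hb.mem_iff.mp (J.2.mem_nhds J.1.zero_mem)
    exact ⟨n, trivial, fun s hs => apply_eq_zero_of_le s (I := ⟨I n, hIo n⟩) hn hs⟩
  have := this.isCountablyGenerated
  refine IsCompleteLinear.isAdmissibleRing ?_
  obtain ⟨K, hK⟩ := exists_openIdeal_isIdealOfDefinition A
  exact ⟨kerEval U K, isOpen_kerEval hU K, fun s hs =>
    isTopologicallyNilpotent_of_nonvanishing_eq_bot hU
      (nonvanishing_eq_bot_of_apply_eq_zero hK hs)⟩

instance : T0Space (SpfTop A) :=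
  (inferInstance : T0Space {p : PrimeSpectrum A // IsOpen (p.asIdeal : Set A)})

/-- A criterion for `Spf B ⟶ Spf A` to be an embedding. -/
lemma isEmbedding_mapBase {B : Type u} [CommRing B] [TopologicalSpace B] [IsAdmissibleRing B]
    (φ : A →+* B) (hφ : Continuous φ)
    (h : ∀ x : B, ∃ (c : A) (u : B), IsUnit u ∧ ∀ q : SpfTop B, u * x - φ c ∈ q.1.asIdeal) :
    IsEmbedding (mapBase φ hφ) := by
  suffices h : IsInducing (mapBase φ hφ) from h.isEmbedding
  refine isInducing_iff_nhds.mpr fun q => le_antisymm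
    (mapBase φ hφ).hom.continuous.continuousAt.le_comap fun N hN => ?_
  obtain ⟨U, hUN, hU, hqU⟩ := mem_nhds_iff.mp hN
  obtain ⟨x, hqx, hxU⟩ := exists_basicOpen_le (U := ⟨U, hU⟩) hqU
  obtain ⟨c, u, hu, hc⟩ := h x
  -- Up to a unit, `x` and `φ c` differ by an element of every open prime, so every basic open
  -- subset of `Spf B` is a preimage of one of `Spf A`.
  have key (q : SpfTop B) : mapBase φ hφ q ∈ basicOpen c ↔ q ∈ basicOpen x := by
    change φ c ∉ q.1.asIdeal ↔ x ∉ q.1.asIdeal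
    rw [not_iff_not, ← Ideal.unit_mul_mem_iff_mem (x := x) q.1.asIdeal hu]
    exact ⟨fun h => by simpa using add_mem (hc q) h, fun h => by simpa using sub_mem h (hc q)⟩
  exact ⟨basicOpen c, (basicOpen c).isOpen.mem_nhds ((key q).mpr hqx),
    fun p hp => hUN (hxU ((key p).mp hp))⟩

/-- The prime ideal of the sections vanishing at a point. -/
def primeAt {U : Opens (SpfTop A)} (p : SpfTop A) (hp : p ∈ U) : PrimeSpectrum (sections U) :=
  haveI := isLocalRing_stalk p
  PrimeSpectrum.comap ((presheaf (A := A)).germ U p hp).hom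
    (IsLocalRing.closedPoint ((presheaf (A := A)).stalk p))

lemma mem_primeAt_iff {U : Opens (SpfTop A)} (p : SpfTop A) (hp : p ∈ U) (s : sections U) :
    s ∈ (primeAt p hp).asIdeal ↔ p ∉ nonvanishing s := by
  have h := not_congr (RingedSpace.mem_basicOpen (X := (Spf A).toRingedSpace) (U := U) s p hp)
  exact h.symm

lemma isOpen_primeAt {U : Opens (SpfTop A)} (hU : IsCompact (U : Set (SpfTop A))) (p : SpfTop A)
    (hp : p ∈ U) : IsOpen ((primeAt p hp).asIdeal : Set (sections U)) := by
  obtain ⟨K, hK⟩ := exists_openIdeal_isIdealOfDefinition A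
  refine isOpen_ideal_of_le (I := kerEval U K) (fun s hs => ?_) (isOpen_kerEval hU K)
  rw [mem_primeAt_iff, nonvanishing_eq_bot_of_apply_eq_zero hK hs]
  exact fun h => h

/-- Elements of open primes are detected modulo ideals of definition. -/
lemma mem_asIdeal_of_isTopologicallyNilpotent {B : Type u} [CommRing B] [TopologicalSpace B]
    (q : SpfTop B) {x : B} (hx : IsTopologicallyNilpotent x) : x ∈ q.1.asIdeal := by
  obtain ⟨n, hn⟩ := (hx.eventually (q.2.mem_nhds q.1.asIdeal.zero_mem)).exists
  exact q.1.isPrime.mem_of_pow_mem n hn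

lemma exists_fraction_sub_mem {R B : Type*} [CommRing R] [CommRing B] {ψ : B →+* R} {v : R}
    (hv : IsUnit v) {c y : R} (hc : c ∈ Set.range ψ) {N : Set R} {K : Ideal R}
    (hK : (K : Set R) ⊆ N) {k : ℕ} (h : v ^ k * y - c ∈ K) :
    ∃ s ∈ {w : R | ∃ (c : B) (m : ℕ), v ^ m * w = ψ c}, s - y ∈ N := by
  obtain ⟨u, hu⟩ := (hv.pow k).exists_right_inv
  obtain ⟨d, rfl⟩ := hc
  refine ⟨u * ψ d, ⟨d, k, by rw [← mul_assoc, hu, one_mul]⟩, hK ?_⟩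
  rw [SetLike.mem_coe, ← Ideal.unit_mul_mem_iff_mem _ (hv.pow k), ← neg_mem_iff]
  convert h using 1
  linear_combination (-ψ d) * hu

section BasicOpen

variable (a : A)

instance isAdmissibleRing_sections_basicOpen : IsAdmissibleRing (sections (basicOpen a)) :=
  isAdmissibleRing_sections (isCompact_basicOpen a)

/-- Modulo an ideal of definition every section over `basicOpen a` is, up to a power of the unit
`a`, an element of `A`; the error is topologically nilpotent. -/
lemma isEmbedding_mapBase_basicOpen :
    IsEmbedding (mapBase (toSections (basicOpen a)) (continuous_toSections _)) := by
  refine isEmbedding_mapBase _ _ fun x => ?_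
  obtain ⟨K, hK⟩ := exists_openIdeal_isIdealOfDefinition A
  obtain ⟨c, k, hc⟩ := exists_pow_mul_apply_eq_toSections a x K
  exact ⟨c, _, (isUnit_toSections_basicOpen a).pow k, fun q =>
    mem_asIdeal_of_isTopologicallyNilpotent q (isTopologicallyNilpotent_of_nonvanishing_eq_bot
      (isCompact_basicOpen a) (nonvanishing_eq_bot_of_apply_eq_zero hK hc))⟩

/-- The sections vanishing at `p` form the open prime over `p`, so the points of the formal spectrum
of the sections are those of `basicOpen a`. -/
lemma mapBase_primeAt (p : SpfTop A) (hp : p ∈ basicOpen a) :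
    mapBase (toSections (basicOpen a)) (continuous_toSections _)
      ⟨primeAt p hp, isOpen_primeAt (isCompact_basicOpen a) p hp⟩ = p := by
  refine Subtype.ext (PrimeSpectrum.ext (Ideal.ext fun c => ?_))
  change toSections (basicOpen a) c ∈ (primeAt p hp).asIdeal ↔ _
  rw [mem_primeAt_iff, nonvanishing_toSections]
  exact ⟨fun h => by_contra fun hc => h ⟨hc, hp⟩, fun h h' => h'.1 h⟩

lemma range_mapBase_basicOpen :
    Set.range (mapBase (toSections (basicOpen a)) (continuous_toSections _)) = basicOpen a := by
  refine subset_antisymm ?_ fun p hp => ⟨_, mapBase_primeAt a p hp⟩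
  rintro _ ⟨q, rfl⟩ h
  exact q.1.isPrime.ne_top (Ideal.eq_top_of_isUnit_mem _ h (isUnit_toSections_basicOpen a))

lemma isOpenEmbedding_mapBase_basicOpen :
    IsOpenEmbedding (mapBase (toSections (basicOpen a)) (continuous_toSections _)) :=
  ⟨isEmbedding_mapBase_basicOpen a, by
    rw [range_mapBase_basicOpen]
    exact (basicOpen a).isOpen⟩

lemma mapBase_mem_nonvanishing (b : sections (basicOpen a)) (q : SpfTop (sections (basicOpen a))) :
    mapBase (toSections (basicOpen a)) (continuous_toSections _) q ∈ nonvanishing b ↔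
      q ∈ basicOpen b := by
  obtain ⟨p, hp, rfl⟩ : ∃ (p : SpfTop A) (hp : p ∈ basicOpen a),
      (⟨primeAt p hp, isOpen_primeAt (isCompact_basicOpen a) p hp⟩ : SpfTop _) = q := by
    have h : mapBase (toSections (basicOpen a)) (continuous_toSections _) q ∈ basicOpen a := by
      rw [← SetLike.mem_coe, ← range_mapBase_basicOpen]
      exact ⟨q, rfl⟩
    exact ⟨_, h, (isEmbedding_mapBase_basicOpen a).injective (mapBase_primeAt a _ h)⟩
  rw [mapBase_primeAt]
  exact (not_iff_comm.mp (mem_primeAt_iff p hp b).symm).symm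

lemma functor_basicOpen (b : sections (basicOpen a)) :
    (isOpenEmbedding_mapBase_basicOpen a).functor.obj (basicOpen b) = nonvanishing b := by
  ext p
  refine ⟨?_, fun hp => ?_⟩
  · rintro ⟨q, hq, rfl⟩
    exact (mapBase_mem_nonvanishing a b q).mpr hq
  · obtain ⟨q, rfl⟩ : p ∈ Set.range (mapBase (toSections (basicOpen a))
      (continuous_toSections _)) := by
      rw [range_mapBase_basicOpen]
      exact nonvanishing_le b hp
    exact ⟨q, (mapBase_mem_nonvanishing a b q).mp hp, rfl⟩

lemma functor_le (U : Opens (SpfTop (sections (basicOpen a)))) :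
    (isOpenEmbedding_mapBase_basicOpen a).functor.obj U ≤ basicOpen a := by
  rintro _ ⟨q, -, rfl⟩
  rw [← SetLike.mem_coe, ← range_mapBase_basicOpen]
  exact ⟨q, rfl⟩

lemma isUnit_res_of_eq {U W : Opens (SpfTop A)} (s : sections U) (hW : W = nonvanishing s)
    (hWU : W ≤ U) : IsUnit (res hWU s) := by
  subst hW
  exact isUnit_res_nonvanishing s

lemma IsAff.exists_pow_mul_mem_kerEval {U W : Opens (SpfTop A)} (hU : IsAff U) (s c : sections U)
    (hW : W = nonvanishing s) (hWU : W ≤ U) (I : OpenIdeal A) (h : res hWU c ∈ kerEval W I) :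
    ∃ k : ℕ, s ^ k * c ∈ kerEval U I := by
  subst hW
  exact hU.exists_pow_mul_apply_eq_zero s c I h

lemma IsAff.exists_pow_mul_apply_eq_of_eq {U W : Opens (SpfTop A)} (hU : IsAff U) (s : sections U)
    (hW : W = Spf.nonvanishing s) (hWU : W ≤ U) (y : sections W) (I : OpenIdeal A) :
    ∃ (c : Γ(specQuot I, preim I U)) (k : ℕ), (res hWU s ^ k * y).1 I =
      (specQuot I).presheaf.map (homOfLE (preim_mono I hWU)).op c := by
  subst hW
  exact hU.exists_pow_mul_apply_eq s y I

/-- A section of one component is a fraction: the numerator lifts to `A`, and the denominator is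
already invertible in `sections W`. -/
lemma eval_surjective_of_eq (s : sections (⊤ : Opens (SpfTop A))) {W : Opens (SpfTop A)}
    (hW : W = nonvanishing s) (I : OpenIdeal A) (x : Γ(specQuot I, preim I W)) :
    ∃ t : sections W, t.1 I = x := by
  subst hW
  have e := preim_nonvanishing I s
  obtain ⟨c, k, h⟩ := exists_pow_mul_eq_res_basicOpen (isAff_top I) (s.1 I)
    ((specQuot I).presheaf.map (homOfLE e.ge).op x)
  obtain ⟨d, rfl⟩ := toSections_top_apply_surjective I c
  have h2 := congrArg ((specQuot I).presheaf.map (homOfLE e.le).op) h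
  simp only [map_mul, map_pow, ← CommRingCat.comp_apply, ← Functor.map_comp] at h2
  have h3 : (res (nonvanishing_le s) s).1 I ^ k * x =
      (res (nonvanishing_le s) (toSections ⊤ d)).1 I := by
    refine Eq.trans ?_ h2
    rw [res_apply]
    congr 1
  obtain ⟨u, hu⟩ := ((isUnit_res_nonvanishing s).pow k).exists_left_inv
  refine ⟨u * res (nonvanishing_le s) (toSections ⊤ d), ?_⟩
  change u.1 I * (res (nonvanishing_le s) (toSections ⊤ d)).1 I = x
  have hu' : u.1 I * (res (nonvanishing_le s) s).1 I ^ k = 1 := congr($(hu).1 I)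
  rw [← h3, ← mul_assoc, hu', one_mul]

lemma eval_basicOpen_surjective (I : OpenIdeal A) (x : Γ(specQuot I, preim I (basicOpen a))) :
    ∃ s : sections (basicOpen a), s.1 I = x :=
  eval_surjective_of_eq (toSections ⊤ a) (by rw [nonvanishing_toSections, inf_top_eq]) I x

/-- The structure sheaf of the basic open subset. -/
def basicOpenSheaf : TopSheaf (SpfTop (sections (basicOpen a))) :=
  (Spf.topSheaf A).restrict (isOpenEmbedding_mapBase_basicOpen a)

/-- The sections over the basic open subset. -/
def basicOpenHom : sections (basicOpen a) →+* (basicOpenSheaf a).obj ⊤ := res (functor_le a ⊤)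

/-- For a section `b` over `basicOpen a`, the set `basicOpen b` corresponds to `nonvanishing b`.
This need not be given by an element of `A`, but it is affine in each `Spec (A ⧸ I)`; the notion
`IsAff` is introduced for such subsets. -/
lemma isChart_basicOpen : IsChart (basicOpenSheaf a) (basicOpenHom a) where
  continuous := continuous_res (functor_le a ⊤)
  isUnit b := by
    have h := isUnit_res_of_eq b (functor_basicOpen a b) (functor_le a _)
    rw [← res_res (functor_le a ⊤) ((isOpenEmbedding_mapBase_basicOpen a).functor.map
      (homOfLE le_top)).le] at h
    exact h
  complete b := by
    refine isCompleteLinear_sections (U := (isOpenEmbedding_mapBase_basicOpen a).functor.obj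
      (basicOpen b)) ?_
    rw [functor_basicOpen]
    exact ((isAff_basicOpen a).isAff_nonvanishing b).isCompact
  exists_nhds b I := by
    have hc : IsCompact ((isOpenEmbedding_mapBase_basicOpen a).functor.obj
      (basicOpen b) : Set (SpfTop A)) := by
      rw [functor_basicOpen]
      exact ((isAff_basicOpen a).isAff_nonvanishing b).isCompact
    obtain ⟨J, -, hJ⟩ := (nhds_zero_hasBasis (isCompact_basicOpen a)).mem_iff.mp
      (I.2.mem_nhds I.1.zero_mem)
    refine ⟨_, (isOpen_kerEval hc J).mem_nhds (Submodule.zero_mem _), fun c hc => ?_⟩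
    obtain ⟨k, hk⟩ := (isAff_basicOpen a).exists_pow_mul_mem_kerEval b c (functor_basicOpen a b)
      (functor_le a _) J (by
        rw [← res_res (functor_le a ⊤) ((isOpenEmbedding_mapBase_basicOpen a).functor.map
          (homOfLE le_top)).le]
        exact hc)
    exact ⟨k, hJ hk⟩

lemma exists_pow_mul_sub_mem_kerEval (b : sections (basicOpen a)) {W : Opens (SpfTop A)}
    (hW : W = nonvanishing b) (hWU : W ≤ basicOpen a) (y : sections W) (I : OpenIdeal A) :
    ∃ (c : sections (basicOpen a)) (k : ℕ), res hWU b ^ k * y - res hWU c ∈ kerEval W I := by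
  obtain ⟨c, k, h⟩ := (isAff_basicOpen a).exists_pow_mul_apply_eq_of_eq b hW hWU y I
  obtain ⟨d, rfl⟩ := eval_basicOpen_surjective a I c
  exact ⟨d, k, sub_eq_zero.mpr h⟩

lemma mem_closure_setOf_pow_mul_eq (b : sections (basicOpen a)) {W : Opens (SpfTop A)}
    (hW : W = nonvanishing b) (hWU : W ≤ basicOpen a) (y : sections W) :
    y ∈ closure {w : sections W | ∃ (c : sections (basicOpen a)) (m : ℕ),
      res hWU b ^ m * w = res hWU c} := by
  have hc : IsCompact (W : Set (SpfTop A)) := by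
    rw [hW]
    exact ((isAff_basicOpen a).isAff_nonvanishing b).isCompact
  refine mem_closure_of_forall_sub_mem fun N hN => ?_
  obtain ⟨I, -, hI⟩ := (nhds_zero_hasBasis hc).mem_iff.mp hN
  obtain ⟨c, k, h⟩ := exists_pow_mul_sub_mem_kerEval a b hW hWU y I
  exact exists_fraction_sub_mem (isUnit_res_of_eq b hW hWU) ⟨c, rfl⟩ hI h

lemma res_functor_le (b c : sections (basicOpen a)) : res (functor_le a (basicOpen b)) c =
    (basicOpenSheaf a).res (le_top : basicOpen b ≤ ⊤) (basicOpenHom a c) :=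
  (res_res (functor_le a ⊤) ((isOpenEmbedding_mapBase_basicOpen a).functor.map
    (homOfLE le_top)).le c).symm

lemma subset_fractions_basicOpen (b : sections (basicOpen a)) :
    {w : sections ((isOpenEmbedding_mapBase_basicOpen a).functor.obj (basicOpen b)) |
      ∃ (c : sections (basicOpen a)) (m : ℕ), res (functor_le a _) b ^ m * w =
        res (functor_le a _) c} ⊆ IsChart.fractions (basicOpenSheaf a) (basicOpenHom a) b := by
  intro w hw
  obtain ⟨c, m, hw⟩ := hw
  refine ⟨c, m, Eq.trans ?_ (hw.trans (res_functor_le a b c))⟩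
  exact congrArg (fun z : sections ((isOpenEmbedding_mapBase_basicOpen a).functor.obj
    (basicOpen b)) => z ^ m * w) (res_functor_le a b b).symm

lemma mem_closure_fractions_basicOpen (b : sections (basicOpen a))
    (y : (basicOpenSheaf a).obj (basicOpen b)) :
    y ∈ closure (IsChart.fractions (basicOpenSheaf a) (basicOpenHom a) b) :=
  closure_mono (subset_fractions_basicOpen a b)
    (mem_closure_setOf_pow_mul_eq a b (functor_basicOpen a b) (functor_le a _) y)

/-- The identification of `Spf (sections (basicOpen a))` with `basicOpen a`. -/
def openIsoBasicOpen : TopSheaf.OpenIso (Spf (sections (basicOpen a))).topSheaf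
    (Spf A).topSheaf where
  base := mapBase (toSections (basicOpen a)) (continuous_toSections _)
  isOpenEmbedding := isOpenEmbedding_mapBase_basicOpen a
  hom U := (isChart_basicOpen a).ThetaHom U
  hom_res h s := (isChart_basicOpen a).ThetaHom_res h s
  bijective U := ⟨(isChart_basicOpen a).ThetaHom_injective U, fun y =>
    (isChart_basicOpen a).exists_ThetaHom_eq y fun p hp => by
      obtain ⟨b, hpb, hb⟩ := exists_basicOpen_le hp
      exact ⟨b, hb, hpb, mem_closure_fractions_basicOpen a b _⟩⟩
  isInducing U := (isChart_basicOpen a).isInducing_ThetaHom U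

/-- The open immersion of `basicOpen a`. -/
def basicOpenι : Spf (sections (basicOpen a)) ⟶ Spf A :=
  LocallyTopRingedSpace.homOfOpenIso (openIsoBasicOpen a)

lemma isOpenImmersion_basicOpenι : LocallyTopRingedSpace.IsOpenImmersion (basicOpenι a) :=
  LocallyTopRingedSpace.isOpenImmersion_homOfOpenIso _

lemma range_basicOpenι : Set.range (basicOpenι a).toLRSHom.base = (basicOpen a : Set (SpfTop A)) :=
  range_mapBase_basicOpen a

end BasicOpen

end

end Spf

end FormalGeometry

/-! ### Morphisms on sections, gluing of equalities and open immersions. -/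

namespace FormalGeometry

noncomputable section

namespace LocallyTopRingedSpace

variable {T X Y Z : LocallyTopRingedSpace.{u}}

/-- The open subset where a section is invertible. -/
def nonvanishing {U : Opens T.carrier} (s : T.topSheaf.obj U) : Opens T.carrier :=
  RingedSpace.basicOpen (X := T.toRingedSpace) (U := U) s

lemma nonvanishing_le {U : Opens T.carrier} (s : T.topSheaf.obj U) : nonvanishing s ≤ U :=
  RingedSpace.basicOpen_le (X := T.toRingedSpace) (U := U) s

lemma isUnit_res_nonvanishing {U : Opens T.carrier} (s : T.topSheaf.obj U) :
    IsUnit (T.topSheaf.res (nonvanishing_le s) s) :=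
  RingedSpace.isUnit_res_basicOpen (X := T.toRingedSpace) (U := U) s

lemma mem_nonvanishing_iff {U : Opens T.carrier} (s : T.topSheaf.obj U) {x : T.carrier}
    (hx : x ∈ U) : x ∈ nonvanishing s ↔ IsUnit (T.presheaf.germ U x hx s) :=
  RingedSpace.mem_basicOpen (X := T.toRingedSpace) (U := U) s x hx

lemma nonvanishing_res {U V : Opens T.carrier} (h : V ≤ U) (s : T.topSheaf.obj U) :
    nonvanishing (T.topSheaf.res h s) = V ⊓ nonvanishing s :=
  RingedSpace.basicOpen_res (X := T.toRingedSpace) (homOfLE h).op s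

lemma mem_nonvanishing_of_isUnit {U V : Opens T.carrier} (h : V ≤ U) {s : T.topSheaf.obj U}
    (hs : IsUnit (T.topSheaf.res h s)) : V ≤ nonvanishing s := by
  intro x hx
  have h1 : x ∈ nonvanishing (T.topSheaf.res h s) :=
    (mem_nonvanishing_iff _ hx).mpr (hs.map (T.presheaf.germ V x hx).hom)
  rw [nonvanishing_res] at h1
  exact h1.2

lemma isUnit_of_le_nonvanishing {U : Opens T.carrier} {s : T.topSheaf.obj U}
    (h : U ≤ nonvanishing s) : IsUnit s := by
  have h1 := (isUnit_res_nonvanishing s).map (T.topSheaf.res h)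
  rwa [TopSheaf.res_res, TopSheaf.res_refl] at h1

lemma nonvanishing_mul {U : Opens T.carrier} (s t : T.topSheaf.obj U) :
    nonvanishing (s * t) = nonvanishing s ⊓ nonvanishing t :=
  RingedSpace.basicOpen_mul (X := T.toRingedSpace) (U := U) s t

lemma mem_nonvanishing_or {U : Opens T.carrier} {s t : T.topSheaf.obj U} {x : T.carrier}
    (h : x ∈ nonvanishing (s + t)) : x ∈ nonvanishing s ∨ x ∈ nonvanishing t := by
  have hx := nonvanishing_le _ h
  rw [mem_nonvanishing_iff _ hx] at h ⊢
  rw [mem_nonvanishing_iff _ hx]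
  have h1 : IsUnit ((T.presheaf.germ U x hx).hom s + (T.presheaf.germ U x hx).hom t) :=
    (congrArg IsUnit (map_add (T.presheaf.germ U x hx).hom s t)).mp h
  have : IsLocalRing (T.presheaf.stalk x) := T.isLocalRing x
  exact IsLocalRing.isUnit_or_isUnit_of_isUnit_add h1

lemma nonvanishing_one (U : Opens T.carrier) : nonvanishing (1 : T.topSheaf.obj U) = U :=
  le_antisymm (nonvanishing_le _) (mem_nonvanishing_of_isUnit le_rfl (by rw [map_one]; exact isUnit_one))

lemma nonvanishing_zero (U : Opens T.carrier) : nonvanishing (0 : T.topSheaf.obj U) = ⊥ := by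
  refine le_bot_iff.mp fun x hx => ?_
  have h := (mem_nonvanishing_iff _ (nonvanishing_le _ hx)).mp hx
  have h0 := map_zero (T.presheaf.germ U x (nonvanishing_le _ hx)).hom
  have : IsLocalRing (T.presheaf.stalk x) := T.isLocalRing x
  exact (not_isUnit_zero (h0 ▸ h)).elim

/-- The underlying map of a morphism. -/
abbrev Hom.fn (f : X ⟶ Y) : X.carrier → Y.carrier := f.toLRSHom.base

lemma Hom.continuous_fn (f : X ⟶ Y) : Continuous (Hom.fn f) := f.toLRSHom.base.hom.continuous

/-- The map from the sections over `U` to the sections over an open subset of the preimage. -/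
def Hom.appLE (f : X ⟶ Y) (U : Opens Y.carrier) (V : Opens X.carrier)
    (h : V ≤ (Opens.map f.toLRSHom.base).obj U) : Y.topSheaf.obj U →+* X.topSheaf.obj V :=
  (X.topSheaf.res h).comp (f.toLRSHom.c.app (op U)).hom

variable (f : X ⟶ Y) (g : Y ⟶ Z)

lemma Hom.continuous_appLE (U : Opens Y.carrier) (V : Opens X.carrier)
    (h : V ≤ (Opens.map f.toLRSHom.base).obj U) : Continuous (Hom.appLE f U V h) :=
  (X.topSheaf.continuous_res h).comp (f.continuous_app U)

lemma Hom.appLE_res {U U' : Opens Y.carrier} {V : Opens X.carrier} (hU : U' ≤ U)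
    (h : V ≤ (Opens.map f.toLRSHom.base).obj U') (s : Y.topSheaf.obj U) :
    Hom.appLE f U' V h (Y.topSheaf.res hU s) = Hom.appLE f U V (fun _ hx => hU (h hx)) s := by
  have h1 : f.toLRSHom.c.app (op U') (Y.topSheaf.res hU s) = X.topSheaf.res
      (fun _ hx => hU hx : (Opens.map f.toLRSHom.base).obj U' ≤
        (Opens.map f.toLRSHom.base).obj U) (f.toLRSHom.c.app (op U) s) :=
    congr($(f.toLRSHom.c.naturality (homOfLE hU).op) s)
  exact (congrArg (X.topSheaf.res h) h1).trans (X.topSheaf.res_res _ h _)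

lemma Hom.res_appLE {U : Opens Y.carrier} {V V' : Opens X.carrier} (hV : V' ≤ V)
    (h : V ≤ (Opens.map f.toLRSHom.base).obj U) (s : Y.topSheaf.obj U) :
    X.topSheaf.res hV (Hom.appLE f U V h s) = Hom.appLE f U V' (hV.trans h) s :=
  X.topSheaf.res_res h hV _

lemma Hom.comp_appLE {U : Opens Z.carrier} {V : Opens Y.carrier} {W : Opens X.carrier}
    (hV : V ≤ (Opens.map g.toLRSHom.base).obj U) (hW : W ≤ (Opens.map f.toLRSHom.base).obj V)
    (s : Z.topSheaf.obj U) :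
    Hom.appLE (f ≫ g) U W (fun _ hx => hV (hW hx)) s =
      Hom.appLE f V W hW (Hom.appLE g U V hV s) := by
  exact (Hom.appLE_res f hV hW (g.toLRSHom.c.app (op U) s)).symm

lemma Hom.id_appLE {U V : Opens X.carrier} (h : V ≤ U) (s : X.topSheaf.obj U) :
    Hom.appLE (𝟙 X) U V h s = X.topSheaf.res h s := rfl

lemma Hom.mem_nonvanishing_appLE {U : Opens Y.carrier} {V : Opens X.carrier}
    (h : V ≤ (Opens.map f.toLRSHom.base).obj U) (s : Y.topSheaf.obj U) {x : X.carrier}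
    (hx : x ∈ V) : x ∈ nonvanishing (Hom.appLE f U V h s) ↔ Hom.fn f x ∈ nonvanishing s := by
  have h1 : (Opens.map f.toLRSHom.base).obj (nonvanishing s) =
      nonvanishing (T := X) (U := (Opens.map f.toLRSHom.base).obj U)
        (f.toLRSHom.c.app (op U) s) :=
    LocallyRingedSpace.preimage_basicOpen f.toLRSHom (U := U) s
  have h2 : nonvanishing (Hom.appLE f U V h s) = V ⊓ (Opens.map f.toLRSHom.base).obj
    (nonvanishing s) := by
    rw [h1]
    exact nonvanishing_res h _
  rw [h2]
  exact ⟨fun h => h.2, fun h => ⟨hx, h⟩⟩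

/-- The section maps are compared on any `V` inside both preimages, so no transport along an
equality of base maps appears, and equality may be checked locally. -/
lemma Hom.ext' {f g : X ⟶ Y} (h : ∀ x, Hom.fn f x = Hom.fn g x)
    (h' : ∀ (U : Opens Y.carrier) (x : X.carrier) (_ : Hom.fn f x ∈ U) (s : Y.topSheaf.obj U),
      ∃ (V : Opens X.carrier) (hf : V ≤ (Opens.map f.toLRSHom.base).obj U)
        (hg : V ≤ (Opens.map g.toLRSHom.base).obj U),
        x ∈ V ∧ Hom.appLE f U V hf s = Hom.appLE g U V hg s) : f = g := by
  obtain ⟨⟨⟨fb, fc⟩, hf⟩, hfc⟩ := f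
  obtain ⟨⟨⟨gb, gc⟩, hg⟩, hgc⟩ := g
  obtain rfl : fb = gb := TopCat.ext h
  suffices fc = gc by subst this; rfl
  refine NatTrans.ext (funext fun U => CommRingCat.hom_ext (RingHom.ext fun s => ?_))
  choose V hVf hVg hxV hV using h' U.unop
  refine X.topSheaf.eq_of_res_eq (U := (Opens.map fb).obj U.unop)
    (fun x : (Opens.map fb).obj U.unop => V x.1 x.2 s) (fun x => hVf x.1 x.2 s) ?_
    fun x => hV x.1 x.2 s
  exact fun x hx => Opens.mem_iSup.mpr ⟨⟨x, hx⟩, hxV x hx s⟩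

/-- Construction of morphisms from maps on sections. -/
def homMk (b : X.carrier ⟶ Y.carrier)
    (app : ∀ U : Opens Y.carrier, Y.topSheaf.obj U →+* X.topSheaf.obj ((Opens.map b).obj U))
    (app_res : ∀ (U V : Opens Y.carrier) (h : V ≤ U) (s : Y.topSheaf.obj U),
      app V (Y.topSheaf.res h s) = X.topSheaf.res ((Opens.map b).map (homOfLE h)).le (app U s))
    (continuous_app : ∀ U, Continuous (app U))
    (mem_nonvanishing : ∀ (U : Opens Y.carrier) (s : Y.topSheaf.obj U) (x : X.carrier),
      x ∈ nonvanishing (app U s) → b x ∈ nonvanishing s) : X ⟶ Y where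
  toLRSHom :=
    { toHom :=
        { base := b
          c := { app := fun U => CommRingCat.ofHom (app U.unop)
                 naturality := fun _ _ i => CommRingCat.hom_ext (RingHom.ext fun s =>
                  app_res _ _ i.unop.le s) } }
      prop := fun x => by
        refine ⟨fun a ha => ?_⟩
        obtain ⟨U, hU, s, rfl⟩ := TopCat.Presheaf.exists_germ_eq _ a
        -- A germ is invertible if and only if its point lies in the nonvanishing locus of a
        -- representing section, so locality on stalks is the hypothesis `mem_nonvanishing`.
        rw [PresheafedSpace.stalkMap_germ_apply] at ha
        exact (mem_nonvanishing_iff (T := Y) s hU).mp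
          (mem_nonvanishing U s x ((mem_nonvanishing_iff (T := X) (U := (Opens.map b).obj U)
            (app U s) hU).mpr ha)) }
  continuous_app := continuous_app

/-- A criterion for open immersions. -/
lemma isOpenImmersion_of_bijective (hb : IsOpenEmbedding (Hom.fn f))
    (h : ∀ U : Opens Y.carrier, (U : Set Y.carrier) ⊆ Set.range (Hom.fn f) →
      Function.Bijective (Hom.appLE f U _ le_rfl) ∧ IsInducing (Hom.appLE f U _ le_rfl)) :
    IsOpenImmersion f := by
  have e (U : Opens Y.carrier) : ⇑(Hom.appLE f U _ le_rfl) = f.toLRSHom.c.app (op U) :=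
    funext fun s => X.topSheaf.res_refl _
  refine ⟨⟨hb, fun U => ?_⟩, fun U hU => ?_⟩
  · have h1 := (h (hb.functor.obj U) (Set.image_subset_range _ _)).1
    rw [e] at h1
    exact (RingEquiv.ofBijective _ h1).toCommRingCatIso.isIso_hom
  · have h1 := (h U hU).2
    rw [e] at h1
    exact h1

variable {f}

lemma IsOpenImmersion.isOpenEmbedding (hf : IsOpenImmersion f) : IsOpenEmbedding (Hom.fn f) :=
  hf.isOpenImmersion.base_open

lemma IsOpenImmersion.bijective_appLE (hf : IsOpenImmersion f) {U : Opens Y.carrier}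
    (hU : (U : Set Y.carrier) ⊆ Set.range (Hom.fn f)) {V : Opens X.carrier}
    (hV : V = (Opens.map f.toLRSHom.base).obj U) :
    Function.Bijective (Hom.appLE f U V hV.le) := by
  subst hV
  have e : ⇑(Hom.appLE f U _ le_rfl) = f.toLRSHom.c.app (op U) :=
    funext fun s => X.topSheaf.res_refl _
  rw [e]
  have h := hf.isOpenImmersion
  have h1 : IsIso (f.toLRSHom.c.app (op U)) := by
    obtain ⟨W, rfl⟩ : ∃ W, hf.isOpenEmbedding.functor.obj W = U :=
      ⟨(Opens.map f.toLRSHom.base).obj U, by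
        ext y
        refine ⟨?_, fun hy => ?_⟩
        · rintro ⟨x, hx, rfl⟩
          exact hx
        · obtain ⟨x, rfl⟩ := hU hy
          exact ⟨x, hy, rfl⟩⟩
    exact h.c_iso W
  exact ConcreteCategory.bijective_of_isIso (f.toLRSHom.c.app (op U))

lemma IsOpenImmersion.isInducing_appLE (hf : IsOpenImmersion f) {U : Opens Y.carrier}
    (hU : (U : Set Y.carrier) ⊆ Set.range (Hom.fn f)) {V : Opens X.carrier}
    (hV : V = (Opens.map f.toLRSHom.base).obj U) :
    IsInducing (Hom.appLE f U V hV.le) := by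
  subst hV
  have e : ⇑(Hom.appLE f U _ le_rfl) = f.toLRSHom.c.app (op U) :=
    funext fun s => X.topSheaf.res_refl _
  rw [e]
  exact hf.isInducing U hU

lemma IsOpenImmersion.comp {g : Y ⟶ Z} (hf : IsOpenImmersion f) (hg : IsOpenImmersion g) :
    IsOpenImmersion (f ≫ g) := by
  refine isOpenImmersion_of_bijective _ (hg.isOpenEmbedding.comp hf.isOpenEmbedding) fun U hU => ?_
  have h1 : (U : Set Z.carrier) ⊆ Set.range (Hom.fn g) :=
    hU.trans (Set.range_comp_subset_range (Hom.fn f) (Hom.fn g))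
  have h2 : (((Opens.map g.toLRSHom.base).obj U : Opens Y.carrier) : Set Y.carrier) ⊆
      Set.range (Hom.fn f) := by
    intro y hy
    obtain ⟨x, hx⟩ := hU hy
    exact ⟨x, hg.isOpenEmbedding.injective hx⟩
  have e : ⇑(Hom.appLE (f ≫ g) U _ le_rfl) =
      Hom.appLE f _ _ le_rfl ∘ Hom.appLE g U ((Opens.map g.toLRSHom.base).obj U) le_rfl :=
    funext fun s => Hom.comp_appLE f g le_rfl le_rfl s
  rw [e]
  exact ⟨(hf.bijective_appLE h2 rfl).comp (hg.bijective_appLE h1 rfl),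
    (hf.isInducing_appLE h2 rfl).comp (hg.isInducing_appLE h1 rfl)⟩

lemma isOpenImmersion_id (X : LocallyTopRingedSpace.{u}) : IsOpenImmersion (𝟙 X) := by
  refine isOpenImmersion_of_bijective _ IsOpenEmbedding.id fun U _ => ?_
  have e : ⇑(Hom.appLE (𝟙 X) U _ le_rfl) = id := funext fun s => X.topSheaf.res_refl s
  rw [e]
  exact ⟨Function.bijective_id, IsInducing.id⟩

end LocallyTopRingedSpace

end

end FormalGeometry

/-! ### Rings of sections of formal schemes over quasi-compact open subsets. -/

namespace FormalGeometry

noncomputable section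

set_option linter.unusedSectionVars false

namespace LocallyTopRingedSpace

namespace IsOpenImmersion

variable {X Y : LocallyTopRingedSpace.{u}} {j : Y ⟶ X} (hj : IsOpenImmersion j)
include hj

/-- The image of an open subset under an open immersion. -/
def img (U : Opens Y.carrier) : Opens X.carrier := hj.isOpenEmbedding.functor.obj U

lemma fn_mem_img {U : Opens Y.carrier} {y : Y.carrier} : Hom.fn j y ∈ hj.img U ↔ y ∈ U :=
  ⟨fun ⟨_, hx, e⟩ => hj.isOpenEmbedding.injective e ▸ hx, fun h => ⟨y, h, rfl⟩⟩

lemma img_subset_range (U : Opens Y.carrier) :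
    (hj.img U : Set X.carrier) ⊆ Set.range (Hom.fn j) := Set.image_subset_range _ _

lemma map_img (U : Opens Y.carrier) : (Opens.map j.toLRSHom.base).obj (hj.img U) = U :=
  Opens.ext (Set.ext fun _ => hj.fn_mem_img)

lemma img_mono {U V : Opens Y.carrier} (h : U ≤ V) : hj.img U ≤ hj.img V :=
  Set.image_mono h

lemma coe_img_top : (hj.img ⊤ : Set X.carrier) = Set.range (Hom.fn j) := Set.image_univ

lemma isCompact_img {U : Opens Y.carrier} (hU : IsCompact (U : Set Y.carrier)) :
    IsCompact (hj.img U : Set X.carrier) := hU.image (Hom.continuous_fn j)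

/-- The sections over the image of an open subset. -/
def secEquiv (U : Opens Y.carrier) : X.topSheaf.obj (hj.img U) ≃+* Y.topSheaf.obj U :=
  RingEquiv.ofBijective (Hom.appLE j (hj.img U) U (hj.map_img U).ge)
    (hj.bijective_appLE (hj.img_subset_range U) (hj.map_img U).symm)

lemma secEquiv_apply {U : Opens Y.carrier} (s : X.topSheaf.obj (hj.img U)) :
    hj.secEquiv U s = Hom.appLE j (hj.img U) U (hj.map_img U).ge s := rfl

lemma isInducing_secEquiv (U : Opens Y.carrier) : IsInducing (hj.secEquiv U) :=
  hj.isInducing_appLE (hj.img_subset_range U) (hj.map_img U).symm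

lemma continuous_secEquiv_symm (U : Opens Y.carrier) : Continuous (hj.secEquiv U).symm := by
  rw [(hj.isInducing_secEquiv U).continuous_iff]
  convert continuous_id using 1
  ext s
  exact (hj.secEquiv U).apply_symm_apply s

lemma secEquiv_res {U V : Opens Y.carrier} (h : V ≤ U) (s : X.topSheaf.obj (hj.img U)) :
    hj.secEquiv V (X.topSheaf.res (hj.img_mono h) s) = Y.topSheaf.res h (hj.secEquiv U s) := by
  rw [secEquiv_apply, secEquiv_apply, Hom.appLE_res, Hom.res_appLE]

end IsOpenImmersion

/-- The ideal of the sections that are nowhere invertible. -/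
def nilIdeal {T : LocallyTopRingedSpace.{u}} (U : Opens T.carrier) : Ideal (T.topSheaf.obj U) where
  carrier := {s | nonvanishing s = ⊥}
  add_mem' {s t} hs ht := le_bot_iff.mp fun x hx => by
    rcases mem_nonvanishing_or hx with h | h
    · exact hs.le h
    · exact ht.le h
  zero_mem' := nonvanishing_zero U
  smul_mem' c s hs := by
    change nonvanishing (c * s) = ⊥
    rw [nonvanishing_mul, show nonvanishing s = ⊥ from hs, inf_bot_eq]

lemma mem_nilIdeal {T : LocallyTopRingedSpace.{u}} {U : Opens T.carrier} {s : T.topSheaf.obj U} :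
    s ∈ nilIdeal U ↔ nonvanishing s = ⊥ := Iff.rfl

lemma mem_nilIdeal_iff_of_cover {T : LocallyTopRingedSpace.{u}} {ι : Type*} {U : Opens T.carrier}
    (V : ι → Opens T.carrier) (hV : ∀ k, V k ≤ U) (hU : U ≤ iSup V) {s : T.topSheaf.obj U} :
    s ∈ nilIdeal U ↔ ∀ k, T.topSheaf.res (hV k) s ∈ nilIdeal (V k) := by
  simp only [mem_nilIdeal, nonvanishing_res]
  refine ⟨fun h k => by rw [h, inf_bot_eq], fun h => le_bot_iff.mp fun x hx => ?_⟩
  obtain ⟨k, hk⟩ := Opens.mem_iSup.mp (hU (nonvanishing_le _ hx))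
  exact (h k).le ⟨hk, hx⟩

lemma Hom.appLE_mem_nilIdeal {X Y : LocallyTopRingedSpace.{u}} (f : X ⟶ Y) {U : Opens Y.carrier}
    {V : Opens X.carrier} (h : V ≤ (Opens.map f.toLRSHom.base).obj U) {s : Y.topSheaf.obj U} :
    Hom.appLE f U V h s ∈ nilIdeal V ↔ ∀ x ∈ V, Hom.fn f x ∉ nonvanishing s := by
  refine ⟨fun hs x hx hx' => ?_, fun hs => le_bot_iff.mp fun x hx => ?_⟩
  · exact (mem_nilIdeal.mp hs).le ((Hom.mem_nonvanishing_appLE f h s hx).mpr hx')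
  · have hx' := nonvanishing_le _ hx
    exact hs x hx' ((Hom.mem_nonvanishing_appLE f h s hx').mp hx)

/-- Formal schemes, as a property of locally topologically ringed spaces. -/
def IsFormal (T : LocallyTopRingedSpace.{u}) : Prop :=
  ∀ x : T.carrier, ∃ (A : Type u) (_ : CommRing A) (_ : TopologicalSpace A)
    (_ : IsAdmissibleRing A) (j : Spf A ⟶ T), IsOpenImmersion j ∧ x ∈ Set.range (Hom.fn j)

end LocallyTopRingedSpace

open LocallyTopRingedSpace

lemma FormalScheme.isFormal (X : FormalScheme.{u}) : X.toLocallyTopRingedSpace.IsFormal :=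
  X.exists_affine

namespace LocallyTopRingedSpace.IsFormal

variable {X : LocallyTopRingedSpace.{u}} (hX : X.IsFormal)
include hX

/-- Affine neighbourhoods can be made small because basic open subsets of formal spectra are again
formal spectra. -/
lemma exists_affine_subset {U : Opens X.carrier} {x : X.carrier} (hx : x ∈ U) :
    ∃ (A : Type u) (_ : CommRing A) (_ : TopologicalSpace A)
    (_ : IsAdmissibleRing A) (j : Spf A ⟶ X), IsOpenImmersion j ∧ x ∈ Set.range (Hom.fn j) ∧
      Set.range (Hom.fn j) ⊆ U := by
  obtain ⟨A, _, _, _, j, hj, p, rfl⟩ := hX x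
  obtain ⟨a, hpa, ha⟩ := Spf.exists_basicOpen_le (A := A)
    (U := (Opens.map j.toLRSHom.base).obj U) hx
  refine ⟨_, _, _, Spf.isAdmissibleRing_sections_basicOpen a, Spf.basicOpenι a ≫ j,
    (Spf.isOpenImmersion_basicOpenι a).comp hj, ?_, ?_⟩
  · have h : p ∈ Set.range (Spf.basicOpenι a).toLRSHom.base := by
      rw [Spf.range_basicOpenι]
      exact hpa
    obtain ⟨q, rfl⟩ := h
    exact ⟨q, rfl⟩
  · rintro _ ⟨q, rfl⟩
    have h : (Spf.basicOpenι a).toLRSHom.base q ∈ (Spf.basicOpen a : Set (SpfTop A)) := by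
      rw [← Spf.range_basicOpenι]
      exact ⟨q, rfl⟩
    exact ha h

end LocallyTopRingedSpace.IsFormal

/-- The nowhere invertible sections give an ideal of definition that depends on no choice, and can
therefore be compared between charts. -/
lemma Spf.isIdealOfDefinition_nilIdeal {A : Type u} [CommRing A] [TopologicalSpace A]
    [IsAdmissibleRing A] {U : Opens (Spf A).carrier}
    (hU : IsCompact (U : Set (Spf A).carrier)) :
    IsIdealOfDefinition (nilIdeal (T := Spf A) U) := by
  obtain ⟨K, hK⟩ := exists_openIdeal_isIdealOfDefinition A
  exact ⟨isOpen_ideal_of_le (R := (Spf A).topSheaf.obj U) (I := kerEval (A := A) U K)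
    (fun s hs => nonvanishing_eq_bot_of_apply_eq_zero (A := A) (U := U) hK hs)
    (isOpen_kerEval (A := A) (U := U) hU K),
    fun s hs => isTopologicallyNilpotent_of_nonvanishing_eq_bot (A := A) (U := U) hU hs⟩

lemma Spf.isAdmissibleRing_topSheaf {A : Type u} [CommRing A] [TopologicalSpace A]
    [IsAdmissibleRing A] {U : Opens (Spf A).carrier}
    (hU : IsCompact (U : Set (Spf A).carrier)) :
    IsAdmissibleRing ((Spf A).topSheaf.obj U) :=
  isAdmissibleRing_sections (A := A) hU

lemma isCountablyGenerated_nhds_zero {A : Type*} [CommRing A] [TopologicalSpace A]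
    [IsAdmissibleRing A] : (𝓝 (0 : A)).IsCountablyGenerated := by
  obtain ⟨I, -, hb⟩ := IsAdmissibleRing.exists_basis (A := A)
  exact hb.isCountablyGenerated

lemma isTopologicallyNilpotent_of_isInducing {R S : Type*} [CommRing R] [TopologicalSpace R]
    [CommRing S] [TopologicalSpace S] (f : R →+* S) (hf : IsInducing f) {x : R}
    (h : IsTopologicallyNilpotent (f x)) : IsTopologicallyNilpotent x := by
  rw [IsTopologicallyNilpotent, hf.tendsto_nhds_iff, map_zero]
  simpa only [IsTopologicallyNilpotent, ← map_pow, Function.comp_def] using h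

/-- A closed subring of an admissible ring is admissible. -/
lemma IsAdmissibleRing.of_isInducing {R S : Type*} [CommRing R] [TopologicalSpace R]
    [IsTopologicalRing R] [CommRing S] [TopologicalSpace S] [IsAdmissibleRing S] (f : R →+* S)
    (hf : IsInducing f) (hinj : Function.Injective f) (hcl : IsClosed (Set.range f)) :
    IsAdmissibleRing R := by
  have := IsCompleteLinear.of_isInducing f hf hinj hcl
  have := isCountablyGenerated_nhds_zero (A := S)
  have : (𝓝 (0 : R)).IsCountablyGenerated := by
    rw [hf.nhds_eq_comap, map_zero]
    infer_instance
  obtain ⟨I, hI, hI'⟩ := IsAdmissibleRing.exists_isIdealOfDefinition (A := S)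
  refine IsCompleteLinear.isAdmissibleRing ⟨I.comap f, hI.preimage hf.continuous, fun x hx => ?_⟩
  exact isTopologicallyNilpotent_of_isInducing f hf (hI' _ hx)

lemma TopSheaf.isCountablyGenerated_of_cover {X : TopCat.{u}} (F : TopSheaf X) {ι : Type u}
    [Finite ι] {U : Opens X} (V : ι → Opens X) (hV : ∀ k, V k ≤ U) (hU : U ≤ iSup V)
    (h : ∀ k, (𝓝 (0 : F.obj (V k))).IsCountablyGenerated) :
    (𝓝 (0 : F.obj U)).IsCountablyGenerated := by
  rw [(F.isInducing_pi_res V hV hU).nhds_eq_comap]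
  have : (𝓝 fun k => F.res (hV k) (0 : F.obj U)).IsCountablyGenerated := by
    simp only [map_zero, nhds_pi]
    infer_instance
  infer_instance

lemma TopSheaf.isTopologicallyNilpotent_of_cover {X : TopCat.{u}} (F : TopSheaf X) {ι : Type u}
    {U : Opens X} (V : ι → Opens X) (hV : ∀ k, V k ≤ U) (hU : U ≤ iSup V) {s : F.obj U}
    (h : ∀ k, IsTopologicallyNilpotent (F.res (hV k) s)) : IsTopologicallyNilpotent s := by
  rw [IsTopologicallyNilpotent, (F.isInducing_pi_res V hV hU).tendsto_nhds_iff, tendsto_pi_nhds]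
  intro k
  have := h k
  simp only [IsTopologicallyNilpotent, ← map_pow] at this
  simpa only [map_zero, Function.comp_def] using this

namespace LocallyTopRingedSpace

lemma mem_nilIdeal_secEquiv {X Y : LocallyTopRingedSpace.{u}} {j : Y ⟶ X}
    (hj : IsOpenImmersion j) {U : Opens Y.carrier} {s : X.topSheaf.obj (hj.img U)} :
    hj.secEquiv U s ∈ nilIdeal U ↔ s ∈ nilIdeal (hj.img U) := by
  rw [IsOpenImmersion.secEquiv_apply, Hom.appLE_mem_nilIdeal, mem_nilIdeal]
  refine ⟨fun h => le_bot_iff.mp fun x hx => ?_, fun h x hx hx' => h.le hx'⟩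
  obtain ⟨y, hy, rfl⟩ := nonvanishing_le _ hx
  exact h y hy hx

section Chart

variable {X : LocallyTopRingedSpace.{u}} {A : Type u} [CommRing A] [TopologicalSpace A]
  [IsAdmissibleRing A] {j : Spf A ⟶ X} (hj : IsOpenImmersion j)
include hj

lemma IsOpenImmersion.isAdmissibleRing_img {U : Opens (Spf A).carrier}
    (hU : IsCompact (U : Set (Spf A).carrier)) :
    IsAdmissibleRing (X.topSheaf.obj (hj.img U)) := by
  have := Spf.isAdmissibleRing_topSheaf hU
  refine IsAdmissibleRing.of_isInducing (hj.secEquiv U).toRingHom (hj.isInducing_secEquiv U)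
    (hj.secEquiv U).injective ?_
  rw [show Set.range (hj.secEquiv U).toRingHom = Set.univ from (hj.secEquiv U).surjective.range_eq]
  exact isClosed_univ

lemma IsOpenImmersion.isIdealOfDefinition_img {U : Opens (Spf A).carrier}
    (hU : IsCompact (U : Set (Spf A).carrier)) :
    IsIdealOfDefinition (nilIdeal (hj.img U)) := by
  have h := Spf.isIdealOfDefinition_nilIdeal hU
  refine ⟨?_, fun s hs => ?_⟩
  · have e : ((nilIdeal (hj.img U) : Ideal _) : Set (X.topSheaf.obj (hj.img U))) =
        hj.secEquiv U ⁻¹' nilIdeal U := Set.ext fun s => (mem_nilIdeal_secEquiv hj).symm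
    rw [e]
    exact h.1.preimage (hj.isInducing_secEquiv U).continuous
  · have h2 := h.2 _ ((mem_nilIdeal_secEquiv hj).mpr hs)
    exact isTopologicallyNilpotent_of_isInducing (hj.secEquiv U).toRingHom
      (hj.isInducing_secEquiv U) h2

end Chart

namespace IsFormal

variable {X : LocallyTopRingedSpace.{u}} (hX : X.IsFormal)
include hX

/-- Affine neighbourhoods. -/
lemma exists_nhds {U : Opens X.carrier} {x : X.carrier} (hx : x ∈ U) :
    ∃ V : Opens X.carrier, V ≤ U ∧ x ∈ V ∧ IsCompact (V : Set X.carrier) ∧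
      IsAdmissibleRing (X.topSheaf.obj V) ∧ IsIdealOfDefinition (nilIdeal V) := by
  obtain ⟨A, _, _, _, j, hj, ⟨p, rfl⟩, hjU⟩ := hX.exists_affine_subset hx
  have hc : IsCompact ((⊤ : Opens (Spf A).carrier) : Set (Spf A).carrier) :=
    Spf.isCompact_top (A := A)
  exact ⟨hj.img ⊤, fun x hx => hjU (hj.img_subset_range _ hx), hj.fn_mem_img.mpr trivial,
    hj.isCompact_img hc, hj.isAdmissibleRing_img hc, hj.isIdealOfDefinition_img hc⟩

lemma exists_cover (U : Opens X.carrier) : ∃ V : U → Opens X.carrier, (∀ k, V k ≤ U) ∧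
    (∀ k, k.1 ∈ V k) ∧ ∀ k, IsCompact (V k : Set X.carrier) ∧
      IsAdmissibleRing (X.topSheaf.obj (V k)) ∧ IsIdealOfDefinition (nilIdeal (V k)) := by
  choose V hV hx h using fun x : U => hX.exists_nhds x.2
  exact ⟨V, hV, hx, h⟩

lemma t2Space (U : Opens X.carrier) : T2Space (X.topSheaf.obj U) := by
  obtain ⟨V, hV, hx, h⟩ := hX.exists_cover U
  exact X.topSheaf.t2Space_of_cover V hV (fun x hx' => Opens.mem_iSup.mpr ⟨⟨x, hx'⟩, hx _⟩)
    fun k => (h k).2.1.toT2Space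

lemma isCompleteLinear (U : Opens X.carrier) : IsCompleteLinear (X.topSheaf.obj U) := by
  obtain ⟨V, hV, hx, h⟩ := hX.exists_cover U
  exact X.topSheaf.isCompleteLinear_of_cover V hV
    (fun x hx' => Opens.mem_iSup.mpr ⟨⟨x, hx'⟩, hx _⟩)
    (fun k => have := (h k).2.1; inferInstance) hX.t2Space

lemma exists_finite_cover {U : Opens X.carrier} (hU : IsCompact (U : Set X.carrier)) :
    ∃ (ι : Type u) (_ : Finite ι) (V : ι → Opens X.carrier), (∀ k, V k ≤ U) ∧ U ≤ iSup V ∧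
      ∀ k, IsCompact (V k : Set X.carrier) ∧
      IsAdmissibleRing (X.topSheaf.obj (V k)) ∧ IsIdealOfDefinition (nilIdeal (V k)) := by
  obtain ⟨V, hV, hx, h⟩ := hX.exists_cover U
  obtain ⟨t, ht⟩ := hU.elim_finite_subcover (fun k => (V k : Set X.carrier))
    (fun k => (V k).isOpen) fun x hx' => Set.mem_iUnion.mpr ⟨⟨x, hx'⟩, hx _⟩
  refine ⟨t, inferInstance, fun k => V k.1, fun k => hV _, fun x hx => ?_, fun k => h _⟩
  obtain ⟨k, hk, hxk⟩ := Set.mem_iUnion₂.mp (ht hx)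
  exact Opens.mem_iSup.mpr ⟨⟨k, hk⟩, hxk⟩

lemma isIdealOfDefinition_nilIdeal {U : Opens X.carrier} (hU : IsCompact (U : Set X.carrier)) :
    IsIdealOfDefinition (nilIdeal U) := by
  obtain ⟨ι, _, V, hV, hUV, h⟩ := hX.exists_finite_cover hU
  refine ⟨?_, fun s hs => X.topSheaf.isTopologicallyNilpotent_of_cover V hV hUV fun k =>
    (h k).2.2.2 _ ((mem_nilIdeal_iff_of_cover V hV hUV).mp hs k)⟩
  have e : ((nilIdeal U : Ideal _) : Set (X.topSheaf.obj U)) =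
      ⋂ k, X.topSheaf.res (hV k) ⁻¹' nilIdeal (V k) := by
    ext s
    simp only [Set.mem_iInter]
    exact mem_nilIdeal_iff_of_cover V hV hUV
  rw [e]
  -- Quasi-compactness is essential here: openness survives only finite intersections.
  exact isOpen_iInter_of_finite fun k => (h k).2.2.1.preimage (X.topSheaf.continuous_res _)

/-- Completeness holds over every open subset; a finite affine cover supplies the countable basis
and the ideal of definition. The quasi-compactness of the given pseudo-subscheme enters the
construction through this lemma. -/
lemma isAdmissibleRing {U : Opens X.carrier} (hU : IsCompact (U : Set X.carrier)) :
    IsAdmissibleRing (X.topSheaf.obj U) := by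
  obtain ⟨ι, _, V, hV, hUV, h⟩ := hX.exists_finite_cover hU
  have := hX.isCompleteLinear U
  have := X.topSheaf.isCountablyGenerated_of_cover V hV hUV
    fun k => have := (h k).2.1; isCountablyGenerated_nhds_zero
  exact IsCompleteLinear.isAdmissibleRing ⟨_, hX.isIdealOfDefinition_nilIdeal hU⟩

end IsFormal

end LocallyTopRingedSpace

end

end FormalGeometry

/-! ### Elements of the ring of an affine chart as sections. -/

namespace FormalGeometry

noncomputable section

set_option linter.unusedSectionVars false

open LocallyTopRingedSpace

/-- The basic open subsets of the space underlying `Spf A`. -/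
def Spf.D {A : Type u} [CommRing A] [TopologicalSpace A] [IsAdmissibleRing A] (a : A) :
    Opens (Spf A).carrier := Spf.basicOpen a

namespace LocallyTopRingedSpace.IsOpenImmersion

variable {X : LocallyTopRingedSpace.{u}} {A : Type u} [CommRing A] [TopologicalSpace A]
  [IsAdmissibleRing A] {j : Spf A ⟶ X} (hj : IsOpenImmersion j)
include hj

/-- The image of the ring of an affine chart in the rings of sections. -/
def ofChart (U : Opens (Spf A).carrier) : A →+* X.topSheaf.obj (hj.img U) :=
  (hj.secEquiv U).symm.toRingHom.comp (Spf.toSections (A := A) U)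

lemma secEquiv_ofChart (U : Opens (Spf A).carrier) (a : A) :
    hj.secEquiv U (hj.ofChart U a) = Spf.toSections (A := A) U a :=
  (hj.secEquiv U).apply_symm_apply _

lemma res_ofChart {U V : Opens (Spf A).carrier} (h : V ≤ U) (a : A) :
    X.topSheaf.res (hj.img_mono h) (hj.ofChart U a) = hj.ofChart V a := by
  apply (hj.secEquiv V).injective
  rw [secEquiv_res _ h, secEquiv_ofChart, secEquiv_ofChart]
  exact Spf.res_toSections (A := A) h a

lemma continuous_ofChart (U : Opens (Spf A).carrier) : Continuous (hj.ofChart U) :=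
  (hj.continuous_secEquiv_symm U).comp (Spf.continuous_toSections (A := A) U)

lemma isUnit_ofChart (a : A) : IsUnit (hj.ofChart (Spf.D a) a) :=
  (Spf.isUnit_toSections_basicOpen a).map (hj.secEquiv (Spf.D a)).symm.toRingHom

lemma mem_nonvanishing_ofChart {U : Opens (Spf A).carrier} (a : A) {p : SpfTop A} (hp : p ∈ U) :
    Hom.fn j p ∈ nonvanishing (hj.ofChart U a) ↔ p ∈ Spf.D a := by
  rw [← Hom.mem_nonvanishing_appLE j (hj.map_img U).ge (hj.ofChart U a) hp, ← secEquiv_apply,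
    secEquiv_ofChart]
  have h := Spf.nonvanishing_toSections (A := A) U a
  exact (SetLike.ext_iff.mp h p).trans ⟨fun h => h.1, fun h => ⟨h, hp⟩⟩

/-- Fractions are dense in the sections over basic open subsets. -/
lemma mem_closure_fractions (a : A) (y : X.topSheaf.obj (hj.img (Spf.D a))) :
    y ∈ closure {w | ∃ (c : A) (m : ℕ), hj.ofChart (Spf.D a) a ^ m * w =
      hj.ofChart (Spf.D a) c} := by
  have h := Spf.denseRange_awayToSections a (hj.secEquiv (Spf.D a) y)
  have h2 := map_mem_closure (hj.continuous_secEquiv_symm (Spf.D a)) h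
    (t := {w | ∃ (c : A) (m : ℕ), hj.ofChart (Spf.D a) a ^ m * w =
      hj.ofChart (Spf.D a) c}) (by
    rintro _ ⟨x, rfl⟩
    obtain ⟨c, k, hc⟩ := Spf.exists_pow_mul_eq_algebraMap a x
    refine ⟨c, k, ?_⟩
    have h3 := congrArg (Spf.awayToSections a) hc
    rw [map_mul, map_pow, Spf.awayToSections_algebraMap, Spf.awayToSections_algebraMap] at h3
    let σ : (Spf A).topSheaf.obj (Spf.D a) →+* X.topSheaf.obj (hj.img (Spf.D a)) :=
      (hj.secEquiv (Spf.D a)).symm.toRingHom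
    let u : (Spf A).topSheaf.obj (Spf.D a) := Spf.toSections (Spf.basicOpen a) a
    let v : (Spf A).topSheaf.obj (Spf.D a) := Spf.awayToSections a x
    have h4 : σ (u ^ k * v) = σ (Spf.toSections (Spf.basicOpen a) c) := congrArg σ h3
    rw [map_mul, map_pow] at h4
    exact h4)
  rwa [RingEquiv.symm_apply_apply] at h2

lemma exists_img_basicOpen_le {U : Opens X.carrier} {p : SpfTop A} (hp : Hom.fn j p ∈ U) :
    ∃ a : A, p ∈ Spf.D a ∧ hj.img (Spf.D a) ≤ U := by
  obtain ⟨a, hpa, ha⟩ := Spf.exists_basicOpen_le (A := A)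
    (U := (Opens.map j.toLRSHom.base).obj U) hp
  refine ⟨a, hpa, ?_⟩
  rintro _ ⟨q, hq, rfl⟩
  exact ha hq

lemma isCompact_img_basicOpen (a : A) : IsCompact (hj.img (Spf.D a) : Set X.carrier) :=
  hj.isCompact_img (Spf.isCompact_basicOpen a)

end LocallyTopRingedSpace.IsOpenImmersion

namespace Spf

section Map

variable {A B : Type u} [CommRing A] [TopologicalSpace A] [IsAdmissibleRing A]
  [CommRing B] [TopologicalSpace B] [IsAdmissibleRing B] (φ : A →+* B) (hφ : Continuous φ)

lemma specMap_toΓ (J : OpenIdeal B) (a : A) :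
    (specMap φ hφ J).appTop (toΓ (comapIdeal φ hφ J) a) = toΓ J (φ a) := by
  have h2 := congr($(Scheme.ΓSpecIso_inv_naturality
    (CommRingCat.ofHom (Ideal.quotientMap J.1 φ le_rfl)))
      (Ideal.Quotient.mk (comapIdeal φ hφ J).1 a))
  exact h2.symm

lemma mapSections_toSections (U : Opens (SpfTop A)) (a : A) :
    mapSections φ hφ U (toSections U a) = toSections _ (φ a) := by
  refine Subtype.ext (funext fun J => ?_)
  rw [mapSections_apply, toSections_apply, toSections_apply, ← specMap_toΓ φ hφ]
  simp only [← CommRingCat.comp_apply]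
  rw [Scheme.Hom.map_appLE, Scheme.Hom.appLE]
  rfl

lemma appLE_toSections {U : Opens (Spf A).carrier} {V : Opens (Spf B).carrier}
    (h : V ≤ (Opens.map (Spf.map φ hφ).toLRSHom.base).obj U) (a : A) :
    Hom.appLE (Spf.map φ hφ) U V h (toSections (A := A) U a) = toSections (A := B) V (φ a) := by
  have h1 := mapSections_toSections φ hφ U a
  exact (congrArg (res (A := B) h) h1).trans (res_toSections (A := B) h (φ a))

end Map

section Builder

variable {B : Type u} [CommRing B] [TopologicalSpace B] [IsAdmissibleRing B] {Z : TopCat.{u}}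
  {F : TopSheaf Z} {β : SpfTop B ⟶ Z} {hβ : IsOpenEmbedding β} {ψ : B →+* (F.restrict hβ).obj ⊤}

/-- The identification of `Spf B` with an open subspace given by a chart. -/
def IsChart.openIso (h : IsChart (F.restrict hβ) ψ)
    (hs : ∀ (U : Opens (SpfTop B)) (y : (F.restrict hβ).obj U), ∀ p ∈ U,
      ∃ (b : B) (hb : basicOpen b ≤ U), p ∈ basicOpen b ∧
        (F.restrict hβ).res hb y ∈ closure (fractions (F.restrict hβ) ψ b)) :
    TopSheaf.OpenIso (Spf B).topSheaf F where
  base := β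
  isOpenEmbedding := hβ
  hom U := h.ThetaHom U
  hom_res h' s := h.ThetaHom_res h' s
  bijective U := ⟨h.ThetaHom_injective U, fun y => h.exists_ThetaHom_eq y (hs U y)⟩
  isInducing U := h.isInducing_ThetaHom U

lemma IsChart.isInducing_codRestrict (h : IsChart (F.restrict hβ) ψ) (P : F.Sub)
    (U : Opens (SpfTop B)) (hm : ∀ s : sections U,
      h.ThetaHom U s ∈ P.subring (hβ.functor.obj U)) :
    IsInducing ((h.ThetaHom U).codRestrict (P.subring (hβ.functor.obj U)) hm) := by
  have h1 : IsInducing (Subtype.val : P.subring (hβ.functor.obj U) → F.obj (hβ.functor.obj U)) :=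
    IsInducing.subtypeVal
  have h2 : IsInducing (Subtype.val ∘ (h.ThetaHom U).codRestrict (P.subring (hβ.functor.obj U))
    hm) := h.isInducing_ThetaHom U
  exact h1.of_comp_iff.mp h2

/-- The identification of `Spf B` with an open subspace given by a chart for a subsheaf. -/
def IsChart.openIsoSub (h : IsChart (F.restrict hβ) ψ) (P : F.Sub)
    (hm : ∀ (U : Opens (SpfTop B)) (s : sections U),
      h.ThetaHom U s ∈ P.subring (hβ.functor.obj U))
    (hs : ∀ (U : Opens (SpfTop B)) (y : (F.restrict hβ).obj U),
      y ∈ P.subring (hβ.functor.obj U) → ∀ p ∈ U,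
      ∃ (b : B) (hb : basicOpen b ≤ U), p ∈ basicOpen b ∧
        (F.restrict hβ).res hb y ∈ closure (fractions (F.restrict hβ) ψ b)) :
    TopSheaf.OpenIso (Spf B).topSheaf P.toTopSheaf where
  base := β
  isOpenEmbedding := hβ
  hom U := (h.ThetaHom U).codRestrict (P.subring (hβ.functor.obj U)) (hm U)
  hom_res h' s := Subtype.ext (h.ThetaHom_res h' s)
  bijective U := ⟨fun s t hst => h.ThetaHom_injective U (congrArg Subtype.val hst), fun y => by
    obtain ⟨s, hs⟩ := h.exists_ThetaHom_eq y.1 (hs U y.1 y.2)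
    exact ⟨s, Subtype.ext hs⟩⟩
  isInducing U := h.isInducing_codRestrict P U (hm U)

end Builder

end Spf

end

end FormalGeometry

/-! ### Formal spectra of discrete rings and ordinary schemes. -/

namespace FormalGeometry

noncomputable section

set_option linter.unusedSectionVars false

open LocallyTopRingedSpace

namespace Spf

section Discrete

variable {R : Type u} [CommRing R] [TopologicalSpace R] [IsAdmissibleRing R] [DiscreteTopology R]

variable (R) in
/-- The zero ideal of a discrete ring. -/
def botIdeal : OpenIdeal R := ⟨⊥, isOpen_discrete _⟩

lemma botIdeal_le (J : OpenIdeal R) : botIdeal R ≤ J := bot_le (a := J.1)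

lemma specTrans_specTrans {I J K : OpenIdeal R} (h : I ≤ J) (h' : J ≤ K) :
    specTrans h' ≫ specTrans h = specTrans (h.trans h') := by
  rw [specTrans, specTrans, specTrans, ← Spec.map_comp]
  congr 1
  ext x
  rfl

/-- In a discrete ring the zero ideal is open, so the component at zero determines all the others.
-/
lemma bijective_eval_botIdeal (U : Opens (SpfTop R)) :
    Function.Bijective (eval U (botIdeal R)) := by
  refine ⟨fun s t hst => Subtype.ext (funext fun J => ?_), fun x => ?_⟩
  · rw [← s.2 _ J (botIdeal_le J), ← t.2 _ J (botIdeal_le J)]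
    exact congrArg _ hst
  · refine ⟨⟨fun J => (specTrans (botIdeal_le J)).appLE _ _ (preim_le _ U) x,
      fun I J h => ?_⟩, ?_⟩
    · rw [← CommRingCat.comp_apply, Scheme.Hom.appLE_comp_appLE]
      simp only [specTrans_specTrans]
    · change (specTrans (botIdeal_le (botIdeal R))).appLE _ _ (preim_le _ U) x = x
      have h : specTrans (botIdeal_le (botIdeal R)) = 𝟙 _ := by
        rw [specTrans, ← Spec.map_id]
        congr 1
        ext x
        rfl
      have h2 (f : specQuot (botIdeal R) ⟶ specQuot (botIdeal R)) (hf : f = 𝟙 _)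
          (V : (specQuot (botIdeal R)).Opens) (hV : V ≤ f ⁻¹ᵁ V) (x : Γ(specQuot (botIdeal R), V)) :
          f.appLE V V hV x = x := by
        subst hf
        exact congr($((specQuot (botIdeal R)).presheaf.map_id _) x)
      exact h2 _ h _ _ x

lemma isOpenEmbedding_ofQuot_botIdeal : IsOpenEmbedding (ofQuot (botIdeal R)) := by
  have h1 := ofQuot_isInducing (botIdeal R)
  have h2 : Function.Surjective (ofQuot (botIdeal R)) :=
    fun x => exists_ofQuot_eq (botIdeal R) x bot_le
  refine ⟨h1.isEmbedding, ?_⟩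
  rw [h2.range_eq]
  exact isOpen_univ

lemma isOpenImmersion_proj_botIdeal : LocallyRingedSpace.IsOpenImmersion (proj (botIdeal R)) where
  base_open := isOpenEmbedding_ofQuot_botIdeal
  c_iso U := by
    have h : Function.Bijective (evalHom (op (isOpenEmbedding_ofQuot_botIdeal.functor.obj U))
      (botIdeal R)) := bijective_eval_botIdeal (isOpenEmbedding_ofQuot_botIdeal.functor.obj U)
    exact (ConcreteCategory.isIso_iff_bijective _).mpr h

lemma discreteTopology_sections {U : Opens (SpfTop R)} (hU : IsCompact (U : Set (SpfTop R))) :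
    DiscreteTopology (sections U) := by
  have h := isOpen_kerEval hU (botIdeal R)
  refine discreteTopology_of_isOpen_singleton_zero ?_
  convert h
  ext s
  rw [SetLike.mem_coe, mem_kerEval, Set.mem_singleton_iff, ← (bijective_eval_botIdeal U).1.eq_iff,
    map_zero]
  rfl

end Discrete

end Spf

namespace LocallyTopRingedSpace

variable {T : LocallyTopRingedSpace.{u}}

/-- Spaces covered by formal spectra of discrete rings are ordinary schemes. -/
lemma isOrdinaryScheme_of_charts (h : ∀ x : T.carrier, ∃ (R : Type u) (_ : CommRing R)
    (_ : TopologicalSpace R) (_ : IsAdmissibleRing R) (_ : DiscreteTopology R) (j : Spf R ⟶ T),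
    IsOpenImmersion j ∧ x ∈ Set.range (Hom.fn j)) : IsOrdinaryScheme T := by
  refine ⟨⟨LocallyRingedSpace.IsOpenImmersion.scheme T.toLocallyRingedSpace fun x => ?_,
    ⟨Iso.refl _⟩⟩, fun U hU => ?_⟩
  · obtain ⟨R, _, _, _, _, j, hj, p, rfl⟩ := h x
    refine ⟨CommRingCat.of (R ⧸ (Spf.botIdeal R).1), Spf.proj (Spf.botIdeal R) ≫ j.toLRSHom, ?_, ?_⟩
    · obtain ⟨q, hq⟩ := Spf.exists_ofQuot_eq (Spf.botIdeal R) p bot_le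
      exact ⟨q, congrArg (Hom.fn j) hq⟩
    · have h1 := Spf.isOpenImmersion_proj_botIdeal (R := R)
      have h2 := hj.isOpenImmersion
      exact @PresheafedSpace.IsOpenImmersion.comp _ _ _ _ _ h1 _ _ h2
  -- Basic open subsets of the charts have discrete rings of sections, and discreteness passes to
  -- finite unions.
  · have key (x : U) : ∃ V : Opens T.carrier, V ≤ U ∧ x.1 ∈ V ∧
        DiscreteTopology (T.topSheaf.obj V) := by
      obtain ⟨R, _, _, _, _, j, hj, p, hp⟩ := h x.1
      obtain ⟨a, hpa, ha⟩ := hj.exists_img_basicOpen_le (U := U) (p := p) (hp ▸ x.2)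
      refine ⟨hj.img (Spf.D a), ha, hp ▸ hj.fn_mem_img.mpr hpa, ?_⟩
      have : DiscreteTopology ((Spf R).topSheaf.obj (Spf.D a)) :=
        Spf.discreteTopology_sections (Spf.isCompact_basicOpen a)
      exact (IsEmbedding.mk (hj.isInducing_secEquiv (Spf.D a))
        (hj.secEquiv (Spf.D a)).injective).discreteTopology
    choose V hV hx hd using key
    obtain ⟨t, ht⟩ := hU.elim_finite_subcover (fun k => (V k : Set T.carrier))
      (fun k => (V k).isOpen) fun x hx' => Set.mem_iUnion.mpr ⟨⟨x, hx'⟩, hx _⟩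
    exact (T.topSheaf.discreteTopology_of_cover (fun k : t => V k.1) (fun k => hV _)
      (fun x hx => by
        obtain ⟨k, hk, hxk⟩ := Set.mem_iUnion₂.mp (ht hx)
        exact Opens.mem_iSup.mpr ⟨⟨k, hk⟩, hxk⟩) fun k => hd _).eq_bot

namespace IsOrdinaryScheme

/-- An isomorphism with a scheme is replaced by an equality of locally ringed spaces, so that
results on schemes apply to `T` without transport. -/
lemma exists_scheme (h : IsOrdinaryScheme T) :
    ∃ S : Scheme.{u}, S.toLocallyRingedSpace = T.toLocallyRingedSpace := by
  obtain ⟨⟨S, ⟨e⟩⟩, -⟩ := h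
  refine ⟨LocallyRingedSpace.IsOpenImmersion.scheme T.toLocallyRingedSpace fun x => ?_, rfl⟩
  obtain ⟨R, i, hi, hx, -⟩ := Scheme.exists_affine_mem_range_and_range_subset (X := S) (U := ⊤)
    (x := e.hom.base x) trivial
  refine ⟨R, i.toLRSHom ≫ e.inv, ?_, ?_⟩
  · obtain ⟨q, hq⟩ := hx
    refine ⟨q, ?_⟩
    have h1 : e.inv.base (e.hom.base x) = x := congr(($(e.hom_inv_id)).base x)
    exact (congrArg e.inv.base hq).trans h1
  · have h1 : LocallyRingedSpace.IsOpenImmersion i.toLRSHom := hi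
    have h2 : LocallyRingedSpace.IsOpenImmersion e.inv := inferInstance
    exact @PresheafedSpace.IsOpenImmersion.comp _ _ _ _ _ h1 _ _ h2

lemma discreteTopology (h : IsOrdinaryScheme T) {U : Opens T.carrier}
    (hU : IsCompact (U : Set T.carrier)) : DiscreteTopology (T.topSheaf.obj U) := ⟨h.2 U hU⟩

lemma exists_isCompact (h : IsOrdinaryScheme T) {U : Opens T.carrier} {x : T.carrier}
    (hx : x ∈ U) : ∃ V : Opens T.carrier, V ≤ U ∧ x ∈ V ∧ IsCompact (V : Set T.carrier) := by
  -- Splitting off the topological data leaves the locally ringed space as a variable for which the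
  -- scheme can be substituted.
  obtain ⟨T, _, _, _, _⟩ := T
  obtain ⟨S, rfl⟩ := h.exists_scheme
  obtain ⟨V, hV, hxV, hVU⟩ := Opens.isBasis_iff_nbhd.mp S.isBasis_affineOpens (show x ∈ U from hx)
  exact ⟨V, hVU, hxV, IsAffineOpen.isCompact hV⟩

lemma exists_pow_mul_eq_zero (h : IsOrdinaryScheme T) {U : Opens T.carrier}
    (hU : IsCompact (U : Set T.carrier)) (s c : T.topSheaf.obj U)
    (hc : T.topSheaf.res (nonvanishing_le s) c = 0) : ∃ k : ℕ, s ^ k * c = 0 := by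
  obtain ⟨T, _, _, _, _⟩ := T
  obtain ⟨S, rfl⟩ := h.exists_scheme
  exact exists_pow_mul_eq_zero_of_res_basicOpen_eq_zero_of_isCompact S (U := U) hU c s hc

end IsOrdinaryScheme

end LocallyTopRingedSpace

end

end FormalGeometry

/-! ### Immersions of ordinary schemes are strict embeddings. -/

namespace FormalGeometry

noncomputable section

set_option linter.unusedSectionVars false

open LocallyTopRingedSpace

namespace Spf

section Quotient

variable {A : Type u} [CommRing A] [TopologicalSpace A] [IsAdmissibleRing A] (I : Ideal A)

lemma range_mapBase_mk : Set.range (mapBase (Ideal.Quotient.mk I) (continuous_quotientMk I)) =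
    {p : SpfTop A | I ≤ p.1.asIdeal} := by
  ext p
  refine ⟨?_, fun hp => ?_⟩
  · rintro ⟨q, rfl⟩ c hc
    change Ideal.Quotient.mk I c ∈ q.1.asIdeal
    rw [Ideal.Quotient.eq_zero_iff_mem.mpr hc]
    exact q.1.asIdeal.zero_mem
  · have hx : p.1 ∈ Set.range (PrimeSpectrum.comap (Ideal.Quotient.mk I)) := by
      rw [_root_.range_comap_of_surjective _ _ Ideal.Quotient.mk_surjective, Ideal.mk_ker]
      exact hp
    obtain ⟨q, hq⟩ := hx
    refine ⟨⟨q, ?_⟩, Subtype.ext hq⟩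
    have h1 : IsOpen (Ideal.Quotient.mk I ⁻¹' (q.asIdeal : Set (A ⧸ I))) := by
      have h2 := p.2
      rw [← hq] at h2
      exact h2
    exact isOpen_coinduced.mpr h1

variable [IsAdmissibleRing (A ⧸ I)]

lemma isClosedEmbedding_mapBase_mk :
    IsClosedEmbedding (mapBase (Ideal.Quotient.mk I) (continuous_quotientMk I)) := by
  refine ⟨isEmbedding_mapBase _ _ fun x => ?_, ?_⟩
  · obtain ⟨c, rfl⟩ := Ideal.Quotient.mk_surjective x
    exact ⟨c, 1, isUnit_one, fun q => by simp⟩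
  · rw [range_mapBase_mk]
    have e : {p : SpfTop A | I ≤ p.1.asIdeal} = ⋂ c ∈ I, (basicOpen c : Set (SpfTop A))ᶜ := by
      ext p
      simp only [Set.mem_iInter]
      exact ⟨fun h c hc h' => h' (h hc), fun h c hc => not_not.mp (h c hc)⟩
    rw [e]
    exact isClosed_biInter fun c _ => (basicOpen c).isOpen.isClosed_compl

end Quotient

/-- Since `A` is separated, a nonzero element lies outside some open ideal and survives in that
component. -/
lemma injective_toSections_top {A : Type u} [CommRing A] [TopologicalSpace A]
    [IsAdmissibleRing A] : Function.Injective (toSections (⊤ : Opens (SpfTop A))) := by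
  refine (injective_iff_map_eq_zero _).mpr fun a ha => by_contra fun h => ?_
  obtain ⟨I, hI, hI'⟩ := IsCompleteLinear.exists_ideal_subset (R := A) {a}ᶜ
    (isOpen_compl_singleton.mem_nhds (Ne.symm h))
  have h1 : (toSections (⊤ : Opens (SpfTop A)) a).1 ⟨I, hI⟩ = 0 := by rw [ha]; rfl
  rw [toSections_top_apply] at h1
  exact hI' ((toΓ_eq_zero_iff ⟨I, hI⟩ a).mp h1) rfl

end Spf

lemma Spf.appLE_ofChart_of_eq {X : LocallyTopRingedSpace.{u}} {A B : Type u} [CommRing A]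
    [TopologicalSpace A] [IsAdmissibleRing A] [CommRing B] [TopologicalSpace B]
    [IsAdmissibleRing B] {j : Spf A ⟶ X} (hj : IsOpenImmersion j) (φ : A →+* B)
    (hφ : Continuous φ) {f : Spf B ⟶ X} (hf : f = Spf.map φ hφ ≫ j) {U : Opens (Spf A).carrier}
    {V : Opens (Spf B).carrier} (hV : V ≤ (Opens.map (Spf.map φ hφ).toLRSHom.base).obj U)
    (h : V ≤ (Opens.map f.toLRSHom.base).obj (hj.img U)) (c : A) :
    Hom.appLE f (hj.img U) V h (hj.ofChart U c) = Spf.toSections (A := B) V (φ c) := by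
  subst hf
  refine (Hom.comp_appLE (Spf.map φ hφ) j (hj.map_img U).ge hV _).trans ?_
  rw [← hj.secEquiv_apply, hj.secEquiv_ofChart]
  exact Spf.appLE_toSections _ _ _ c

namespace LocallyTopRingedSpace

variable {W X Y : LocallyTopRingedSpace.{u}}

/-- Surjectivity on stalks. -/
def SurjStalks (w : W ⟶ X) : Prop :=
  ∀ (V : Opens W.carrier) (s : W.topSheaf.obj V), ∀ x ∈ V, ∃ (U : Opens X.carrier)
    (t : X.topSheaf.obj U) (V' : Opens W.carrier) (h : V' ≤ (Opens.map w.toLRSHom.base).obj U)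
    (h' : V' ≤ V), x ∈ V' ∧ Hom.appLE w U V' h t = W.topSheaf.res h' s

/-- Embeddings onto locally closed subsets that are surjective on stalks. -/
structure IsStrictEmbedding (w : W ⟶ X) : Prop where
  isEmbedding : IsEmbedding (Hom.fn w)
  isLocallyClosed : IsLocallyClosed (Set.range (Hom.fn w))
  surjStalks : SurjStalks w

/-- Injectivity, the induced topology and closedness of the image are all local on the target, and
over a chart the map is that of `Spf (A ⧸ I)` into `Spf A`. -/
lemma IsClosedImmersion.isClosedEmbedding {i : W ⟶ X} (hi : IsClosedImmersion i) :
    IsClosedEmbedding (Hom.fn i) := by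
  have hinj : Function.Injective (Hom.fn i) := by
    intro x y hxy
    obtain ⟨A, _, _, _, I, hI, a, b, ha, hb, hx, hr, hc⟩ := hi (Hom.fn i x)
    have := IsAdmissibleRing.quotient I hI
    obtain ⟨p, rfl⟩ : x ∈ Set.range (Hom.fn b) := hr.ge hx
    obtain ⟨q, rfl⟩ : y ∈ Set.range (Hom.fn b) := hr.ge
      (show Hom.fn i y ∈ Set.range (Hom.fn a) from hxy ▸ hx)
    have e (p) : Hom.fn i (Hom.fn b p) =
        Hom.fn a (Spf.mapBase (Ideal.Quotient.mk I) (continuous_quotientMk I) p) :=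
      congrArg (fun f => Hom.fn f p) hc
    rw [e, e] at hxy
    rw [(Spf.isClosedEmbedding_mapBase_mk I).injective (ha.isOpenEmbedding.injective hxy)]
  refine ⟨⟨isInducing_iff_nhds.mpr fun x => le_antisymm
    (Hom.continuous_fn i).continuousAt.le_comap fun N hN => ?_, hinj⟩, ?_⟩
  · obtain ⟨A, _, _, _, I, hI, a, b, ha, hb, hx, hr, hc⟩ := hi (Hom.fn i x)
    have := IsAdmissibleRing.quotient I hI
    have e (p) : Hom.fn i (Hom.fn b p) =
        Hom.fn a (Spf.mapBase (Ideal.Quotient.mk I) (continuous_quotientMk I) p) :=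
      congrArg (fun f => Hom.fn f p) hc
    obtain ⟨p, rfl⟩ : x ∈ Set.range (Hom.fn b) := hr.ge hx
    have h1 : Hom.fn b ⁻¹' N ∈ 𝓝 p := (Hom.continuous_fn b).continuousAt hN
    have h2 := ha.isOpenEmbedding.isInducing.comp (Spf.isClosedEmbedding_mapBase_mk I).isInducing
    have h3 : Hom.fn b ⁻¹' N ∈ Filter.comap (Hom.fn a ∘ Spf.mapBase (Ideal.Quotient.mk I)
      (continuous_quotientMk I)) (𝓝 (Hom.fn i (Hom.fn b p))) := by
      rw [e]
      exact h2.nhds_eq_comap p ▸ h1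
    obtain ⟨M, hM, hMN⟩ := h3
    refine ⟨M ∩ Set.range (Hom.fn a), Filter.inter_mem hM
      (ha.isOpenEmbedding.isOpen_range.mem_nhds hx), ?_⟩
    rintro y ⟨hy, hy'⟩
    obtain ⟨q, rfl⟩ : y ∈ Set.range (Hom.fn b) := hr.ge hy'
    refine hMN ?_
    rw [e] at hy
    exact hy
  · rw [← isOpen_compl_iff, isOpen_iff_mem_nhds]
    intro u hu
    obtain ⟨A, _, _, _, I, hI, a, b, ha, hb, ⟨p, rfl⟩, hr, hc⟩ := hi u
    have := IsAdmissibleRing.quotient I hI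
    have e (p) : Hom.fn i (Hom.fn b p) =
        Hom.fn a (Spf.mapBase (Ideal.Quotient.mk I) (continuous_quotientMk I) p) :=
      congrArg (fun f => Hom.fn f p) hc
    have h1 := ha.isOpenEmbedding.isOpenMap _
      (Spf.isClosedEmbedding_mapBase_mk I).isClosed_range.isOpen_compl
    refine Filter.mem_of_superset (h1.mem_nhds ⟨p, ?_, rfl⟩) ?_
    · rintro ⟨q, rfl⟩
      exact hu ⟨Hom.fn b q, e q⟩
    · rintro _ ⟨p', hp', rfl⟩ ⟨y, hy⟩
      obtain ⟨q, rfl⟩ : y ∈ Set.range (Hom.fn b) := hr.ge ⟨p', hy.symm⟩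
      rw [e] at hy
      exact hp' ⟨q, ha.isOpenEmbedding.injective hy⟩

/-- The ring `R` maps continuously and injectively into the discrete ring of sections over the image
of the chart. -/
lemma IsOrdinaryScheme.discreteTopology_of_chart (hW : IsOrdinaryScheme W) {R : Type u}
    [CommRing R] [TopologicalSpace R] [IsAdmissibleRing R] {b : Spf R ⟶ W}
    (hb : IsOpenImmersion b) : DiscreteTopology R := by
  have := hW.discreteTopology (hb.isCompact_img (U := ⊤) (Spf.isCompact_top (A := R)))
  refine discreteTopology_of_isOpen_singleton_zero ?_
  have h := (isOpen_discrete {(0 : W.topSheaf.obj (hb.img ⊤))}).preimage (hb.continuous_ofChart ⊤)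
  convert h
  ext r
  rw [Set.mem_singleton_iff, Set.mem_preimage, Set.mem_singleton_iff, map_eq_zero_iff]
  exact (hb.secEquiv ⊤).symm.injective.comp (Spf.injective_toSections_top (A := R))

lemma IsClosedImmersion.surjStalks {i : W ⟶ Y} (hi : IsClosedImmersion i) {j : Y ⟶ X}
    (hj : IsOpenImmersion j) (hW : IsOrdinaryScheme W) : SurjStalks (i ≫ j) := by
  intro V s x hxV
  obtain ⟨A, _, _, _, I, hI, a, b, ha, hb, hx, hr, hc⟩ := hi (Hom.fn i x)
  have := IsAdmissibleRing.quotient I hI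
  have := hW.discreteTopology_of_chart hb
  have hJ := ha.comp hj
  obtain ⟨p, rfl⟩ : x ∈ Set.range (Hom.fn b) := hr.ge hx
  obtain ⟨d, hpd, hd⟩ := hb.exists_img_basicOpen_le hxV
  obtain ⟨d, rfl⟩ := Ideal.Quotient.mk_surjective d
  have : DiscreteTopology (W.topSheaf.obj (hb.img (Spf.D (Ideal.Quotient.mk I d)))) :=
    hW.discreteTopology (hb.isCompact_img_basicOpen _)
  have h1 := hb.mem_closure_fractions _ (W.topSheaf.res hd s)
  -- In a discrete ring a limit of fractions is a fraction. Its numerator and denominator lift to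
  -- `A`, and the lifted denominator `d` is invertible on its own basic open subset of the target.
  rw [closure_discrete] at h1
  obtain ⟨c, m, h1⟩ := h1
  obtain ⟨c, rfl⟩ := Ideal.Quotient.mk_surjective c
  obtain ⟨u, hu⟩ := ((hJ.isUnit_ofChart d).pow m).exists_right_inv
  have hle : hb.img (Spf.D (Ideal.Quotient.mk I d)) ≤
      (Opens.map (i ≫ j).toLRSHom.base).obj (hJ.img (Spf.D d)) := by
    rintro _ ⟨q, hq, rfl⟩
    exact ⟨Spf.mapBase (Ideal.Quotient.mk I) (continuous_quotientMk I) q, hq,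
      (congrArg (fun f => Hom.fn (f ≫ j) q) hc).symm⟩
  refine ⟨hJ.img (Spf.D d), u * hJ.ofChart (Spf.D d) c,
    hb.img (Spf.D (Ideal.Quotient.mk I d)), hle, hd, hb.fn_mem_img.mpr hpd, ?_⟩
  have key (c : A) : Hom.appLE (i ≫ j) _ _ hle (hJ.ofChart (Spf.D d) c) =
      hb.ofChart (Spf.D (Ideal.Quotient.mk I d)) (Ideal.Quotient.mk I c) := by
    apply (hb.secEquiv _).injective
    rw [hb.secEquiv_ofChart, hb.secEquiv_apply, ← Hom.comp_appLE]
    have e : b ≫ i ≫ j = Spf.map (Ideal.Quotient.mk I) (continuous_quotientMk I) ≫ a ≫ j := by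
      rw [← Category.assoc, hc, Category.assoc]
    exact Spf.appLE_ofChart_of_eq hJ _ _ e (fun q hq => hq) _ c
  rw [map_mul, key]
  have h3 := congrArg (Hom.appLE (i ≫ j) _ _ hle) hu
  rw [map_mul, map_pow, key, map_one] at h3
  rw [← h1, ← mul_assoc, mul_comm _ (_ ^ m), h3, one_mul]

/-- Immersions of ordinary schemes are strict embeddings. -/
lemma IsImmersion.isStrictEmbedding {w : W ⟶ X} (h : IsImmersion w) (hW : IsOrdinaryScheme W) :
    IsStrictEmbedding w := by
  obtain ⟨U, i, j, hi, hj, rfl⟩ := h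
  refine ⟨hj.isOpenEmbedding.isEmbedding.comp hi.isClosedEmbedding.isEmbedding, ?_,
    hi.surjStalks hj hW⟩
  have e : Set.range (Hom.fn (i ≫ j)) = Hom.fn j '' Set.range (Hom.fn i) :=
    Set.range_comp (Hom.fn j) (Hom.fn i)
  rw [e]
  exact hi.isClosedEmbedding.isClosed_range.isLocallyClosed.image
    hj.isOpenEmbedding.isInducing hj.isOpenEmbedding.isOpen_range.isLocallyClosed

end LocallyTopRingedSpace

end

end FormalGeometry

/-! ### Strict embeddings that are closed over an affine chart. -/

namespace FormalGeometry

noncomputable section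

set_option linter.unusedSectionVars false

open LocallyTopRingedSpace

/-- Continuous homomorphisms from the sections over a basic open subset are determined on the ring
of the chart. -/
lemma LocallyTopRingedSpace.IsOpenImmersion.ringHom_ext {X : LocallyTopRingedSpace.{u}} {A : Type u}
    [CommRing A] [TopologicalSpace A] [IsAdmissibleRing A] {j : Spf A ⟶ X}
    (hj : IsOpenImmersion j) (a : A) {S : Type*} [CommRing S] [TopologicalSpace S]
    [IsTopologicalRing S] [T2Space S] {ρ σ : X.topSheaf.obj (hj.img (Spf.D a)) →+* S}
    (hρ : Continuous ρ) (hσ : Continuous σ)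
    (h : ∀ c, ρ (hj.ofChart (Spf.D a) c) = σ (hj.ofChart (Spf.D a) c)) : ρ = σ := by
  refine RingHom.ext fun y => ?_
  refine closure_minimal (t := {y | ρ y = σ y}) ?_ (isClosed_eq hρ hσ)
    (hj.mem_closure_fractions a y)
  rintro w ⟨c, m, hw⟩
  have h1 := congrArg ρ hw
  have h2 := congrArg σ hw
  rw [map_mul, map_pow, h, h] at h1
  rw [map_mul, map_pow] at h2
  exact ((((hj.isUnit_ofChart a).map σ).pow m).mul_right_inj).mp (h1.trans h2.symm)

/-- Morphisms to a space that factor through an affine chart on the points are determined by the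
images of the elements of the ring of the chart. -/
lemma LocallyTopRingedSpace.IsOpenImmersion.hom_ext {T X : LocallyTopRingedSpace.{u}} {A : Type u}
    [CommRing A] [TopologicalSpace A] [IsAdmissibleRing A] {j : Spf A ⟶ X}
    (hj : IsOpenImmersion j) {f g : T ⟶ X} (hT : ∀ U, T2Space (T.topSheaf.obj U))
    (hfg : ∀ x, Hom.fn f x = Hom.fn g x) (hf : Set.range (Hom.fn f) ⊆ Set.range (Hom.fn j))
    (h : ∀ (a : A) (V : Opens T.carrier) (hf : V ≤ (Opens.map f.toLRSHom.base).obj (hj.img (Spf.D a)))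
      (hg : V ≤ (Opens.map g.toLRSHom.base).obj (hj.img (Spf.D a))) (c : A),
      Hom.appLE f _ V hf (hj.ofChart (Spf.D a) c) = Hom.appLE g _ V hg (hj.ofChart (Spf.D a) c)) :
    f = g := by
  refine Hom.ext' hfg fun U x hx s => ?_
  obtain ⟨p, hp⟩ := hf ⟨x, rfl⟩
  obtain ⟨a, hpa, ha⟩ := hj.exists_img_basicOpen_le (U := U) (p := p) (hp ▸ hx)
  have hf' : (Opens.map f.toLRSHom.base).obj (hj.img (Spf.D a)) ≤
    (Opens.map f.toLRSHom.base).obj U := fun _ hy => ha hy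
  have hg' : (Opens.map f.toLRSHom.base).obj (hj.img (Spf.D a)) ≤
    (Opens.map g.toLRSHom.base).obj (hj.img (Spf.D a)) := fun y hy => by
      change Hom.fn g y ∈ hj.img (Spf.D a)
      rw [← hfg]
      exact hy
  refine ⟨_, hf', fun _ hy => ha (hg' hy), ?_, ?_⟩
  · change Hom.fn f x ∈ hj.img (Spf.D a)
    rw [← hp]
    exact hj.fn_mem_img.mpr hpa
  · have := hT ((Opens.map f.toLRSHom.base).obj (hj.img (Spf.D a)))
    have e := hj.ringHom_ext a (Hom.continuous_appLE f _ _ le_rfl) (Hom.continuous_appLE g _ _ hg')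
      (h a _ le_rfl hg')
    have e2 := congr($e (X.topSheaf.res ha s))
    rw [Hom.appLE_res, Hom.appLE_res] at e2
    exact e2

lemma TopSheaf.OpenIso.hom_appLE {T X : LocallyTopRingedSpace.{u}}
    (e : TopSheaf.OpenIso T.topSheaf X.topSheaf) {U : Opens X.carrier} {V : Opens T.carrier}
    (h : V ≤ (Opens.map (homOfOpenIso e).toLRSHom.base).obj U)
    (h' : e.isOpenEmbedding.functor.obj V ≤ U) (s : X.topSheaf.obj U) :
    e.hom V (Hom.appLE (homOfOpenIso e) U V h s) = X.topSheaf.res h' s := by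
  have h1 := e.hom_res h (e.app U s)
  refine h1.trans ?_
  refine (congrArg _ (e.hom_app U s)).trans ?_
  exact X.topSheaf.res_res _ _ s

/-- There is only one section over the empty set. -/
lemma TopSheaf.eq_of_eq_bot {X : TopCat.{u}} (F : TopSheaf X) {U : Opens X} (hU : U = ⊥)
    (s t : F.obj U) : s = t :=
  F.eq_of_res_eq (ι := PEmpty.{1}) PEmpty.elim (fun k => k.elim) (by rw [hU]; exact bot_le)
    fun k => k.elim

lemma discreteTopology_quotient {A : Type u} [CommRing A] [TopologicalSpace A]
    [IsTopologicalRing A] {I : Ideal A} (hI : IsOpen (I : Set A)) : DiscreteTopology (A ⧸ I) := by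
  refine discreteTopology_of_isOpen_singleton_zero (isOpen_coinduced.mpr ?_)
  convert hI
  ext a
  exact Ideal.Quotient.eq_zero_iff_mem

lemma Spf.surjective_toSections_top {R : Type u} [CommRing R] [TopologicalSpace R]
    [IsAdmissibleRing R] [DiscreteTopology R] :
    Function.Surjective (toSections (⊤ : Opens (SpfTop R))) := by
  intro s
  obtain ⟨d, hd⟩ := toSections_top_apply_surjective (botIdeal R) (s.1 (botIdeal R))
  exact ⟨d, (bijective_eval_botIdeal ⊤).1 hd⟩

namespace AffineStrictEmbedding

variable {W X : LocallyTopRingedSpace.{u}} {w : W ⟶ X} (hW : IsOrdinaryScheme W)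
  (hw : IsEmbedding (Hom.fn w)) (hs : SurjStalks w) {A : Type u} [CommRing A]
  [TopologicalSpace A] [IsAdmissibleRing A] {a : Spf A ⟶ X} (ha : IsOpenImmersion a)
  (hcl : closure (Set.range (Hom.fn w)) ∩ Set.range (Hom.fn a) ⊆ Set.range (Hom.fn w))

/-- The preimage of the chart. -/
abbrev pre (w : W ⟶ X) {A : Type u} [CommRing A] [TopologicalSpace A] [IsAdmissibleRing A]
    {a : Spf A ⟶ X} (ha : IsOpenImmersion a) : Opens W.carrier :=
  (Opens.map w.toLRSHom.base).obj (ha.img ⊤)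

/-- The homomorphism from the ring of the chart to the sections over its preimage. -/
def toPre (w : W ⟶ X) {A : Type u} [CommRing A] [TopologicalSpace A] [IsAdmissibleRing A]
    {a : Spf A ⟶ X} (ha : IsOpenImmersion a) : A →+* W.topSheaf.obj (pre w ha) :=
  (Hom.appLE w _ _ le_rfl).comp (ha.ofChart ⊤)

lemma continuous_toPre : Continuous (toPre w ha) :=
  (Hom.continuous_appLE _ _ _ _).comp (ha.continuous_ofChart ⊤)

lemma mem_nonvanishing_toPre {x : W.carrier} {p : SpfTop A} (hp : Hom.fn a p = Hom.fn w x) (c : A) :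
    x ∈ nonvanishing (toPre w ha c) ↔ p ∈ Spf.basicOpen c := by
  have hx : x ∈ pre w ha := by
    change Hom.fn w x ∈ ha.img ⊤
    rw [← hp]
    exact ha.fn_mem_img.mpr trivial
  refine (Hom.mem_nonvanishing_appLE w le_rfl _ hx).trans ?_
  rw [← hp]
  exact ha.mem_nonvanishing_ofChart c trivial

include hw hcl in
-- Inside the chart the image is closed, so the preimage is homeomorphic to a closed subset of `U`.
lemma isCompact_map {U : Opens X.carrier} (hU : IsCompact (U : Set X.carrier))
    (hU' : (U : Set X.carrier) ⊆ Set.range (Hom.fn a)) :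
    IsCompact ((Opens.map w.toLRSHom.base).obj U : Set W.carrier) := by
  rw [hw.isInducing.isCompact_iff]
  have e : Hom.fn w '' ((Opens.map w.toLRSHom.base).obj U : Set W.carrier) =
      (U : Set X.carrier) ∩ closure (Set.range (Hom.fn w)) := by
    refine (Set.image_preimage_eq_inter_range (f := Hom.fn w)).trans (subset_antisymm
      (Set.inter_subset_inter_right _ subset_closure) fun x hx => ⟨hx.1, hcl ⟨hx.2, hU' hx.1⟩⟩)
  rw [e]
  exact hU.inter_right isClosed_closure

include hw hcl in
lemma isCompact_pre : IsCompact (pre w ha : Set W.carrier) :=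
  isCompact_map hw hcl (ha.isCompact_img (U := ⊤) (Spf.isCompact_top (A := A)))
    (ha.img_subset_range _)

/-- The ideal of the preimage. -/
def ideal (w : W ⟶ X) {A : Type u} [CommRing A] [TopologicalSpace A] [IsAdmissibleRing A]
    {a : Spf A ⟶ X} (ha : IsOpenImmersion a) : Ideal A := RingHom.ker (toPre w ha)

include hW hw hcl in
-- The preimage of the chart is quasi-compact, so its ring of sections is discrete and the kernel of
-- a continuous map into it is open.
lemma isOpen_ideal : IsOpen (ideal w ha : Set A) := by
  have := hW.discreteTopology (isCompact_pre hw ha hcl)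
  exact (isOpen_discrete {0}).preimage (continuous_toPre ha)

include hW hw hcl in
lemma isClosed_ideal : IsClosed (ideal w ha : Set A) :=
  AddSubgroup.isClosed_of_isOpen (ideal w ha).toAddSubgroup (isOpen_ideal hW hw ha hcl)

/-- The map from the formal spectrum of the quotient. -/
def quotMap (w : W ⟶ X) {A : Type u} [CommRing A] [TopologicalSpace A] [IsAdmissibleRing A]
    {a : Spf A ⟶ X} (ha : IsOpenImmersion a) (q : SpfTop (A ⧸ ideal w ha)) : X.carrier :=
  Hom.fn a (Spf.mapBase (Ideal.Quotient.mk (ideal w ha)) (continuous_quotientMk _) q)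

lemma mem_range_quotMap {x : X.carrier} :
    x ∈ Set.range (quotMap w ha) ↔ ∃ p : SpfTop A, ideal w ha ≤ p.1.asIdeal ∧ Hom.fn a p = x := by
  have h := Spf.range_mapBase_mk (ideal w ha)
  refine ⟨?_, ?_⟩
  · rintro ⟨q, rfl⟩
    exact ⟨_, h.le ⟨q, rfl⟩, rfl⟩
  · rintro ⟨p, hp, rfl⟩
    obtain ⟨q, rfl⟩ := h.ge hp
    exact ⟨q, rfl⟩

include hW hw hcl in
-- If an open prime contains the kernel but its point is off the image, then some `c` outside the
-- prime has its basic open subset disjoint from the image. The pullback of `c` is nowhere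
-- invertible, hence nilpotent, and a power of `c` lies in the prime.
lemma range_quotMap : Set.range (quotMap w ha) = Set.range (Hom.fn w) ∩ Set.range (Hom.fn a) := by
  ext x
  rw [mem_range_quotMap]
  refine ⟨?_, ?_⟩
  · rintro ⟨p, hp, rfl⟩
    refine ⟨by_contra fun hx => ?_, p, rfl⟩
    have hx' : Hom.fn a p ∈ (⟨_, isClosed_closure.isOpen_compl⟩ : Opens X.carrier) :=
      fun h => hx (hcl ⟨h, p, rfl⟩)
    obtain ⟨c, hpc, hc⟩ := ha.exists_img_basicOpen_le hx'
    have h1 : nonvanishing (toPre w ha c) = ⊥ := by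
      refine le_bot_iff.mp fun y hy => ?_
      obtain ⟨p', -, hp'⟩ := nonvanishing_le _ hy
      have h2 := (mem_nonvanishing_toPre ha hp' c).mp hy
      have h3 := hc (ha.fn_mem_img.mpr h2)
      exact h3 (subset_closure ⟨y, hp'.symm⟩)
    -- Over the empty set `1 = 0`, so the statement about powers applied to the section `1` gives
    -- nilpotence.
    obtain ⟨k, hk⟩ := hW.exists_pow_mul_eq_zero (isCompact_pre hw ha hcl) (toPre w ha c) 1
      (W.topSheaf.eq_of_eq_bot h1 _ _)
    rw [mul_one, ← map_pow] at hk
    exact hpc (p.1.isPrime.mem_of_pow_mem k (hp hk))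
  · rintro ⟨⟨y, rfl⟩, p, hp⟩
    refine ⟨p, fun c hc => by_contra fun h => ?_, hp⟩
    have h1 := (mem_nonvanishing_toPre ha hp c).mpr h
    rw [show toPre w ha c = 0 from hc, nonvanishing_zero] at h1
    exact h1

include hW hw hcl in
lemma exists_lift : ∃ β : SpfTop (A ⧸ ideal w ha) ⟶ W.carrier, IsOpenEmbedding β ∧
    (∀ q, Hom.fn w (β q) = quotMap w ha q) ∧ Set.range β = pre w ha := by
  have := IsAdmissibleRing.quotient (ideal w ha) (isClosed_ideal hW hw ha hcl)
  have hγ : IsEmbedding (quotMap w ha) :=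
    ha.isOpenEmbedding.isEmbedding.comp (Spf.isClosedEmbedding_mapBase_mk _).isEmbedding
  have hr := range_quotMap hW hw ha hcl
  choose b hb using fun q => (hr.le ⟨q, rfl⟩ : quotMap w ha q ∈ _).1
  have hb' : Hom.fn w ∘ b = quotMap w ha := funext hb
  have hbc : Continuous b := by
    rw [hw.isInducing.continuous_iff, hb']
    exact hγ.continuous
  have hbr : Set.range b = pre w ha := by
    ext x
    refine ⟨?_, fun hx => ?_⟩
    · rintro ⟨q, rfl⟩
      change Hom.fn w (b q) ∈ ha.img ⊤
      rw [hb]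
      exact ha.fn_mem_img.mpr trivial
    · obtain ⟨q, hq⟩ := hr.ge ⟨⟨x, rfl⟩, ha.img_subset_range _ hx⟩
      exact ⟨q, hw.injective ((hb q).trans hq)⟩
  refine ⟨TopCat.ofHom ⟨b, hbc⟩, ⟨IsEmbedding.of_comp hbc hw.continuous (hb' ▸ hγ), ?_⟩, hb, hbr⟩
  exact hbr ▸ (pre w ha).isOpen

section Chart

variable {β : SpfTop (A ⧸ ideal w ha) ⟶ W.carrier} (hβ : IsOpenEmbedding β)
  (hβw : ∀ q, Hom.fn w (β q) = quotMap w ha q) (hβr : Set.range β = pre w ha)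

include hβr in
lemma functor_le_pre (U : Opens (SpfTop (A ⧸ ideal w ha))) : hβ.functor.obj U ≤ pre w ha := by
  rintro _ ⟨q, -, rfl⟩
  exact hβr.le ⟨q, rfl⟩

include hβr hβw in
lemma functor_basicOpen (c : A) : hβ.functor.obj (Spf.basicOpen (Ideal.Quotient.mk _ c)) =
    nonvanishing (toPre w ha c) := by
  ext x
  refine ⟨?_, fun hx => ?_⟩
  · rintro ⟨q, hq, rfl⟩
    exact (mem_nonvanishing_toPre ha (hβw q).symm c).mpr hq
  · obtain ⟨q, rfl⟩ := hβr.ge (nonvanishing_le _ hx)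
    exact ⟨q, (mem_nonvanishing_toPre ha (hβw q).symm c).mp hx, rfl⟩

/-- The sections given by elements of the quotient. -/
def quotHom (hβr : Set.range β = pre w ha) :
    A ⧸ ideal w ha →+* (W.topSheaf.restrict hβ).obj ⊤ :=
  (W.topSheaf.res (functor_le_pre ha hβ hβr ⊤)).comp (RingHom.kerLift (toPre w ha))

lemma res_quotHom (U : Opens (SpfTop (A ⧸ ideal w ha))) (c : A) :
    (W.topSheaf.restrict hβ).res (le_top : U ≤ ⊤) (quotHom ha hβ hβr (Ideal.Quotient.mk _ c)) =
      W.topSheaf.res (functor_le_pre ha hβ hβr U) (toPre w ha c) :=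
  W.topSheaf.res_res (functor_le_pre ha hβ hβr ⊤) (hβ.functor.map (homOfLE le_top)).le _

include hW hw hcl hβw in
-- All rings involved are discrete, so the neighbourhood can be `{0}`, and `exists_nhds` becomes the
-- statement that a section vanishing where `c` is invertible is killed by a power of `c`.
lemma isChart_quotHom [IsAdmissibleRing (A ⧸ ideal w ha)] :
    Spf.IsChart (W.topSheaf.restrict hβ) (quotHom ha hβ hβr) where
  continuous := by
    have := discreteTopology_quotient (isOpen_ideal hW hw ha hcl)
    exact continuous_of_discreteTopology
  isUnit b := by
    obtain ⟨c, rfl⟩ := Ideal.Quotient.mk_surjective b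
    rw [res_quotHom]
    have h := (isUnit_res_nonvanishing (toPre w ha c)).map
      (W.topSheaf.res (functor_basicOpen ha hβ hβw hβr c).le)
    rw [TopSheaf.res_res] at h
    exact h
  complete b := by
    have : DiscreteTopology ((W.topSheaf.restrict hβ).obj (Spf.basicOpen b)) :=
      hW.discreteTopology (U := hβ.functor.obj (Spf.basicOpen b))
        ((Spf.isCompact_basicOpen b).image β.hom.continuous)
    exact IsCompleteLinear.of_discrete
  exists_nhds b J := by
    have : DiscreteTopology ((W.topSheaf.restrict hβ).obj (Spf.basicOpen b)) :=
      hW.discreteTopology (U := hβ.functor.obj (Spf.basicOpen b))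
        ((Spf.isCompact_basicOpen b).image β.hom.continuous)
    refine ⟨{0}, (isOpen_discrete _).mem_nhds rfl, fun d hd => ?_⟩
    obtain ⟨c, rfl⟩ := Ideal.Quotient.mk_surjective b
    obtain ⟨d, rfl⟩ := Ideal.Quotient.mk_surjective d
    rw [Set.mem_singleton_iff, res_quotHom] at hd
    have h1 := congrArg (W.topSheaf.res (functor_basicOpen ha hβ hβw hβr c).ge) hd
    replace h1 := ((W.topSheaf.res_res _ (functor_basicOpen ha hβ hβw hβr c).ge _).symm.trans
      h1).trans (map_zero _)
    obtain ⟨k, hk⟩ := hW.exists_pow_mul_eq_zero (isCompact_pre hw ha hcl) (toPre w ha c)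
      (toPre w ha d) h1
    refine ⟨k, ?_⟩
    rw [← map_pow, ← map_mul] at hk ⊢
    rw [Ideal.Quotient.eq_zero_iff_mem.mpr (show _ ∈ ideal w ha from hk)]
    exact J.1.zero_mem

include hw hs hβw in
-- Surjectivity on stalks represents `y` locally by a section of `X`, which is a limit of fractions
-- over a small basic open subset; pulling back preserves fractions and limits.
lemma exists_mem_closure_fractions (U : Opens (SpfTop (A ⧸ ideal w ha)))
    (y : (W.topSheaf.restrict hβ).obj U) (q : SpfTop (A ⧸ ideal w ha)) (hq : q ∈ U) :
    ∃ (b : A ⧸ ideal w ha) (hb : Spf.basicOpen b ≤ U), q ∈ Spf.basicOpen b ∧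
      (W.topSheaf.restrict hβ).res hb y ∈
        closure (Spf.IsChart.fractions (W.topSheaf.restrict hβ) (quotHom ha hβ hβr) b) := by
  obtain ⟨N, t, V, hVN, hVU, hqV, ht⟩ := hs (hβ.functor.obj U) y (β q) ⟨q, hq, rfl⟩
  obtain ⟨N', hN', hVN'⟩ := hw.isInducing.isOpen_iff.mp V.isOpen
  obtain ⟨c, hqc, hc⟩ := ha.exists_img_basicOpen_le (U := N ⊓ ⟨N', hN'⟩)
    (p := Spf.mapBase (Ideal.Quotient.mk (ideal w ha)) (continuous_quotientMk _) q) (by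
      refine ⟨?_, ?_⟩
      · have := hVN hqV
        change Hom.fn w (β q) ∈ N at this
        rwa [hβw] at this
      · have := hVN'.ge hqV
        change Hom.fn w (β q) ∈ N' at this
        rwa [hβw] at this)
  have hcV : hβ.functor.obj (Spf.basicOpen (Ideal.Quotient.mk (ideal w ha) c)) ≤ V := by
    rintro _ ⟨r, hr, rfl⟩
    refine hVN'.le ?_
    change Hom.fn w (β r) ∈ N'
    rw [hβw]
    exact (hc (ha.fn_mem_img.mpr hr)).2
  have hcU : Spf.basicOpen (Ideal.Quotient.mk (ideal w ha) c) ≤ U := by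
    intro r hr
    obtain ⟨r', hr', e⟩ := hVU (hcV ⟨r, hr, rfl⟩)
    exact hβ.injective e ▸ hr'
  refine ⟨Ideal.Quotient.mk _ c, hcU, hqc, ?_⟩
  have hle : hβ.functor.obj (Spf.basicOpen (Ideal.Quotient.mk (ideal w ha) c)) ≤
      (Opens.map w.toLRSHom.base).obj (ha.img (Spf.D c)) := by
    rintro _ ⟨r, hr, rfl⟩
    change Hom.fn w (β r) ∈ ha.img (Spf.D c)
    rw [hβw]
    exact ha.fn_mem_img.mpr hr
  have key (d : A) : Hom.appLE w _ _ hle (ha.ofChart (Spf.D c) d) =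
      (W.topSheaf.restrict hβ).res (le_top : Spf.basicOpen (Ideal.Quotient.mk _ c) ≤ ⊤)
        (quotHom ha hβ hβr (Ideal.Quotient.mk _ d)) := by
    rw [res_quotHom, ← ha.res_ofChart (le_top : Spf.D c ≤ ⊤), Hom.appLE_res]
    exact (Hom.res_appLE w (functor_le_pre ha hβ hβr _) le_rfl _).symm
  have h1 := map_mem_closure (Hom.continuous_appLE w _ _ hle)
    (ha.mem_closure_fractions c (X.topSheaf.res (hc.trans inf_le_left) t))
    (t := Spf.IsChart.fractions (W.topSheaf.restrict hβ) (quotHom ha hβ hβr)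
      (Ideal.Quotient.mk _ c)) (by
      rintro v ⟨d, m, hv⟩
      refine ⟨d, m, ?_⟩
      rw [← key, ← key, ← hv, map_mul, map_pow]
      rfl)
  rw [Hom.appLE_res] at h1
  refine (congrArg (· ∈ closure _) ?_).mp h1
  have h2 := congrArg (W.topSheaf.res hcV) ht
  rw [Hom.res_appLE] at h2
  exact h2.trans (W.topSheaf.res_res hVU hcV y)

end Chart

include hW hw hs hcl in
/-- The preimage of an affine chart under a strict embedding that is closed over the chart. -/
theorem exists_chart (hcl' : IsClosed (ideal w ha : Set A)) :
    haveI := IsAdmissibleRing.quotient (ideal w ha) hcl'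
    ∃ b : Spf (A ⧸ ideal w ha) ⟶ W, IsOpenImmersion b ∧
      Set.range (Hom.fn b) = Hom.fn w ⁻¹' Set.range (Hom.fn a) ∧
      b ≫ w = Spf.map (Ideal.Quotient.mk _) (continuous_quotientMk _) ≫ a ∧
      Function.Surjective (toPre w ha) := by
  have := IsAdmissibleRing.quotient (ideal w ha) hcl'
  have := discreteTopology_quotient (isOpen_ideal hW hw ha hcl)
  obtain ⟨β, hβ, hβw, hβr⟩ := exists_lift hW hw ha hcl
  have hch := isChart_quotHom hW hw ha hcl hβ hβw hβr
  let e : TopSheaf.OpenIso (Spf (A ⧸ ideal w ha)).topSheaf W.topSheaf :=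
    hch.openIso (exists_mem_closure_fractions hw hs ha hβ hβw hβr)
  have he (c : A) (V : Opens (SpfTop (A ⧸ ideal w ha))) : e.hom V (Spf.toSections V
      (Ideal.Quotient.mk _ c)) = W.topSheaf.res (functor_le_pre ha hβ hβr V) (toPre w ha c) :=
    (hch.ThetaHom_toSections V _).trans (res_quotHom ha hβ hβr V c)
  refine ⟨homOfOpenIso e, isOpenImmersion_homOfOpenIso e, ?_, ?_, ?_⟩
  · refine hβr.trans ?_
    rw [← ha.coe_img_top]
    rfl
  · refine ha.hom_ext (fun U => Spf.t2Space_sections (A := A ⧸ ideal w ha) U) hβw ?_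
      fun c V hf hg d => ?_
    · rintro _ ⟨q, rfl⟩
      exact ⟨_, (hβw q).symm⟩
    · have h1 : Hom.appLE (homOfOpenIso e ≫ w) _ V hf (ha.ofChart (Spf.D c) d) =
          Spf.toSections (A := A ⧸ ideal w ha) V (Ideal.Quotient.mk _ d) := by
        apply (e.bijective V).1
        rw [← ha.res_ofChart (le_top : Spf.D c ≤ ⊤), Hom.appLE_res]
        have hV : V ≤ (Opens.map (homOfOpenIso e).toLRSHom.base).obj (pre w ha) :=
          fun q _ => hβr.le ⟨q, rfl⟩
        rw [Hom.comp_appLE (homOfOpenIso e) w (V := pre w ha) le_rfl hV]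
        exact (e.hom_appLE hV (functor_le_pre ha hβ hβr V) (toPre w ha d)).trans (he d V).symm
      rw [h1]
      have hV : V ≤ (Opens.map (Spf.map (Ideal.Quotient.mk (ideal w ha))
          (continuous_quotientMk _)).toLRSHom.base).obj (Spf.D c) :=
        fun q hq => (ha.fn_mem_img (U := Spf.D c)).mp (hg hq)
      exact (Spf.appLE_ofChart_of_eq ha _ _ rfl hV _ d).symm
  · intro y
    have hle : pre w ha ≤ hβ.functor.obj ⊤ := by
      intro x hx
      obtain ⟨q, rfl⟩ := hβr.ge hx
      exact ⟨q, trivial, rfl⟩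
    obtain ⟨s, hs⟩ := (e.bijective ⊤).2 (W.topSheaf.res (functor_le_pre ha hβ hβr ⊤) y)
    -- The quotient ring is discrete, so its elements exhaust the global sections of its formal
    -- spectrum. This yields the surjectivity of `toPre`, from which density is derived later.
    obtain ⟨c, rfl⟩ := Spf.surjective_toSections_top s
    obtain ⟨c, rfl⟩ := Ideal.Quotient.mk_surjective c
    have h1 := congrArg (W.topSheaf.res hle) ((he c ⊤).symm.trans hs)
    rw [TopSheaf.res_res, TopSheaf.res_res, TopSheaf.res_refl, TopSheaf.res_refl] at h1
    exact ⟨c, h1⟩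

end AffineStrictEmbedding

end

end FormalGeometry

/-! ### Open subspaces, and strict embeddings as immersions. -/

namespace FormalGeometry

noncomputable section

set_option linter.unusedSectionVars false

namespace LocallyTopRingedSpace

/-- The open subspace with underlying set `U`. -/
def restrict (X : LocallyTopRingedSpace.{u}) (U : Opens X.carrier) : LocallyTopRingedSpace.{u} where
  toLocallyRingedSpace := X.toLocallyRingedSpace.restrict U.isOpenEmbedding
  sectionTop := (X.topSheaf.restrict U.isOpenEmbedding).sectionTop
  isTopologicalRing := (X.topSheaf.restrict U.isOpenEmbedding).isTopologicalRing
  continuous_map := (X.topSheaf.restrict U.isOpenEmbedding).continuous_map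
  iInf_induced_le := (X.topSheaf.restrict U.isOpenEmbedding).iInf_induced_le

variable {T X : LocallyTopRingedSpace.{u}} (U : Opens X.carrier)

/-- The identification of the open subspace with its image. -/
def restrictOpenIso : TopSheaf.OpenIso (X.restrict U).topSheaf X.topSheaf where
  base := U.inclusion'
  isOpenEmbedding := U.isOpenEmbedding
  hom _ := RingHom.id _
  hom_res _ _ := rfl
  bijective _ := Function.bijective_id
  isInducing _ := IsInducing.id

/-- The inclusion of an open subspace. -/
def restrictι : X.restrict U ⟶ X := homOfOpenIso (restrictOpenIso U)

lemma isOpenImmersion_restrictι : IsOpenImmersion (restrictι U) := isOpenImmersion_homOfOpenIso _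

/-- The image of an open subset of an open subspace. -/
def restrictImg (V : Opens (X.restrict U).carrier) : Opens X.carrier :=
  U.isOpenEmbedding.functor.obj V

lemma restrictι_appLE (V : Opens (X.restrict U).carrier)
    (h : V ≤ (Opens.map (restrictι U).toLRSHom.base).obj (restrictImg U V))
    (s : X.topSheaf.obj (restrictImg U V)) :
    Hom.appLE (restrictι U) (restrictImg U V) V h s = s :=
  ((restrictOpenIso U).hom_appLE h le_rfl s).trans (X.topSheaf.res_refl s)

variable {U} (g : T ⟶ X) (hg : ∀ x, Hom.fn g x ∈ U)

/-- The map on the underlying spaces. -/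
def liftBase : T.carrier ⟶ (X.restrict U).carrier :=
  TopCat.ofHom ⟨fun x => (⟨Hom.fn g x, hg x⟩ : U), (Hom.continuous_fn g).subtype_mk _⟩

lemma liftBase_le (V : Opens (X.restrict U).carrier) :
    (Opens.map (liftBase g hg)).obj V ≤ (Opens.map g.toLRSHom.base).obj (restrictImg U V) :=
  fun _ hx => ⟨_, hx, rfl⟩

lemma mem_restrictImg (V : Opens (X.restrict U).carrier) (x : T.carrier) :
    Hom.fn g x ∈ restrictImg U V ↔ liftBase g hg x ∈ V := by
  refine ⟨?_, fun h => ⟨_, h, rfl⟩⟩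
  rintro ⟨y, hy, e⟩
  obtain rfl : y = liftBase g hg x := Subtype.ext e
  exact hy

/-- A morphism with image in `U` factors through the open subspace. -/
def lift : T ⟶ X.restrict U :=
  homMk (liftBase g hg) (fun V => Hom.appLE g (restrictImg U V) _ (liftBase_le g hg V))
    (fun V V' h s => by
      refine Eq.trans ?_ (Hom.res_appLE g _ (liftBase_le g hg V) s).symm
      exact Hom.appLE_res g (U.isOpenEmbedding.functor.map (homOfLE h)).le (liftBase_le g hg V') s)
    (fun V => Hom.continuous_appLE g _ _ _)
    (fun V s x hx => by
      have hx' : x ∈ (Opens.map (liftBase g hg)).obj V := nonvanishing_le _ hx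
      have h1 := (Hom.mem_nonvanishing_appLE g (liftBase_le g hg V) s hx').mp hx
      have hle : V ≤ (Opens.map (restrictι U).toLRSHom.base).obj (restrictImg U V) :=
        fun y hy => ⟨y, hy, rfl⟩
      have h2 := (Hom.mem_nonvanishing_appLE (restrictι U) hle s
        (x := liftBase g hg x) hx').mpr h1
      exact (congrArg (fun t : (X.restrict U).topSheaf.obj V => liftBase g hg x ∈ nonvanishing t)
        (restrictι_appLE U V hle s)).mp h2)

lemma lift_appLE (V : Opens (X.restrict U).carrier) (N : Opens T.carrier)
    (h : N ≤ (Opens.map (lift g hg).toLRSHom.base).obj V)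
    (s : X.topSheaf.obj (restrictImg U V)) :
    Hom.appLE (lift g hg) V N h s =
      Hom.appLE g (restrictImg U V) N (h.trans (liftBase_le g hg V)) s :=
  Hom.res_appLE g h (liftBase_le g hg V) s

lemma lift_fac : lift g hg ≫ restrictι U = g := by
  refine Hom.ext' (fun _ => rfl) fun N x hx s => ⟨(Opens.map g.toLRSHom.base).obj N, le_rfl,
    le_rfl, hx, ?_⟩
  have h1 : (Opens.map g.toLRSHom.base).obj N ≤ (Opens.map (lift g hg).toLRSHom.base).obj
    ((Opens.map (restrictι U).toLRSHom.base).obj N) := le_rfl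
  have h2 : restrictImg U ((Opens.map (restrictι U).toLRSHom.base).obj N) ≤ N := by
    rintro _ ⟨y, hy, rfl⟩
    exact hy
  have h3 : (Opens.map (restrictι U).toLRSHom.base).obj N ≤ (Opens.map (restrictι U).toLRSHom.base).obj
    (restrictImg U ((Opens.map (restrictι U).toLRSHom.base).obj N)) := fun y hy => ⟨y, hy, rfl⟩
  refine (Hom.comp_appLE (lift g hg) (restrictι U) le_rfl h1 s).trans ?_
  have h4 := Hom.appLE_res (restrictι U) h2 h3 s
  replace h4 := (restrictι_appLE U _ h3 _).symm.trans h4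
  refine (congrArg _ h4.symm).trans ?_
  refine (lift_appLE g hg _ _ h1 _).trans ?_
  exact Hom.appLE_res g h2 _ s

lemma isOpenImmersion_lift (h : IsOpenImmersion g) : IsOpenImmersion (lift g hg) := by
  have hb : IsOpenEmbedding (Hom.fn (lift g hg)) :=
    IsOpenEmbedding.of_comp _ (isOpenImmersion_restrictι U).isOpenEmbedding
      (by
        have e : Hom.fn (restrictι U) ∘ Hom.fn (lift g hg) = Hom.fn g := rfl
        exact h.isOpenEmbedding)
  refine isOpenImmersion_of_bijective _ hb fun V hV => ?_
  have e : (⇑(Hom.appLE (lift g hg) V _ le_rfl) : _ → _) =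
      Hom.appLE g (restrictImg U V) _ (liftBase_le g hg V) :=
    funext fun s => lift_appLE g hg V _ le_rfl s
  have h1 : (restrictImg U V : Set X.carrier) ⊆ Set.range (Hom.fn g) := by
    rintro _ ⟨y, hy, rfl⟩
    obtain ⟨x, rfl⟩ := hV hy
    exact ⟨x, rfl⟩
  have h2 : (Opens.map (lift g hg).toLRSHom.base).obj V =
      (Opens.map g.toLRSHom.base).obj (restrictImg U V) :=
    Opens.ext (Set.ext fun x => (mem_restrictImg g hg V x).symm)
  rw [e]
  exact ⟨h.bijective_appLE h1 h2, h.isInducing_appLE h1 h2⟩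

lemma IsFormal.restrict (hX : X.IsFormal) : (X.restrict U).IsFormal := by
  intro x
  obtain ⟨A, _, _, _, j, hj, ⟨p, hp⟩, hjU⟩ := hX.exists_affine_subset (U := U) (x := x.1) x.2
  exact ⟨A, _, _, _, lift j (fun p => hjU ⟨p, rfl⟩), isOpenImmersion_lift _ _ hj, p, Subtype.ext hp⟩

lemma SurjStalks.lift (h : SurjStalks g) : SurjStalks (lift g hg) := by
  intro V s x hx
  obtain ⟨N, t, V', h1, h2, hxV', ht⟩ := h V s x hx
  have h3 : restrictImg U ((Opens.map (restrictι U).toLRSHom.base).obj N) ≤ N := by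
    rintro _ ⟨y, hy, rfl⟩
    exact hy
  refine ⟨(Opens.map (restrictι U).toLRSHom.base).obj N, X.topSheaf.res h3 t, V', h1, h2, hxV', ?_⟩
  refine (lift_appLE g hg _ _ h1 _).trans ?_
  exact (Hom.appLE_res g h3 _ t).trans ht

/-- Strict embeddings of ordinary schemes into formal schemes are immersions. -/
theorem IsStrictEmbedding.isImmersion {W : LocallyTopRingedSpace.{u}} {w : W ⟶ X}
    (h : IsStrictEmbedding w) (hX : X.IsFormal) (hW : IsOrdinaryScheme W) : IsImmersion w := by
  -- The complement of `closure \ image` is open because the image is locally closed, and the image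
  -- is closed in it.
  let U : Opens X.carrier := ⟨_, isLocallyClosed_iff_isOpen_coborder.mp h.isLocallyClosed⟩
  have hU (x : W.carrier) : Hom.fn w x ∈ U := subset_coborder ⟨x, rfl⟩
  refine ⟨X.restrict U, lift w hU, restrictι U, fun x => ?_, isOpenImmersion_restrictι U,
    lift_fac w hU⟩
  obtain ⟨A, _, _, _, a, ha, hx⟩ := hX.restrict x
  have hemb : IsEmbedding (Hom.fn (lift w hU)) :=
    IsEmbedding.of_comp (Hom.continuous_fn _) (Hom.continuous_fn (restrictι U)) h.isEmbedding
  have hclosed : IsClosed (Set.range (Hom.fn (lift w hU))) := by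
    have e : Set.range (Hom.fn (lift w hU)) =
        Hom.fn (restrictι U) ⁻¹' closure (Set.range (Hom.fn w)) := by
      ext y
      refine ⟨?_, fun hy => ?_⟩
      · rintro ⟨x, rfl⟩
        exact subset_closure ⟨x, rfl⟩
      · obtain ⟨x, hx⟩ : y.1 ∈ Set.range (Hom.fn w) := by
          have h1 : y.1 ∈ (closure (Set.range (Hom.fn w)) \ Set.range (Hom.fn w))ᶜ := y.2
          exact by_contra fun h2 => h1 ⟨hy, h2⟩
        exact ⟨x, Subtype.ext hx⟩
    rw [e]
    exact isClosed_closure.preimage (Hom.continuous_fn _)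
  have hcl : closure (Set.range (Hom.fn (lift w hU))) ∩ Set.range (Hom.fn a) ⊆
      Set.range (Hom.fn (lift w hU)) := by
    rw [hclosed.closure_eq]
    exact Set.inter_subset_left
  have hI := AffineStrictEmbedding.isClosed_ideal hW hemb ha hcl
  obtain ⟨b, hb, hbr, hbw, -⟩ := AffineStrictEmbedding.exists_chart hW hemb
    (h.surjStalks.lift w hU) ha hcl hI
  exact ⟨A, _, _, _, _, hI, a, b, ha, hb, hx, hbr, hbw⟩

end LocallyTopRingedSpace

end

end FormalGeometry

/-! ### Pseudo-discrete sheaves and functions with values in the residue fields. -/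

namespace FormalGeometry

noncomputable section

set_option linter.unusedSectionVars false

namespace TopSheaf

section PseudoDiscrete

variable {X : TopCat.{u}} (P : TopCat.Presheaf CommRingCat.{u} X)

/-- The restrictions to all quasi-compact open subsets. -/
def compactRes (U : Opens X) : P.obj (op U) →+*
    ∀ V : {V : Opens X // V ≤ U ∧ IsCompact (V : Set X)}, P.obj (op V.1) :=
  RingHom.pi fun V => (P.map (homOfLE V.2.1).op).hom

/-- The pseudo-discrete topology. -/
@[reducible]
def pseudoDiscreteTop (U : Opens X) : TopologicalSpace (P.obj (op U)) :=
  letI (V : {V : Opens X // V ≤ U ∧ IsCompact (V : Set X)}) : TopologicalSpace (P.obj (op V.1)) := ⊥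
  TopologicalSpace.induced (compactRes P U) Pi.topologicalSpace

lemma continuous_pseudoDiscreteTop {U V : Opens X} (h : V ≤ U) (hV : IsCompact (V : Set X)) :
    Continuous[pseudoDiscreteTop P U, ⊥] (P.map (homOfLE h).op) := by
  let (V : {V : Opens X // V ≤ U ∧ IsCompact (V : Set X)}) : TopologicalSpace (P.obj (op V.1)) := ⊥
  let := pseudoDiscreteTop P U
  exact (continuous_apply (⟨V, h, hV⟩ : {V : Opens X // V ≤ U ∧ IsCompact (V : Set X)})).comp
    (continuous_induced_dom (f := compactRes P U))

lemma continuous_pseudoDiscreteTop_rng {S : Type*} (t : TopologicalSpace S) {U : Opens X}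
    (f : S → P.obj (op U)) (hf : ∀ (V : Opens X) (h : V ≤ U), IsCompact (V : Set X) →
      Continuous[t, ⊥] fun s => P.map (homOfLE h).op (f s)) :
    Continuous[t, pseudoDiscreteTop P U] f := by
  let (V : {V : Opens X // V ≤ U ∧ IsCompact (V : Set X)}) : TopologicalSpace (P.obj (op V.1)) := ⊥
  exact continuous_induced_rng.mpr (continuous_pi fun V => hf V.1 V.2.1 V.2.2)

lemma isTopologicalRing_pseudoDiscreteTop (U : Opens X) :
    @IsTopologicalRing (P.obj (op U)) (pseudoDiscreteTop P U) _ := by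
  let (V : {V : Opens X // V ≤ U ∧ IsCompact (V : Set X)}) : TopologicalSpace (P.obj (op V.1)) := ⊥
  have (V : {V : Opens X // V ≤ U ∧ IsCompact (V : Set X)}) : DiscreteTopology (P.obj (op V.1)) :=
    ⟨rfl⟩
  let := pseudoDiscreteTop P U
  have h1 : ContinuousAdd (P.obj (op U)) := continuousAdd_induced (compactRes P U)
  have h2 : ContinuousMul (P.obj (op U)) := continuousMul_induced (compactRes P U)
  have h3 : IsTopologicalAddGroup (P.obj (op U)) := topologicalAddGroup_induced (compactRes P U)
  exact { h1, h2, h3 with }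

/-- A sheaf of rings as a sheaf of pseudo-discrete rings. -/
def pseudoDiscrete (hP : P.IsSheaf) (hX : ∀ (U : Opens X), ∀ x ∈ U, ∃ V : Opens X, V ≤ U ∧ x ∈ V ∧
    IsCompact (V : Set X)) : TopSheaf X where
  presheaf := P
  isSheaf := hP
  sectionTop := pseudoDiscreteTop P
  isTopologicalRing := isTopologicalRing_pseudoDiscreteTop P
  continuous_map {U V} i := by
    refine continuous_pseudoDiscreteTop_rng P _ _ fun W hW hWc => ?_
    have e : (fun s => P.map (homOfLE hW).op (P.map i.op s)) =
        P.map (homOfLE (hW.trans i.le)).op := by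
      funext s
      rw [← CommRingCat.comp_apply, ← P.map_comp]
      rfl
    rw [e]
    exact continuous_pseudoDiscreteTop P _ hWc
  iInf_induced_le {ι} V U i hU := by
    set t : TopologicalSpace (P.obj (op U)) :=
      ⨅ k, (pseudoDiscreteTop P (V k)).induced (P.map (i k).op) with ht
    refine continuous_id_iff_le.mp (continuous_pseudoDiscreteTop_rng P t id fun W hWU hW => ?_)
    have h1 (x : X) (hx : x ∈ W) : ∃ (N : Opens X) (k : ι),
        IsCompact (N : Set X) ∧ x ∈ N ∧ N ≤ W ∧ N ≤ V k := by
      obtain ⟨k, hk⟩ := Opens.mem_iSup.mp (hU (hWU hx))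
      obtain ⟨N, hN, hxN, hNc⟩ := hX (W ⊓ V k) x ⟨hx, hk⟩
      exact ⟨N, k, hNc, hxN, fun y hy => (hN hy).1, fun y hy => (hN hy).2⟩
    choose! N hk using h1
    choose k hNc hxN hNW hNV using hk
    obtain ⟨T, hT, hcov⟩ := hW.elim_nhds_subcover (fun x => (N x : Set X))
      fun x hx => (N x).isOpen.mem_nhds (hxN x hx)
    -- The quasi-compact `W` is covered by finitely many quasi-compact pieces, each inside some
    -- member of the cover. A finite product of discrete rings is discrete, so continuity into
    -- discrete sections over `W` can be tested through the injection `r`.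
    let r (y : P.obj (op W)) (x : T) : P.obj (op (N x)) := P.map (homOfLE (hNW x (hT x x.2))).op y
    have hr : Function.Injective r := by
      intro y z hyz
      refine TopCat.Sheaf.eq_of_locally_eq' ⟨P, hP⟩ (fun x : T => N x) W
        (fun x => homOfLE (hNW x (hT x x.2))) ?_ y z fun x => congrFun hyz x
      intro q hq
      obtain ⟨x, hx, hqx⟩ := Set.mem_iUnion₂.mp (hcov hq)
      exact Opens.mem_iSup.mpr ⟨⟨x, hx⟩, hqx⟩
    let (x : T) : TopologicalSpace (P.obj (op (N x))) := ⊥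
    have (x : T) : DiscreteTopology (P.obj (op (N x))) := ⟨rfl⟩
    have hP : Continuous fun s : P.obj (op U) => r (P.map (homOfLE hWU).op s) := by
      refine continuous_pi fun x => ?_
      have h2 : Continuous[t, pseudoDiscreteTop P (V (k x (hT x x.2)))]
          (P.map (i (k x (hT x x.2))).op) :=
        continuous_iInf_dom (i := k x.1 (hT x x.2)) continuous_induced_dom
      have h3 := @Continuous.comp _ _ _ t (pseudoDiscreteTop P _) ⊥ _ _
        (continuous_pseudoDiscreteTop P (hNV x (hT x x.2)) (hNc x (hT x x.2))) h2
      convert h3 using 2 with s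
      change P.map _ (P.map _ s) = P.map _ (P.map _ s)
      rw [← CommRingCat.comp_apply, ← CommRingCat.comp_apply, ← P.map_comp, ← P.map_comp]
      rfl
    let : TopologicalSpace (P.obj (op W)) := ⊥
    refine continuous_def.mpr fun S _ => ?_
    have h4 := (isOpen_discrete (r '' S)).preimage hP
    convert h4 using 1
    ext s
    simp [hr.eq_iff]

lemma discreteTopology_pseudoDiscrete (hP : P.IsSheaf) (hX) {U : Opens X}
    (hU : IsCompact (U : Set X)) : DiscreteTopology ((pseudoDiscrete P hP hX).obj U) := by
  have h := continuous_pseudoDiscreteTop P (le_refl U) hU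
  have e : ⇑(P.map (homOfLE (le_refl U)).op) = id := funext fun s => congr($(P.map_id (op U)) s)
  rw [e] at h
  exact ⟨le_bot_iff.mp (continuous_id_iff_le.mp h)⟩

end PseudoDiscrete

end TopSheaf

namespace LocallyTopRingedSpace

variable (T : LocallyTopRingedSpace.{u})

instance (x : T.carrier) : IsLocalRing (T.presheaf.stalk x) := T.isLocalRing x

/-- The residue field at a point. -/
abbrev resField (x : T.carrier) : Type u := IsLocalRing.ResidueField (T.presheaf.stalk x)

variable {T}

/-- The value of a section at a point. -/
def value {U : Opens T.carrier} {x : T.carrier} (hx : x ∈ U) : T.topSheaf.obj U →+* T.resField x :=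
  (IsLocalRing.residue (T.presheaf.stalk x)).comp (T.presheaf.germ U x hx).hom

lemma value_ne_zero_iff {U : Opens T.carrier} {x : T.carrier} (hx : x ∈ U) (s : T.topSheaf.obj U) :
    value hx s ≠ 0 ↔ x ∈ nonvanishing s := by
  rw [mem_nonvanishing_iff s hx]
  exact IsLocalRing.residue_ne_zero_iff_isUnit _

lemma value_res {U V : Opens T.carrier} (h : V ≤ U) {x : T.carrier} (hx : x ∈ V)
    (s : T.topSheaf.obj U) : value hx (T.topSheaf.res h s) = value (h hx) s :=
  congrArg (IsLocalRing.residue (T.presheaf.stalk x))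
    (TopCat.Presheaf.germ_res_apply T.presheaf (homOfLE h) x hx s)

/-- The restriction of functions with values in the residue fields. -/
def funRes {U V : Opens T.carrier} (h : V ≤ U) :
    (∀ x : U, T.resField x.1) →+* ∀ x : V, T.resField x.1 where
  toFun φ x := φ ⟨x.1, h x.2⟩
  map_one' := rfl
  map_mul' _ _ := rfl
  map_zero' := rfl
  map_add' _ _ := rfl

variable (T) in
/-- The presheaf of functions with values in the residue fields. -/
def funPresheaf : TopCat.Presheaf CommRingCat.{u} T.carrier where
  obj U := CommRingCat.of (∀ x : U.unop, T.resField x.1)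
  map i := CommRingCat.ofHom (funRes i.unop.le)
  map_id _ := CommRingCat.hom_ext (RingHom.ext fun _ => rfl)
  map_comp _ _ := CommRingCat.hom_ext (RingHom.ext fun _ => rfl)

lemma isSheaf_funPresheaf : (funPresheaf T).IsSheaf := by
  rw [TopCat.Presheaf.isSheaf_iff_isSheafUniqueGluing]
  intro ι U sf hsf
  let φ (k : ι) : ∀ x : U k, T.resField x.1 := sf k
  have hφ (k l : ι) (x : T.carrier) (hk : x ∈ U k) (hl : x ∈ U l) : φ k ⟨x, hk⟩ = φ l ⟨x, hl⟩ :=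
    congrFun (hsf k l) ⟨x, hk, hl⟩
  choose k hk using fun x : ((iSup U : Opens T.carrier)) => Opens.mem_iSup.mp x.2
  refine ⟨fun x => φ (k x) ⟨x.1, hk x⟩, fun l => ?_, fun t ht => ?_⟩
  · exact funext fun x => hφ _ _ _ _ _
  · refine funext fun x => ?_
    exact congrFun (ht (k x)) ⟨x.1, hk x⟩

lemma IsFormal.exists_isCompact (hT : T.IsFormal) (U : Opens T.carrier) (x : T.carrier)
    (hx : x ∈ U) : ∃ V : Opens T.carrier, V ≤ U ∧ x ∈ V ∧ IsCompact (V : Set T.carrier) := by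
  obtain ⟨V, hV, hxV, hVc, -⟩ := hT.exists_nhds hx
  exact ⟨V, hV, hxV, hVc⟩

/-- The sheaf of functions with values in the residue fields, with the pseudo-discrete topology. -/
def funSheaf (hT : T.IsFormal) : TopSheaf T.carrier :=
  TopSheaf.pseudoDiscrete (funPresheaf T) isSheaf_funPresheaf hT.exists_isCompact

/-- The function on `U` defined by a section. -/
def valueHom (hT : T.IsFormal) (U : Opens T.carrier) : T.topSheaf.obj U →+* (funSheaf hT).obj U :=
  RingHom.pi fun x : U => value x.2

/-- The value of a function at a point. -/
def funEval (hT : T.IsFormal) {U : Opens T.carrier} {x : T.carrier} (hx : x ∈ U) :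
    (funSheaf hT).obj U →+* T.resField x := Pi.evalRingHom (fun x : U => T.resField x.1) ⟨x, hx⟩

variable (hT : T.IsFormal)

lemma funEval_valueHom {U : Opens T.carrier} {x : T.carrier} (hx : x ∈ U) (s : T.topSheaf.obj U) :
    funEval hT hx (valueHom hT U s) = value hx s := rfl

lemma funSheaf_ext {U : Opens T.carrier} {φ ψ : (funSheaf hT).obj U}
    (h : ∀ (x : T.carrier) (hx : x ∈ U), funEval hT hx φ = funEval hT hx ψ) : φ = ψ :=
  funext fun x : U => h x.1 x.2

lemma valueHom_res {U V : Opens T.carrier} (h : V ≤ U) (s : T.topSheaf.obj U) :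
    valueHom hT V (T.topSheaf.res h s) = (funSheaf hT).res h (valueHom hT U s) :=
  funSheaf_ext hT fun _ hx => value_res h hx s

lemma isUnit_funSheaf {U : Opens T.carrier} {φ : (funSheaf hT).obj U}
    (h : ∀ (x : T.carrier) (hx : x ∈ U), funEval hT hx φ ≠ 0) : IsUnit φ :=
  Pi.isUnit_iff.mpr fun x : U => (h x.1 x.2).isUnit

lemma valueHom_eq_zero_iff {U : Opens T.carrier} {s : T.topSheaf.obj U} :
    valueHom hT U s = 0 ↔ s ∈ nilIdeal U := by
  rw [mem_nilIdeal]
  refine ⟨fun h => le_bot_iff.mp fun x hx => ?_, fun h => funSheaf_ext hT fun x hx => ?_⟩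
  · refine ((value_ne_zero_iff (nonvanishing_le _ hx) s).mpr hx ?_).elim
    rw [← funEval_valueHom hT, h, map_zero]
  · rw [map_zero, funEval_valueHom]
    exact not_not.mp ((value_ne_zero_iff hx s).not.mpr fun h' => h.le h')

lemma discreteTopology_funSheaf {U : Opens T.carrier} (hU : IsCompact (U : Set T.carrier)) :
    DiscreteTopology ((funSheaf hT).obj U) :=
  TopSheaf.discreteTopology_pseudoDiscrete _ _ _ hU

end LocallyTopRingedSpace

end

end FormalGeometry

/-! ### The reduced ordinary scheme underlying a formal scheme, as a sheaf of functions. -/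

namespace FormalGeometry

noncomputable section

set_option linter.unusedSectionVars false

open LocallyTopRingedSpace

namespace LocallyTopRingedSpace

namespace Reduced

variable {T : LocallyTopRingedSpace.{u}} (hT : T.IsFormal)

lemma eq_mul_of_pow_mul_eq {R : Type*} [CommRing R] {u v w d : R} {m : ℕ} (h : u * v ^ m = 1)
    (h' : v ^ m * w = d) : w = u * d := by
  rw [← h', ← mul_assoc, h, one_mul]

/-- The functions that are locally given by sections. -/
def sub : (funSheaf hT).Sub where
  subring U :=
    { carrier := {φ | ∀ x ∈ U, ∃ (V : Opens T.carrier) (h : V ≤ U) (s : T.topSheaf.obj V),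
        x ∈ V ∧ (funSheaf hT).res h φ = valueHom hT V s}
      mul_mem' := by
        intro φ ψ hφ hψ x hx
        obtain ⟨V, h, s, hxV, hs⟩ := hφ x hx
        obtain ⟨V', h', s', hxV', hs'⟩ := hψ x hx
        refine ⟨V ⊓ V', inf_le_left.trans h, T.topSheaf.res inf_le_left s *
          T.topSheaf.res inf_le_right s', ⟨hxV, hxV'⟩, ?_⟩
        rw [map_mul, map_mul, valueHom_res, valueHom_res, ← hs, ← hs', TopSheaf.res_res,
          TopSheaf.res_res]
      one_mem' := fun x hx => ⟨U, le_rfl, 1, hx, by rw [map_one, map_one]⟩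
      add_mem' := by
        intro φ ψ hφ hψ x hx
        obtain ⟨V, h, s, hxV, hs⟩ := hφ x hx
        obtain ⟨V', h', s', hxV', hs'⟩ := hψ x hx
        refine ⟨V ⊓ V', inf_le_left.trans h, T.topSheaf.res inf_le_left s +
          T.topSheaf.res inf_le_right s', ⟨hxV, hxV'⟩, ?_⟩
        rw [map_add, map_add, valueHom_res, valueHom_res, ← hs, ← hs', TopSheaf.res_res,
          TopSheaf.res_res]
      zero_mem' := fun x hx => ⟨U, le_rfl, 0, hx, by rw [map_zero, map_zero]⟩
      neg_mem' := by
        intro φ hφ x hx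
        obtain ⟨V, h, s, hxV, hs⟩ := hφ x hx
        exact ⟨V, h, -s, hxV, by rw [map_neg, map_neg, hs]⟩ }
  res_mem {U V} h φ hφ := by
    intro x hx
    obtain ⟨N, hN, s, hxN, hs⟩ := hφ x (h hx)
    refine ⟨N ⊓ V, inf_le_right, T.topSheaf.res inf_le_left s, ⟨hxN, hx⟩, ?_⟩
    rw [valueHom_res, ← hs, TopSheaf.res_res, TopSheaf.res_res]
  mem_of_local {U} φ hφ := by
    intro x hx
    obtain ⟨V, h, hxV, hV⟩ := hφ x hx
    obtain ⟨N, hN, s, hxN, hs⟩ := hV x hxV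
    refine ⟨N, hN.trans h, s, hxN, ?_⟩
    rw [← hs, TopSheaf.res_res]

lemma valueHom_mem_sub {U : Opens T.carrier} (s : T.topSheaf.obj U) :
    valueHom hT U s ∈ (sub hT).subring U :=
  fun _ hx => ⟨U, le_rfl, s, hx, by rw [TopSheaf.res_refl]⟩

section Chart

variable {A : Type u} [CommRing A] [TopologicalSpace A] [IsAdmissibleRing A]

variable (A) in
/-- The elements that are contained in all open prime ideals. -/
def nil : Ideal A := ⨅ p : SpfTop A, p.1.asIdeal

lemma mem_nil {a : A} : a ∈ nil A ↔ ∀ p : SpfTop A, a ∈ p.1.asIdeal := Ideal.mem_iInf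

lemma nil_le (p : SpfTop A) : nil A ≤ p.1.asIdeal := fun _ h => mem_nil.mp h p

/-- It contains every ideal of definition. Hence the quotient is discrete, while its formal spectrum
still has all the points. -/
lemma isOpen_nil : IsOpen (nil A : Set A) := by
  obtain ⟨K, hK⟩ := IsAdmissibleRing.exists_isIdealOfDefinition (A := A)
  exact isOpen_ideal_of_le (fun _ ha => mem_nil.mpr fun p => hK.le_of_isOpen p.2 ha) hK.1

lemma isClosed_nil : IsClosed (nil A : Set A) :=
  AddSubgroup.isClosed_of_isOpen (nil A).toAddSubgroup isOpen_nil

instance : IsAdmissibleRing (A ⧸ nil A) := IsAdmissibleRing.quotient _ isClosed_nil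

instance : DiscreteTopology (A ⧸ nil A) := discreteTopology_quotient isOpen_nil

lemma isOpenEmbedding_mapBase_nil :
    IsOpenEmbedding (Spf.mapBase (Ideal.Quotient.mk (nil A)) (continuous_quotientMk _)) := by
  refine ⟨(Spf.isClosedEmbedding_mapBase_mk (nil A)).isEmbedding, ?_⟩
  have h : Set.range (Spf.mapBase (Ideal.Quotient.mk (nil A)) (continuous_quotientMk _)) =
      Set.univ := by
    rw [Spf.range_mapBase_mk]
    exact Set.eq_univ_of_forall nil_le
  rw [h]
  exact isOpen_univ

variable {j : Spf A ⟶ T} (hj : IsOpenImmersion j)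

/-- The underlying map of the chart of the reduced space. -/
def base (j : Spf A ⟶ T) : SpfTop (A ⧸ nil A) ⟶ T.carrier :=
  TopCat.ofHom ⟨fun q => Hom.fn j (Spf.mapBase (Ideal.Quotient.mk (nil A))
    (continuous_quotientMk _) q), (Hom.continuous_fn j).comp
      (Spf.mapBase (Ideal.Quotient.mk (nil A)) (continuous_quotientMk _)).hom.continuous⟩

include hj in
lemma isOpenEmbedding_base : IsOpenEmbedding (base j) :=
  hj.isOpenEmbedding.comp isOpenEmbedding_mapBase_nil

lemma exists_base_eq (p : SpfTop A) : ∃ q, base j q = Hom.fn j p := by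
  obtain ⟨q, rfl⟩ := (Spf.range_mapBase_mk (nil A)).ge (nil_le p)
  exact ⟨q, rfl⟩

lemma functor_le_img (U : Opens (SpfTop (A ⧸ nil A))) :
    (isOpenEmbedding_base hj).functor.obj U ≤ hj.img ⊤ := by
  rintro _ ⟨q, -, rfl⟩
  exact hj.fn_mem_img.mpr trivial

lemma functor_basicOpen_eq (c : A) :
    (isOpenEmbedding_base hj).functor.obj (Spf.basicOpen (Ideal.Quotient.mk (nil A) c)) =
      hj.img (Spf.D c) := by
  ext x
  refine ⟨?_, ?_⟩
  · rintro ⟨q, hq, rfl⟩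
    exact hj.fn_mem_img.mpr hq
  · rintro ⟨p, hp, rfl⟩
    obtain ⟨q, rfl⟩ := (Spf.range_mapBase_mk (nil A)).ge
      (nil_le p)
    exact ⟨q, hp, rfl⟩

/-- The functions given by elements of the ring of the chart. -/
def preHom : A →+* ((funSheaf hT).restrict (isOpenEmbedding_base hj)).obj ⊤ :=
  ((funSheaf hT).res (functor_le_img hj ⊤)).comp ((valueHom hT (hj.img ⊤)).comp (hj.ofChart ⊤))

lemma preHom_eq_zero {c : A} (hc : c ∈ nil A) : preHom hT hj c = 0 := by
  have h : valueHom hT (hj.img ⊤) (hj.ofChart ⊤ c) = 0 := by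
    rw [valueHom_eq_zero_iff, mem_nilIdeal]
    refine le_bot_iff.mp fun x hx => ?_
    obtain ⟨p, -, rfl⟩ := nonvanishing_le _ hx
    exact ((hj.mem_nonvanishing_ofChart c (show p ∈ (⊤ : Opens (Spf A).carrier) from trivial)).mp
      hx) (mem_nil.mp hc p)
  exact (congrArg _ h).trans (map_zero ((funSheaf hT).res (functor_le_img hj ⊤)))

/-- The functions given by elements of the quotient. -/
def redHom : A ⧸ nil A →+* ((funSheaf hT).restrict (isOpenEmbedding_base hj)).obj ⊤ :=
  Ideal.Quotient.lift (nil A) (preHom hT hj) fun _ hc => preHom_eq_zero hT hj hc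

lemma res_redHom (U : Opens (SpfTop (A ⧸ nil A))) (c : A) :
    ((funSheaf hT).restrict (isOpenEmbedding_base hj)).res (le_top : U ≤ ⊤)
      (redHom hT hj (Ideal.Quotient.mk _ c)) =
    valueHom hT ((isOpenEmbedding_base hj).functor.obj U)
      (T.topSheaf.res (functor_le_img hj U) (hj.ofChart ⊤ c)) := by
  rw [valueHom_res]
  exact (funSheaf hT).res_res (functor_le_img hj ⊤)
    ((isOpenEmbedding_base hj).functor.map (homOfLE (le_top : U ≤ ⊤))).le
    (valueHom hT (hj.img ⊤) (hj.ofChart ⊤ c))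

lemma mem_nonvanishing_res_ofChart {U : Opens (SpfTop (A ⧸ nil A))} (c : A)
    {q : SpfTop (A ⧸ nil A)} (hq : q ∈ U) :
    base j q ∈ nonvanishing (T.topSheaf.res (functor_le_img hj U) (hj.ofChart ⊤ c)) ↔
      q ∈ Spf.basicOpen (Ideal.Quotient.mk (nil A) c) := by
  rw [nonvanishing_res]
  refine ⟨fun h => (hj.mem_nonvanishing_ofChart c (U := ⊤) trivial).mp h.2, fun h =>
    ⟨⟨q, hq, rfl⟩, (hj.mem_nonvanishing_ofChart c (U := ⊤) trivial).mpr h⟩⟩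

lemma discreteTopology_restrict (b : A ⧸ nil A) : DiscreteTopology
    (((funSheaf hT).restrict (isOpenEmbedding_base hj)).obj (Spf.basicOpen b)) :=
  discreteTopology_funSheaf hT (U := (isOpenEmbedding_base hj).functor.obj (Spf.basicOpen b))
    ((Spf.isCompact_basicOpen b).image (base j).hom.continuous)

lemma isChart_redHom :
    Spf.IsChart ((funSheaf hT).restrict (isOpenEmbedding_base hj)) (redHom hT hj) where
  continuous := continuous_of_discreteTopology
  isUnit b := by
    obtain ⟨c, rfl⟩ := Ideal.Quotient.mk_surjective b
    rw [res_redHom]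
    refine isUnit_funSheaf hT fun x hx => ?_
    rw [funEval_valueHom, value_ne_zero_iff]
    obtain ⟨q, hq, rfl⟩ := hx
    exact (mem_nonvanishing_res_ofChart hj c hq).mpr hq
  complete b := by
    have := discreteTopology_restrict hT hj b
    exact IsCompleteLinear.of_discrete
  exists_nhds b J := by
    have := discreteTopology_restrict hT hj b
    -- The exponent one suffices: if `d` vanishes wherever `c` does not, the product vanishes at
    -- every point, hence is zero in the quotient by `nil A`.
    refine ⟨{0}, (isOpen_discrete _).mem_nhds rfl, fun d hd => ⟨1, ?_⟩⟩
    obtain ⟨c, rfl⟩ := Ideal.Quotient.mk_surjective b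
    obtain ⟨d, rfl⟩ := Ideal.Quotient.mk_surjective d
    rw [Set.mem_singleton_iff, res_redHom] at hd
    have h0 := (mem_nilIdeal.mp ((valueHom_eq_zero_iff hT).mp hd)).le
    rw [pow_one, ← map_mul, Ideal.Quotient.eq_zero_iff_mem.mpr]
    · exact J.1.zero_mem
    · refine mem_nil.mpr fun p => ?_
      obtain ⟨q, rfl⟩ := (Spf.range_mapBase_mk (nil A)).ge
        (nil_le p)
      by_contra hp
      have hc : q ∈ Spf.basicOpen (Ideal.Quotient.mk (nil A) c) :=
        fun h => hp (Ideal.mul_mem_right _ _ h)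
      have hd : q ∈ Spf.basicOpen (Ideal.Quotient.mk (nil A) d) :=
        fun h => hp (Ideal.mul_mem_left _ _ h)
      exact h0 ((mem_nonvanishing_res_ofChart hj d hc).mpr hd)

/-- By discreteness a section over a basic open subset is a fraction; the denominator is
nonvanishing there, hence invertible in the original structure sheaf, and the fraction lifts. -/
lemma thetaHom_mem_sub (U : Opens (SpfTop (A ⧸ nil A))) (s : Spf.sections U) :
    (isChart_redHom hT hj).ThetaHom U s ∈
      (sub hT).subring ((isOpenEmbedding_base hj).functor.obj U) := by
  rintro _ ⟨q, hq, rfl⟩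
  obtain ⟨b, hqb, hb⟩ := Spf.exists_basicOpen_le hq
  have h1 := (isChart_redHom hT hj).res_ThetaHom_mem_closure s b hb
  have := discreteTopology_restrict hT hj b
  rw [closure_discrete] at h1
  obtain ⟨d, m, h2⟩ := h1
  obtain ⟨c, rfl⟩ := Ideal.Quotient.mk_surjective b
  obtain ⟨d, rfl⟩ := Ideal.Quotient.mk_surjective d
  rw [res_redHom, res_redHom] at h2
  have hu : IsUnit (T.topSheaf.res (functor_le_img hj (Spf.basicOpen (Ideal.Quotient.mk (nil A) c)))
      (hj.ofChart ⊤ c)) := by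
    refine isUnit_of_le_nonvanishing ?_
    rintro _ ⟨r, hr, rfl⟩
    exact (mem_nonvanishing_res_ofChart hj c hr).mpr hr
  obtain ⟨u, hu⟩ := (hu.pow m).exists_left_inv
  refine ⟨_, ((isOpenEmbedding_base hj).functor.map (homOfLE hb)).le, u *
    T.topSheaf.res (functor_le_img hj _) (hj.ofChart ⊤ d), ⟨q, hqb, rfl⟩, ?_⟩
  refine (eq_mul_of_pow_mul_eq (R := (funSheaf hT).obj _) ?_ h2).trans (map_mul _ _ _).symm
  rw [← map_pow, ← map_mul, hu, map_one]

lemma exists_mem_closure_fractions (U : Opens (SpfTop (A ⧸ nil A)))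
    (y : ((funSheaf hT).restrict (isOpenEmbedding_base hj)).obj U)
    (hy : y ∈ (sub hT).subring ((isOpenEmbedding_base hj).functor.obj U))
    (q : SpfTop (A ⧸ nil A)) (hq : q ∈ U) :
    ∃ (b : A ⧸ nil A) (hb : Spf.basicOpen b ≤ U), q ∈ Spf.basicOpen b ∧
      ((funSheaf hT).restrict (isOpenEmbedding_base hj)).res hb y ∈ closure
        (Spf.IsChart.fractions ((funSheaf hT).restrict (isOpenEmbedding_base hj))
          (redHom hT hj) b) := by
  obtain ⟨V, hV, s, hqV, hs⟩ := hy (base j q) ⟨q, hq, rfl⟩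
  obtain ⟨c, hqc, hc⟩ := hj.exists_img_basicOpen_le (U := V)
    (p := Spf.mapBase (Ideal.Quotient.mk (nil A)) (continuous_quotientMk _) q) hqV
  have hcV := (functor_basicOpen_eq hj c).le.trans hc
  have hcU : Spf.basicOpen (Ideal.Quotient.mk (nil A) c) ≤ U := by
    intro r hr
    obtain ⟨r', hr', e⟩ := hV (hcV ⟨r, hr, rfl⟩)
    exact (isOpenEmbedding_base hj).injective e ▸ hr'
  refine ⟨Ideal.Quotient.mk _ c, hcU, hqc, subset_closure ?_⟩
  -- The nowhere invertible sections form an open ideal, so a section can be approximated by a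
  -- fraction with the same values at all points.
  have hopen := (hT.isIdealOfDefinition_nilIdeal (hj.isCompact_img_basicOpen c)).1
  obtain ⟨w, ⟨d, m, hw⟩, hws⟩ := exists_sub_mem_of_mem_closure
    (hj.mem_closure_fractions c (T.topSheaf.res hc s)) (hopen.mem_nhds (Ideal.zero_mem _))
  have h1 : valueHom hT _ w = valueHom hT _ (T.topSheaf.res hc s) := by
    rw [← sub_eq_zero, ← map_sub, valueHom_eq_zero_iff]
    exact hws
  refine ⟨Ideal.Quotient.mk _ d, m, ?_⟩
  rw [res_redHom, res_redHom]
  have h2 : ((funSheaf hT).restrict (isOpenEmbedding_base hj)).res hcU y =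
      (funSheaf hT).res (functor_basicOpen_eq hj c).le (valueHom hT _ w) := by
    rw [h1, valueHom_res, ← hs]
    simp only [TopSheaf.res_res]
    rfl
  have h3 := congrArg (fun z => (funSheaf hT).res (functor_basicOpen_eq hj c).le
    (valueHom hT _ z)) hw
  simp only [map_mul, map_pow] at h3
  have key (d : A) : (funSheaf hT).res (functor_basicOpen_eq hj c).le
      (valueHom hT _ (hj.ofChart (Spf.D c) d)) = valueHom hT _ (T.topSheaf.res
        (functor_le_img hj (Spf.basicOpen (Ideal.Quotient.mk (nil A) c))) (hj.ofChart ⊤ d)) := by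
    rw [← hj.res_ofChart (le_top : Spf.D c ≤ ⊤), ← valueHom_res, TopSheaf.res_res]
  rw [key, key] at h3
  exact (congrArg _ h2).trans h3

/-- The chart of the reduced space. -/
def openIso : TopSheaf.OpenIso (Spf (A ⧸ nil A)).topSheaf (sub hT).toTopSheaf :=
  (isChart_redHom hT hj).openIsoSub (sub hT) (thetaHom_mem_sub hT hj)
    (exists_mem_closure_fractions hT hj)

end Chart

include hT in
lemma isLocalRing_stalk (x : T.carrier) : IsLocalRing ((sub hT).toTopSheaf.presheaf.stalk x) := by
  obtain ⟨A, _, _, _, j, hj, p, rfl⟩ := hT x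
  obtain ⟨q, hq⟩ := exists_base_eq (j := j) p
  have h := (openIso hT hj).isLocalRing_stalk (Spf (A ⧸ nil A)).isLocalRing q
  exact hq ▸ h

/-- The reduced space. -/
def space : LocallyTopRingedSpace.{u} := ofTopSheaf (sub hT).toTopSheaf (isLocalRing_stalk hT)

lemma isOrdinaryScheme_space : IsOrdinaryScheme (space hT) := by
  refine isOrdinaryScheme_of_charts fun x => ?_
  obtain ⟨A, _, _, _, j, hj, p, rfl⟩ := hT x
  obtain ⟨q, hq⟩ := exists_base_eq (j := j) p
  exact ⟨A ⧸ nil A, _, _, inferInstance, inferInstance,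
    homOfOpenIso (T := Spf (A ⧸ nil A)) (X := space hT) (openIso hT hj),
    isOpenImmersion_homOfOpenIso (T := Spf (A ⧸ nil A)) (X := space hT) (openIso hT hj), q, hq⟩

end Reduced

end LocallyTopRingedSpace

end

end FormalGeometry

/-! ### The topology of pseudo-immersions. -/

namespace FormalGeometry

noncomputable section

set_option linter.unusedSectionVars false

open LocallyTopRingedSpace

namespace LocallyTopRingedSpace

namespace Reduced

variable {T : LocallyTopRingedSpace.{u}} (hT : T.IsFormal)

/-- Over quasi-compact open subsets the kernel is the open ideal of nowhere invertible sections; the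
general case is local. -/
lemma continuous_valueHom (U : Opens T.carrier) : Continuous (valueHom hT U) := by
  have h1 (V : Opens T.carrier) (hV : IsCompact (V : Set T.carrier)) :
      Continuous (valueHom hT V) := by
    have := discreteTopology_funSheaf hT hV
    refine continuous_of_continuousAt_zero (valueHom hT V) ?_
    rw [ContinuousAt, map_zero, nhds_discrete ((funSheaf hT).obj V), Filter.tendsto_pure]
    filter_upwards [(hT.isIdealOfDefinition_nilIdeal hV).1.mem_nhds (Ideal.zero_mem _)] with s hs
    exact (valueHom_eq_zero_iff hT).mpr hs
  obtain ⟨V, hV, hx, h⟩ := hT.exists_cover U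
  rw [((funSheaf hT).isInducing_pi_res V hV
    (fun x hx' => Opens.mem_iSup.mpr ⟨⟨x, hx'⟩, hx _⟩)).continuous_iff]
  refine continuous_pi fun k => ?_
  have e : (fun s => (funSheaf hT).res (hV k) (valueHom hT U s)) =
      valueHom hT (V k) ∘ T.topSheaf.res (hV k) := funext fun s => (valueHom_res hT (hV k) s).symm
  exact (congrArg Continuous e).mpr ((h1 _ (h k).1).comp (T.topSheaf.continuous_res _))

/-- The functions given by sections, as sections of the reduced space. -/
def toSpace (U : Opens T.carrier) : T.topSheaf.obj U →+* (space hT).topSheaf.obj U :=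
  (valueHom hT U).codRestrict ((sub hT).subring U) (valueHom_mem_sub hT)

lemma mem_nonvanishing_of_toSpace {U : Opens T.carrier} (s : T.topSheaf.obj U) {x : T.carrier}
    (hx : x ∈ nonvanishing (T := space hT) (toSpace hT U s)) : x ∈ nonvanishing s := by
  have h1 := isUnit_res_nonvanishing (T := space hT) (toSpace hT U s)
  have hU := nonvanishing_le (T := space hT) _ hx
  have h2 : IsUnit (((sub hT).subring _).subtype ((space hT).topSheaf.res
      (nonvanishing_le (T := space hT) _) (toSpace hT U s))) := h1.map ((sub hT).subring _).subtype
  have h3 := (h2.map (funEval hT hx)).ne_zero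
  exact (value_ne_zero_iff hU s).mp h3

/-- The inclusion of the reduced space. -/
def ι : space hT ⟶ T :=
  homMk (X := space hT) (𝟙 T.carrier) (toSpace hT)
    (fun _ _ h s => Subtype.ext (valueHom_res hT h s))
    (fun U => (continuous_valueHom hT U).subtype_mk (valueHom_mem_sub hT))
    fun _ s _ hx => mem_nonvanishing_of_toSpace hT s hx

lemma isStrictEmbedding_ι : IsStrictEmbedding (ι hT) where
  isEmbedding := IsEmbedding.id
  isLocallyClosed := by
    have h : Set.range (Hom.fn (ι hT)) = Set.univ := Set.range_id
    rw [h]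
    exact isOpen_univ.isLocallyClosed
  surjStalks V s x hx := by
    obtain ⟨N, hN, t, hxN, ht⟩ := s.2 x hx
    exact ⟨N, t, N, le_rfl, hN, hxN, Subtype.ext ht.symm⟩

end Reduced

/-- The condition in the definition of pseudo-immersions. -/
def IsPseudoImmersion {Y X : LocallyTopRingedSpace.{u}} (f : Y ⟶ X) : Prop :=
  ∀ (W : LocallyTopRingedSpace.{u}) (i : W ⟶ Y), IsOrdinaryScheme W → IsImmersion i →
    IsImmersion (i ≫ f)

namespace IsPseudoImmersion

variable {Y X : LocallyTopRingedSpace.{u}} {f : Y ⟶ X} (hf : IsPseudoImmersion f)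
  (hY : Y.IsFormal)
include hf hY

/-- The reduced space is an ordinary scheme immersed in `Y` by the identity on points. The
definition of pseudo-immersions applied to it determines `f` topologically. -/
lemma isStrictEmbedding_reduced : IsStrictEmbedding (Reduced.ι hY ≫ f) :=
  (hf _ _ (Reduced.isOrdinaryScheme_space hY) ((Reduced.isStrictEmbedding_ι hY).isImmersion hY
    (Reduced.isOrdinaryScheme_space hY))).isStrictEmbedding (Reduced.isOrdinaryScheme_space hY)

lemma isEmbedding : IsEmbedding (Hom.fn f) := (hf.isStrictEmbedding_reduced hY).isEmbedding

lemma isLocallyClosed : IsLocallyClosed (Set.range (Hom.fn f)) :=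
  (hf.isStrictEmbedding_reduced hY).isLocallyClosed

end IsPseudoImmersion

end LocallyTopRingedSpace

end

end FormalGeometry

/-! ### Density of the sections of the target. -/

namespace FormalGeometry

noncomputable section

set_option linter.unusedSectionVars false

open LocallyTopRingedSpace

namespace Spf

variable {C : Type u} [CommRing C] [TopologicalSpace C] [IsAdmissibleRing C]

/-- The component at the zero ideal of `C ⧸ K` is the pullback, along an isomorphism of spectra, of
the component at the preimage of zero, which is contained in `K`. -/
lemma apply_eq_zero_of_mapSections_mk_eq_zero (K : OpenIdeal C) [IsAdmissibleRing (C ⧸ K.1)]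
    {U : Opens (SpfTop C)} {t : sections U}
    (h : mapSections (Ideal.Quotient.mk K.1) (continuous_quotientMk K.1) U t = 0) :
    t.1 K = 0 := by
  have := discreteTopology_quotient K.2
  let J : OpenIdeal (C ⧸ K.1) := botIdeal (C ⧸ K.1)
  let φ := Ideal.Quotient.mk K.1
  have hφ : Continuous φ := continuous_quotientMk K.1
  have hbij : Function.Bijective (Ideal.quotientMap J.1 φ (le_refl (J.1.comap φ))) :=
    ⟨Ideal.quotientMap_injective, Ideal.quotientMap_surjective Ideal.Quotient.mk_surjective⟩
  have h1 : IsIso (specMap φ hφ J) :=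
    (Scheme.Spec.mapIso (RingEquiv.ofBijective _ hbij).toCommRingCatIso.op).isIso_hom
  have h2 : (specMap φ hφ J).appLE _ _ (preim_mapBase_le φ hφ J U)
      (t.1 (comapIdeal φ hφ J)) = 0 := by
    rw [← mapSections_apply, h]
    rfl
  have h3 : (specMap φ hφ J).app (preim (comapIdeal φ hφ J) U) (t.1 (comapIdeal φ hφ J)) = 0 := by
    rw [← Scheme.Hom.appLE_eq_app]
    exact h2
  have h4 : Function.Injective ((specMap φ hφ J).app (preim (comapIdeal φ hφ J) U)) :=
    (ConcreteCategory.bijective_of_isIso _).1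
  refine apply_eq_zero_of_le t (I := comapIdeal φ hφ J) (fun c hc => ?_)
    (h4 (h3.trans (map_zero _).symm))
  exact Ideal.Quotient.eq_zero_iff_mem.mp (show φ c = 0 from hc)

lemma isClosedImmersion_map_mk (I : Ideal C) (hI : IsClosed (I : Set C))
    [IsAdmissibleRing (C ⧸ I)] :
    IsClosedImmersion (Spf.map (Ideal.Quotient.mk I) (continuous_quotientMk I)) := by
  intro x
  refine ⟨C, _, _, inferInstance, I, hI, 𝟙 _, 𝟙 _, isOpenImmersion_id _, isOpenImmersion_id _,
    ⟨x, rfl⟩, ?_, ?_⟩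
  · have h1 : Set.range (Hom.fn (𝟙 (Spf C))) = Set.univ := Set.range_id
    have h2 : Set.range (Hom.fn (𝟙 (Spf (C ⧸ I)))) = Set.univ := Set.range_id
    refine h2.trans ?_
    rw [show Set.range (𝟙 (Spf C) : Spf C ⟶ Spf C).toLRSHom.base = Set.univ from h1]
    rfl
  · rw [Category.comp_id, Category.id_comp]

end Spf

namespace LocallyTopRingedSpace

variable {Z X : LocallyTopRingedSpace.{u}} {g : Z ⟶ X} (hg : IsPseudoImmersion g)
  (hZ : Z.IsFormal) {A : Type u} [CommRing A] [TopologicalSpace A] [IsAdmissibleRing A]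
  {a : Spf A ⟶ X} (ha : IsOpenImmersion a) {C : Type u} [CommRing C] [TopologicalSpace C]
  [IsAdmissibleRing C] {c : Spf C ⟶ Z} (hc : IsOpenImmersion c)
  (hac : Hom.fn g ⁻¹' Set.range (Hom.fn a) ⊆ Set.range (Hom.fn c))
  (hcl : closure (Set.range (Hom.fn g)) ∩ Set.range (Hom.fn a) ⊆ Set.range (Hom.fn g))

open AffineStrictEmbedding

include hg hZ hc hac hcl in
-- The discrete quotient by `K` is an ordinary scheme immersed in `Z`, so its composite with `g` is
-- an immersion. That composite is closed over the chart `a`, hence `A` maps onto its sections: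
-- every `y` agrees modulo `K` with an element of `A`.
lemma IsPseudoImmersion.exists_quotient_eq (K : OpenIdeal C)
    (y : Z.topSheaf.obj (pre g ha)) : ∃ x : A,
      Spf.eval (A := C) ((Opens.map c.toLRSHom.base).obj (pre g ha)) K
        (Hom.appLE c _ _ le_rfl (toPre g ha x - y)) = 0 := by
  have hKc : IsClosed (K.1 : Set C) := AddSubgroup.isClosed_of_isOpen K.1.toAddSubgroup K.2
  have := IsAdmissibleRing.quotient K.1 hKc
  have := discreteTopology_quotient K.2
  let i : Spf (C ⧸ K.1) ⟶ Z := Spf.map (Ideal.Quotient.mk K.1) (continuous_quotientMk K.1) ≫ c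
  have hi : IsImmersion i := ⟨_, _, _, Spf.isClosedImmersion_map_mk K.1 hKc, hc, rfl⟩
  have hW : IsOrdinaryScheme (Spf (C ⧸ K.1)) := isOrdinaryScheme_of_charts fun x =>
    ⟨_, _, _, inferInstance, inferInstance, 𝟙 _, isOpenImmersion_id _, x, rfl⟩
  have hw := (hg _ _ hW hi).isStrictEmbedding hW
  -- A limit point over the chart lies in the image of `g` by `hcl` and comes from `Spf C` by `hac`.
  -- As `c ≫ g` is an embedding, it is then a limit point within `Spf C`, where the zero locus of
  -- `K` is closed.
  have hcl' : closure (Set.range (Hom.fn (i ≫ g))) ∩ Set.range (Hom.fn a) ⊆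
      Set.range (Hom.fn (i ≫ g)) := by
    let R : Set (Spf C).carrier :=
      Set.range (Hom.fn (Spf.map (Ideal.Quotient.mk K.1) (continuous_quotientMk K.1)))
    have hR : IsClosed R := (Spf.isClosedEmbedding_mapBase_mk K.1).isClosed_range
    have e : Set.range (Hom.fn (i ≫ g)) = Hom.fn (c ≫ g) '' R := by
      rw [← Set.range_comp]
      rfl
    have hcg : IsEmbedding (Hom.fn (c ≫ g)) :=
      (hg.isEmbedding hZ).comp hc.isOpenEmbedding.isEmbedding
    rintro x ⟨hx, hxa⟩
    obtain ⟨z, rfl⟩ := hcl ⟨closure_mono (by rintro _ ⟨w, rfl⟩; exact ⟨_, rfl⟩) hx, hxa⟩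
    obtain ⟨p, rfl⟩ := hac hxa
    rw [e] at hx ⊢
    refine ⟨p, ?_, rfl⟩
    rw [← hR.closure_eq, hcg.closure_eq_preimage_closure_image]
    exact hx
  obtain ⟨-, -, -, -, hsurj⟩ := exists_chart hW hw.isEmbedding hw.surjStalks ha hcl'
    (isClosed_ideal hW hw.isEmbedding ha hcl')
  obtain ⟨x, hx⟩ := hsurj (Hom.appLE i (pre g ha) (pre (i ≫ g) ha) le_rfl y)
  refine ⟨x, ?_⟩
  have h1 : toPre (i ≫ g) ha x = Hom.appLE i (pre g ha) (pre (i ≫ g) ha) le_rfl (toPre g ha x) :=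
    Hom.comp_appLE i g (V := pre g ha) le_rfl le_rfl _
  have h2 : Hom.appLE i (pre g ha) (pre (i ≫ g) ha) le_rfl (toPre g ha x - y) = 0 := by
    rw [map_sub, ← h1, hx, sub_self]
  apply Spf.apply_eq_zero_of_mapSections_mk_eq_zero K
  have h3 := Hom.comp_appLE (Spf.map (Ideal.Quotient.mk K.1) (continuous_quotientMk K.1)) c
    (U := pre g ha) (V := (Opens.map c.toLRSHom.base).obj (pre g ha)) (W := pre (i ≫ g) ha)
    le_rfl le_rfl (toPre g ha x - y)
  have h4 := h3.symm.trans h2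
  refine Eq.trans ?_ h4
  exact (Spf.res_refl _ _).symm

include hg hZ hc hac hcl in
/-- The sections of the target are dense where the pseudo-immersion is closed and affine. -/
lemma IsPseudoImmersion.denseRange_toPre : DenseRange (toPre g ha) := by
  intro y
  have hemb := hg.isEmbedding hZ
  have hpre : (pre g ha : Set Z.carrier) ⊆ Set.range (Hom.fn c) :=
    fun z hz => hac (ha.img_subset_range _ hz)
  -- Over a quasi-compact subset, neighbourhoods of zero are governed by the evaluations at the open
  -- ideals of `C`, so approximation modulo each of them gives density.
  have hU : IsCompact ((Opens.map c.toLRSHom.base).obj (pre g ha) : Set (Spf C).carrier) := by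
    rw [hc.isOpenEmbedding.isInducing.isCompact_iff]
    have h1 := isCompact_pre hemb ha hcl
    rwa [← Set.image_preimage_eq_of_subset hpre] at h1
  have hind := hc.isInducing_appLE hpre rfl
  refine mem_closure_of_forall_sub_mem fun N hN => ?_
  rw [hind.nhds_eq_comap, map_zero] at hN
  obtain ⟨M, hM, hMN⟩ := Filter.mem_comap.mp hN
  obtain ⟨K, -, hK⟩ := (Spf.nhds_zero_hasBasis (A := C) hU).mem_iff.mp hM
  obtain ⟨x, hx⟩ := hg.exists_quotient_eq hZ ha hc hac hcl K y
  exact ⟨_, ⟨x, rfl⟩, hMN (hK hx)⟩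

end LocallyTopRingedSpace

end

end FormalGeometry

/-! ### The closure of the image over an affine chart: ring and points. -/

namespace FormalGeometry

noncomputable section

set_option linter.unusedSectionVars false

open LocallyTopRingedSpace

namespace LocallyTopRingedSpace

/-- Modulo an open ideal of `C` this is the annihilation of a section by a power of `s`. It is
stated for all large exponents so that finitely many charts can share one. -/
lemma IsOpenImmersion.exists_nhds_pow_mul_mem {Y : LocallyTopRingedSpace.{u}} {C : Type u}
    [CommRing C] [TopologicalSpace C] [IsAdmissibleRing C] {j : Spf C ⟶ Y}
    (hj : IsOpenImmersion j) (s : Y.topSheaf.obj (hj.img ⊤))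
    {M : Set (Y.topSheaf.obj (hj.img ⊤))} (hM : M ∈ 𝓝 (0 : Y.topSheaf.obj (hj.img ⊤))) :
    ∃ N ∈ 𝓝 (0 : Y.topSheaf.obj (nonvanishing s)), ∀ c : Y.topSheaf.obj (hj.img ⊤),
      Y.topSheaf.res (nonvanishing_le s) c ∈ N → ∃ k₀ : ℕ, ∀ k ≥ k₀, s ^ k * c ∈ M := by
  let s' : Spf.sections (⊤ : Opens (SpfTop C)) := hj.secEquiv ⊤ s
  let W : Opens (Spf C).carrier := (Opens.map j.toLRSHom.base).obj (nonvanishing s)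
  have hW : (W : Opens (SpfTop C)) = Spf.nonvanishing s' := by
    ext p
    exact (Hom.mem_nonvanishing_appLE j (hj.map_img ⊤).ge s (x := p) trivial).symm
  have hWc : IsCompact (W : Set (Spf C).carrier) := by
    have e : (W : Set (Spf C).carrier) = (Spf.nonvanishing s' : Set (SpfTop C)) :=
      congrArg (fun V : Opens (SpfTop C) => (V : Set (SpfTop C))) hW
    rw [e]
    exact (Spf.isAff_top.isAff_nonvanishing s').isCompact
  rw [(hj.isInducing_secEquiv ⊤).nhds_eq_comap, map_zero] at hM
  obtain ⟨M', hM', hMM'⟩ := Filter.mem_comap.mp hM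
  obtain ⟨K, -, hK⟩ := (Spf.nhds_zero_hasBasis (A := C) Spf.isCompact_top).mem_iff.mp hM'
  let E : Set ((Spf C).topSheaf.obj W) := {t | Spf.eval (A := C) W K t = 0}
  refine ⟨Hom.appLE j (nonvanishing s) W le_rfl ⁻¹' E, ?_,
    fun c hc => ?_⟩
  · refine (Hom.continuous_appLE j (nonvanishing s) W le_rfl).continuousAt.preimage_mem_nhds ?_
    rw [map_zero]
    have hE : IsOpen E := Spf.isOpen_kerEval (A := C) (U := W) hWc K
    exact hE.mem_nhds (map_zero (Spf.eval (A := C) W K))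
  · have h1 : Hom.appLE j (nonvanishing s) W le_rfl (Y.topSheaf.res (nonvanishing_le s) c) =
        (Spf C).topSheaf.res le_top (hj.secEquiv ⊤ c) := by
      rw [hj.secEquiv_apply, Hom.appLE_res, Hom.res_appLE]
    rw [Set.mem_preimage, h1] at hc
    obtain ⟨k, hk⟩ := Spf.isAff_top.exists_pow_mul_mem_kerEval s' (hj.secEquiv ⊤ c) hW le_top K hc
    -- Since the smaller neighbourhood is an ideal, all exponents above `k` work as well.
    refine ⟨k, fun l hl => hMM' (hK ?_)⟩
    obtain ⟨m, rfl⟩ := Nat.exists_eq_add_of_le hl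
    have h2 := Ideal.mul_mem_left _ (s' ^ m) hk
    have e : hj.secEquiv ⊤ (s ^ (k + m) * c) =
        hj.secEquiv ⊤ s ^ m * (hj.secEquiv ⊤ s ^ k * hj.secEquiv ⊤ c) := by
      rw [map_mul, map_pow, pow_add, ← mul_assoc, mul_comm (hj.secEquiv ⊤ s ^ m)]
    exact (congrArg (fun z => Spf.eval (A := C) ⊤ K z = 0) e).mpr h2

/-- This yields the condition `exists_nhds` for the closure of the image: localizing that ring
induces the topology of the sections of `Y` where `s` is invertible. -/
lemma IsFormal.exists_nhds_pow_mul_mem {Y : LocallyTopRingedSpace.{u}} (hY : Y.IsFormal)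
    {U : Opens Y.carrier} (hU : IsCompact (U : Set Y.carrier)) (s : Y.topSheaf.obj U)
    {M : Set (Y.topSheaf.obj U)} (hM : M ∈ 𝓝 (0 : Y.topSheaf.obj U)) :
    ∃ N ∈ 𝓝 (0 : Y.topSheaf.obj (nonvanishing s)), ∀ c : Y.topSheaf.obj U,
      Y.topSheaf.res (nonvanishing_le s) c ∈ N → ∃ k : ℕ, s ^ k * c ∈ M := by
  have hloc (x : U) : ∃ V : Opens Y.carrier, V ≤ U ∧ x.1 ∈ V ∧ ∀ (s : Y.topSheaf.obj V)
      (M : Set (Y.topSheaf.obj V)), M ∈ 𝓝 (0 : Y.topSheaf.obj V) →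
      ∃ N ∈ 𝓝 (0 : Y.topSheaf.obj (nonvanishing s)), ∀ c : Y.topSheaf.obj V,
      Y.topSheaf.res (nonvanishing_le s) c ∈ N → ∃ k₀ : ℕ, ∀ k ≥ k₀, s ^ k * c ∈ M := by
    obtain ⟨A, _, _, _, j, hj, ⟨p, hp⟩, hjU⟩ := hY.exists_affine_subset x.2
    exact ⟨hj.img ⊤, fun x hx => hjU (hj.img_subset_range _ hx),
      hp ▸ hj.fn_mem_img.mpr trivial, fun s M hM => hj.exists_nhds_pow_mul_mem s hM⟩
  choose V hV hxV hP using hloc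
  obtain ⟨t, ht⟩ := hU.elim_finite_subcover (fun k => (V k : Set Y.carrier))
    (fun k => (V k).isOpen) fun x hx' => Set.mem_iUnion.mpr ⟨⟨x, hx'⟩, hxV _⟩
  have hcov : U ≤ iSup fun k : t => V k.1 := fun x hx => by
    obtain ⟨k, hk, hxk⟩ := Set.mem_iUnion₂.mp (ht hx)
    exact Opens.mem_iSup.mpr ⟨⟨k, hk⟩, hxk⟩
  have hVt (k : t) : V k.1 ≤ U := hV k.1
  rw [(Y.topSheaf.isInducing_pi_res (fun k : t => V k.1) hVt hcov).nhds_eq_comap] at hM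
  obtain ⟨M', hM', hMM'⟩ := Filter.mem_comap.mp hM
  simp only [map_zero] at hM'
  rw [nhds_pi, Filter.mem_pi] at hM'
  obtain ⟨I, -, L, hL, hLM⟩ := hM'
  choose N hN hNk using fun k : t => hP k.1 (Y.topSheaf.res (hVt k) s) (L k) (hL k)
  have hle (k : t) : nonvanishing (Y.topSheaf.res (hVt k) s) ≤ nonvanishing s := by
    rw [nonvanishing_res]
    exact inf_le_right
  refine ⟨⋂ k, Y.topSheaf.res (hle k) ⁻¹' N k, ?_, fun c hc => ?_⟩
  · refine Filter.iInter_mem.mpr fun k =>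
      (Y.topSheaf.continuous_res (hle k)).continuousAt.preimage_mem_nhds ?_
    rw [map_zero]
    exact hN k
  · have h1 (k : t) := hNk k (Y.topSheaf.res (hVt k) c) (by
      have := Set.mem_iInter.mp hc k
      rw [Set.mem_preimage, TopSheaf.res_res] at this
      rwa [TopSheaf.res_res])
    choose k₀ hk₀ using h1
    -- The largest of the finitely many local bounds works on every chart.
    refine ⟨Finset.univ.sup k₀, hMM' (hLM fun k _ => ?_)⟩
    have := hk₀ k _ (Finset.le_sup (Finset.mem_univ k))
    rwa [← map_pow, ← map_mul] at this

namespace ImageClosure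

open AffineStrictEmbedding

variable {Y X : LocallyTopRingedSpace.{u}} (f : Y ⟶ X) {A : Type u} [CommRing A]
  [TopologicalSpace A] [IsAdmissibleRing A] {a : Spf A ⟶ X} (ha : IsOpenImmersion a)

/-- The closure of the image of the ring of the chart. -/
abbrev ring : Subring (Y.topSheaf.obj (pre f ha)) := (toPre f ha).range.topologicalClosure

/-- The map to the closure of the image. -/
def toRing : A →+* ring f ha := (toPre f ha).codRestrict (ring f ha) fun c =>
  subset_closure ⟨c, rfl⟩

lemma continuous_toRing : Continuous (toRing f ha) := (continuous_toPre ha).subtype_mk _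

variable {f} (hY : Y.IsFormal) (hc : IsCompact (pre f ha : Set Y.carrier))
include hY hc

lemma isAdmissibleRing_ring : IsAdmissibleRing (ring f ha) := by
  have := hY.isAdmissibleRing hc
  refine IsAdmissibleRing.of_isInducing (ring f ha).subtype IsInducing.subtypeVal
    Subtype.val_injective ?_
  have h : Set.range (ring f ha).subtype = ring f ha := Subtype.range_val
  rw [h]
  exact Subring.isClosed_topologicalClosure _

lemma isTopologicallyNilpotent_ring {b : ring f ha} (hb : b.1 ∈ nilIdeal (pre f ha)) :
    IsTopologicallyNilpotent b :=
  isTopologicallyNilpotent_of_isInducing (ring f ha).subtype IsInducing.subtypeVal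
    ((hY.isIdealOfDefinition_nilIdeal hc).2 _ hb)

lemma isOpen_nilIdeal_ring : IsOpen {b : ring f ha | b.1 ∈ nilIdeal (pre f ha)} :=
  (hY.isIdealOfDefinition_nilIdeal hc).1.preimage continuous_subtype_val

/-- The ideal is open, so the dense image of `A` meets each of its cosets. Thus modulo topologically
nilpotent elements the closure ring is a quotient of `A`, which determines the points of its formal
spectrum. -/
lemma exists_sub_mem_nilIdeal (b : ring f ha) :
    ∃ c : A, b.1 - toPre f ha c ∈ nilIdeal (pre f ha) := by
  obtain ⟨_, ⟨c, rfl⟩, h⟩ := exists_sub_mem_of_mem_closure b.2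
    ((hY.isIdealOfDefinition_nilIdeal hc).1.mem_nhds (Ideal.zero_mem _))
  exact ⟨c, by rw [← neg_sub]; exact neg_mem h⟩

lemma isEmbedding_mapBase [IsAdmissibleRing (ring f ha)] :
    IsEmbedding (Spf.mapBase (toRing f ha) (continuous_toRing f ha)) := by
  refine Spf.isEmbedding_mapBase _ _ fun b => ?_
  obtain ⟨c, h⟩ := exists_sub_mem_nilIdeal ha hY hc b
  refine ⟨c, 1, isUnit_one, fun q => ?_⟩
  rw [one_mul]
  exact Spf.mem_asIdeal_of_isTopologicallyNilpotent q
    (isTopologicallyNilpotent_ring ha hY hc (b := b - toRing f ha c) h)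

/-- The open prime ideal of the sections that vanish at a point. -/
def pointPrime (y : Y.carrier) (hy : y ∈ pre f ha) : SpfTop (ring f ha) :=
  ⟨PrimeSpectrum.comap (ring f ha).subtype (PrimeSpectrum.comap (value hy)
    ⟨⊥, Ideal.isPrime_bot⟩), by
    refine isOpen_ideal_of_le (I := (nilIdeal (pre f ha)).comap (ring f ha).subtype)
      (fun b hb => ?_) (isOpen_nilIdeal_ring ha hY hc)
    change value hy b.1 = 0
    by_contra h
    have h1 := (value_ne_zero_iff hy b.1).mp h
    exact (mem_nilIdeal.mp hb).le h1⟩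

lemma mem_basicOpen_pointPrime (y : Y.carrier) (hy : y ∈ pre f ha) (b : ring f ha) :
    pointPrime ha hY hc y hy ∈ Spf.basicOpen b ↔ y ∈ nonvanishing b.1 :=
  value_ne_zero_iff hy b.1

lemma fn_mapBase_pointPrime (y : Y.carrier) (hy : y ∈ pre f ha) :
    Hom.fn a (Spf.mapBase (toRing f ha) (continuous_toRing f ha) (pointPrime ha hY hc y hy)) =
      Hom.fn f y := by
  obtain ⟨p, -, hp⟩ := hy
  refine Eq.trans (congrArg (Hom.fn a) ?_) hp
  refine Subtype.ext (PrimeSpectrum.ext (Ideal.ext fun c => not_iff_not.mp ?_))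
  exact (value_ne_zero_iff _ _).trans (mem_nonvanishing_toPre ha hp c)

/-- A function of `A` that is nonvanishing only away from the image becomes nowhere invertible on
`Y`, hence topologically nilpotent, and lies in every open prime. -/
lemma fn_mapBase_mem_closure (q : SpfTop (ring f ha)) :
    Hom.fn a (Spf.mapBase (toRing f ha) (continuous_toRing f ha) q) ∈
      closure (Set.range (Hom.fn f)) := by
  by_contra h
  obtain ⟨c, hqc, hcl⟩ := ha.exists_img_basicOpen_le
    (U := ⟨_, isClosed_closure.isOpen_compl⟩) h
  refine hqc (Spf.mem_asIdeal_of_isTopologicallyNilpotent q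
    (isTopologicallyNilpotent_ring ha hY hc (b := toRing f ha c) ?_))
  rw [mem_nilIdeal]
  refine le_bot_iff.mp fun y hy => ?_
  obtain ⟨p, -, hp⟩ := nonvanishing_le _ hy
  have h1 := hcl (ha.fn_mem_img.mpr ((mem_nonvanishing_toPre ha hp c).mp hy))
  exact h1 (subset_closure ⟨y, hp.symm⟩)

/-- The kernel of the surjection from `A` to the quotient by nowhere invertible sections consists of
functions vanishing along the image, hence on its closure. So `p` contains this kernel and lifts to
a prime of the quotient. -/
lemma exists_mapBase_eq {p : SpfTop A} (hp : Hom.fn a p ∈ closure (Set.range (Hom.fn f))) :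
    ∃ q, Spf.mapBase (toRing f ha) (continuous_toRing f ha) q = p := by
  let N : Ideal (ring f ha) := (nilIdeal (pre f ha)).comap (ring f ha).subtype
  let θ : A →+* ring f ha ⧸ N := (Ideal.Quotient.mk N).comp (toRing f ha)
  have hθ : Function.Surjective θ := by
    intro b
    obtain ⟨b, rfl⟩ := Ideal.Quotient.mk_surjective b
    obtain ⟨c, h⟩ := exists_sub_mem_nilIdeal ha hY hc b
    exact ⟨c, (Ideal.Quotient.eq.mpr (show b - toRing f ha c ∈ N from h)).symm⟩
  have h1 : p.1 ∈ PrimeSpectrum.zeroLocus (RingHom.ker θ : Set A) := by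
    intro c hc'
    by_contra h
    obtain ⟨_, h2, y, rfl⟩ := mem_closure_iff.mp hp (ha.img (Spf.D c)) (ha.img (Spf.D c)).isOpen
      (ha.fn_mem_img.mpr h)
    obtain ⟨p', hp'c, hp'⟩ := h2
    have h3 := (mem_nonvanishing_toPre ha hp' c).mpr hp'c
    have h4 : toPre f ha c ∈ nilIdeal (pre f ha) :=
      (Ideal.Quotient.eq_zero_iff_mem.mp
        (show Ideal.Quotient.mk N (toRing f ha c) = 0 from hc') : toRing f ha c ∈ N)
    rw [mem_nilIdeal.mp h4] at h3
    exact h3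
  rw [← range_comap_of_surjective _ θ hθ] at h1
  obtain ⟨q, hq⟩ := h1
  refine ⟨⟨PrimeSpectrum.comap (Ideal.Quotient.mk N) q, ?_⟩, Subtype.ext hq⟩
  refine isOpen_ideal_of_le (I := N) (fun b hb => ?_) (isOpen_nilIdeal_ring ha hY hc)
  change Ideal.Quotient.mk N b ∈ q.asIdeal
  rw [Ideal.Quotient.eq_zero_iff_mem.mpr hb]
  exact Ideal.zero_mem _

end ImageClosure

end LocallyTopRingedSpace

end

end FormalGeometry

/-! ### The structure sheaf of the closure of the image and its charts. -/

namespace FormalGeometry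

noncomputable section

set_option linter.unusedSectionVars false

open LocallyTopRingedSpace

namespace LocallyTopRingedSpace

namespace ImageClosure

open AffineStrictEmbedding

section Sheaf

variable {Y X : LocallyTopRingedSpace.{u}} (f : Y ⟶ X)

/-- The closure of the image. -/
def carrier : TopCat.{u} := TopCat.of (closure (Set.range (Hom.fn f)))

/-- The map to the closure of the image. -/
def base : Y.carrier ⟶ carrier f :=
  TopCat.ofHom ⟨fun y => ⟨Hom.fn f y, subset_closure ⟨y, rfl⟩⟩, (Hom.continuous_fn f).subtype_mk _⟩

/-- The inclusion of the closure of the image. -/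
def incl : carrier f ⟶ X.carrier := TopCat.ofHom ⟨Subtype.val, continuous_subtype_val⟩

lemma isClosedEmbedding_incl : IsClosedEmbedding (incl f) :=
  isClosed_closure.isClosedEmbedding_subtypeVal

lemma denseRange_base : DenseRange (base f) := by
  intro z
  rw [(isClosedEmbedding_incl f).isInducing.closure_eq_preimage_closure_image, Set.mem_preimage,
    ← Set.range_comp]
  exact z.2

/-- The open subset of the closure cut out by an open subset. -/
def inter (V : Opens X.carrier) : Opens (carrier f) := (Opens.map (incl f)).obj V

lemma inter_mono {V V' : Opens X.carrier} (h : V' ≤ V) : inter f V' ≤ inter f V := fun _ hz => h hz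

lemma exists_inter_le {W : Opens (carrier f)} {z : carrier f} (hz : z ∈ W) :
    ∃ V : Opens X.carrier, incl f z ∈ V ∧ inter f V ≤ W := by
  obtain ⟨V, hV, hVW⟩ := (isClosedEmbedding_incl f).isInducing.isOpen_iff.mp W.isOpen
  exact ⟨⟨V, hV⟩, hVW.ge hz, hVW.le⟩

/-- The direct image of the structure sheaf. -/
abbrev direct : TopSheaf (carrier f) := Y.topSheaf.pushforward (base f)

/-- The sections induced by sections of the target. -/
def toDirect (V : Opens X.carrier) : X.topSheaf.obj V →+* (direct f).obj (inter f V) :=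
  Hom.appLE f V ((Opens.map (base f)).obj (inter f V)) le_rfl

lemma continuous_toDirect (V : Opens X.carrier) : Continuous (toDirect f V) :=
  Hom.continuous_appLE f V _ le_rfl

lemma res_toDirect {V V' : Opens X.carrier} (h : V' ≤ V) (s : X.topSheaf.obj V) :
    (direct f).res (inter_mono f h) (toDirect f V s) = toDirect f V' (X.topSheaf.res h s) :=
  (Hom.res_appLE f (V := (Opens.map (base f)).obj (inter f V))
    (V' := (Opens.map (base f)).obj (inter f V')) (fun _ hx => h hx) le_rfl s).trans
    (Hom.appLE_res f h (V := (Opens.map (base f)).obj (inter f V')) le_rfl s).symm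

/-- The closure of the ring of sections induced by sections of the target. -/
def approx (V : Opens X.carrier) : Subring ((direct f).obj (inter f V)) :=
  (toDirect f V).range.topologicalClosure

lemma toDirect_mem_approx (V : Opens X.carrier) (s : X.topSheaf.obj V) :
    toDirect f V s ∈ approx f V := subset_closure ⟨s, rfl⟩

lemma isClosed_approx (V : Opens X.carrier) : IsClosed (approx f V : Set ((direct f).obj (inter f V))) :=
  Subring.isClosed_topologicalClosure _

lemma res_mem_approx {V V' : Opens X.carrier} (h : V' ≤ V) {s : (direct f).obj (inter f V)}
    (hs : s ∈ approx f V) : (direct f).res (inter_mono f h) s ∈ approx f V' := by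
  refine map_mem_closure ((direct f).continuous_res (inter_mono f h)) hs ?_
  rintro _ ⟨r, rfl⟩
  exact ⟨X.topSheaf.res h r, (res_toDirect f h r).symm⟩

lemma exists_common {U : Opens (carrier f)} {s t : (direct f).obj U} {z : carrier f}
    (hs : ∃ (V : Opens X.carrier) (h : inter f V ≤ U),
      incl f z ∈ V ∧ (direct f).res h s ∈ approx f V)
    (ht : ∃ (V : Opens X.carrier) (h : inter f V ≤ U),
      incl f z ∈ V ∧ (direct f).res h t ∈ approx f V) :
    ∃ (V : Opens X.carrier) (h : inter f V ≤ U), incl f z ∈ V ∧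
      (direct f).res h s ∈ approx f V ∧ (direct f).res h t ∈ approx f V := by
  obtain ⟨V, h, hz, hs⟩ := hs
  obtain ⟨V', h', hz', ht⟩ := ht
  refine ⟨V ⊓ V', (inter_mono f inf_le_left).trans h, ⟨hz, hz'⟩, ?_, ?_⟩
  · have := res_mem_approx f (inf_le_left : V ⊓ V' ≤ V) hs
    rwa [TopSheaf.res_res] at this
  · have := res_mem_approx f (inf_le_right : V ⊓ V' ≤ V') ht
    rwa [TopSheaf.res_res] at this

/-- The sections that are locally limits of sections of the target. -/
def sub : (direct f).Sub where
  subring U :=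
    { carrier := {s | ∀ z ∈ U, ∃ (V : Opens X.carrier) (h : inter f V ≤ U),
        incl f z ∈ V ∧ (direct f).res h s ∈ approx f V}
      mul_mem' := by
        intro s t hs ht z hz
        obtain ⟨V, h, hzV, hs, ht⟩ := exists_common f (hs z hz) (ht z hz)
        exact ⟨V, h, hzV, by rw [map_mul]; exact mul_mem hs ht⟩
      one_mem' := by
        intro z hz
        obtain ⟨V, hzV, hV⟩ := exists_inter_le f hz
        exact ⟨V, hV, hzV, by rw [map_one]; exact one_mem _⟩
      add_mem' := by
        intro s t hs ht z hz
        obtain ⟨V, h, hzV, hs, ht⟩ := exists_common f (hs z hz) (ht z hz)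
        exact ⟨V, h, hzV, by rw [map_add]; exact add_mem hs ht⟩
      zero_mem' := by
        intro z hz
        obtain ⟨V, hzV, hV⟩ := exists_inter_le f hz
        exact ⟨V, hV, hzV, by rw [map_zero]; exact zero_mem _⟩
      neg_mem' := by
        intro s hs z hz
        obtain ⟨V, h, hzV, hs⟩ := hs z hz
        exact ⟨V, h, hzV, by rw [map_neg]; exact neg_mem hs⟩ }
  res_mem {U W} h s hs := by
    intro z hz
    obtain ⟨V, hV, hzV, hs⟩ := hs z (h hz)
    obtain ⟨V', hzV', hV'⟩ := exists_inter_le f hz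
    refine ⟨V ⊓ V', (inter_mono f inf_le_right).trans hV', ⟨hzV, hzV'⟩, ?_⟩
    have := res_mem_approx f (inf_le_left : V ⊓ V' ≤ V) hs
    rw [TopSheaf.res_res] at this ⊢
    exact this
  mem_of_local {U} s hs := by
    intro z hz
    obtain ⟨W, h, hzW, hW⟩ := hs z hz
    obtain ⟨V, hV, hzV, hs⟩ := hW z hzW
    refine ⟨V, hV.trans h, hzV, ?_⟩
    rw [TopSheaf.res_res] at hs
    exact hs

lemma mem_sub_of_mem_approx {V : Opens X.carrier} {s : (direct f).obj (inter f V)}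
    (hs : s ∈ approx f V) : s ∈ (sub f).subring (inter f V) :=
  fun _ hz => ⟨V, le_rfl, hz, by rw [TopSheaf.res_refl]; exact hs⟩

end Sheaf

section Chart

variable {Y X : LocallyTopRingedSpace.{u}} {f : Y ⟶ X} {A : Type u} [CommRing A]
  [TopologicalSpace A] [IsAdmissibleRing A] {a : Spf A ⟶ X} (ha : IsOpenImmersion a)
  (hY : Y.IsFormal) (hc : IsCompact (pre f ha : Set Y.carrier)) [IsAdmissibleRing (ring f ha)]

/-- The underlying map of the chart. -/
def chartBase : SpfTop (ring f ha) ⟶ carrier f :=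
  TopCat.ofHom ⟨fun q => ⟨Hom.fn a (Spf.mapBase (toRing f ha) (continuous_toRing f ha) q),
    fn_mapBase_mem_closure ha hY hc q⟩, ((Hom.continuous_fn a).comp (Spf.mapBase (toRing f ha)
      (continuous_toRing f ha)).hom.continuous).subtype_mk _⟩

lemma exists_chartBase_eq {p : SpfTop A} {z : carrier f} (hp : Hom.fn a p = incl f z) :
    ∃ q, Spf.mapBase (toRing f ha) (continuous_toRing f ha) q = p ∧ chartBase ha hY hc q = z := by
  obtain ⟨q, rfl⟩ := exists_mapBase_eq ha hY hc (p := p) (by rw [hp]; exact z.2)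
  exact ⟨q, rfl, (isClosedEmbedding_incl f).injective hp⟩

lemma isOpenEmbedding_chartBase : IsOpenEmbedding (chartBase ha hY hc) := by
  refine ⟨IsEmbedding.of_comp (chartBase ha hY hc).hom.continuous (incl f).hom.continuous
    (ha.isOpenEmbedding.isEmbedding.comp (isEmbedding_mapBase ha hY hc)), ?_⟩
  have h : Set.range (chartBase ha hY hc) = inter f (ha.img ⊤) := by
    ext z
    refine ⟨?_, ?_⟩
    · rintro ⟨q, rfl⟩
      exact ha.fn_mem_img.mpr trivial
    · rintro ⟨p, -, hp⟩
      obtain ⟨q, -, hq⟩ := exists_chartBase_eq ha hY hc hp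
      exact ⟨q, hq⟩
  rw [h]
  exact (inter f (ha.img ⊤)).isOpen

/-- The image of an open subset under the chart. -/
abbrev chartImg (U : Opens (SpfTop (ring f ha))) : Opens (carrier f) :=
  (isOpenEmbedding_chartBase ha hY hc).functor.obj U

lemma chartImg_toRing (c : A) :
    chartImg ha hY hc (Spf.basicOpen (toRing f ha c)) = inter f (ha.img (Spf.D c)) := by
  ext z
  refine ⟨?_, ?_⟩
  · rintro ⟨q, hq, rfl⟩
    exact ha.fn_mem_img.mpr hq
  · rintro ⟨p, hpc, hp⟩
    obtain ⟨q, rfl, hq⟩ := exists_chartBase_eq ha hY hc hp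
    exact ⟨q, hpc, hq⟩

lemma map_chartImg_le (U : Opens (SpfTop (ring f ha))) :
    (Opens.map (base f)).obj (chartImg ha hY hc U) ≤ pre f ha := by
  rintro y ⟨q, -, hq⟩
  exact ⟨_, trivial, congrArg (incl f) hq⟩

lemma map_chartImg_basicOpen (b : ring f ha) :
    (Opens.map (base f)).obj (chartImg ha hY hc (Spf.basicOpen b)) = nonvanishing b.1 := by
  ext y
  refine ⟨?_, fun hy => ?_⟩
  · rintro ⟨q, hq, hqy⟩
    have hy : y ∈ pre f ha := ⟨_, trivial, congrArg (incl f) hqy⟩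
    -- The chart is injective, so the prime of sections vanishing at `y` is the only point of the
    -- chart at the image of `y`.
    have e : pointPrime ha hY hc y hy = q := by
      refine (isOpenEmbedding_chartBase ha hY hc).injective (Eq.trans ?_ hqy.symm)
      exact (isClosedEmbedding_incl f).injective (fn_mapBase_pointPrime ha hY hc y hy)
    rw [← e] at hq
    exact (mem_basicOpen_pointPrime ha hY hc y hy b).mp hq
  · have hy' : y ∈ pre f ha := nonvanishing_le _ hy
    exact ⟨pointPrime ha hY hc y hy', (mem_basicOpen_pointPrime ha hY hc y hy' b).mpr hy,
      (isClosedEmbedding_incl f).injective (fn_mapBase_pointPrime ha hY hc y hy')⟩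

/-- The direct image on the chart. -/
abbrev chartSheaf : TopSheaf (SpfTop (ring f ha)) :=
  (direct f).restrict (isOpenEmbedding_chartBase ha hY hc)

/-- The sections given by elements of the ring of the chart. -/
def chartHom : ring f ha →+* (chartSheaf ha hY hc).obj ⊤ :=
  (Y.topSheaf.res (map_chartImg_le ha hY hc ⊤)).comp (ring f ha).subtype

lemma res_chartHom (U : Opens (SpfTop (ring f ha))) (b : ring f ha) :
    (chartSheaf ha hY hc).res (le_top : U ≤ ⊤) (chartHom ha hY hc b) =
      Y.topSheaf.res (map_chartImg_le ha hY hc U) b.1 :=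
  Y.topSheaf.res_res (map_chartImg_le ha hY hc ⊤)
    (V := (Opens.map (base f)).obj (chartImg ha hY hc ⊤))
    (W := (Opens.map (base f)).obj (chartImg ha hY hc U))
    (((Opens.map (base f)).map ((isOpenEmbedding_chartBase ha hY hc).functor.map
      (homOfLE (le_top : U ≤ ⊤)))).le) b.1

/-- The preimage in `Y` of `basicOpen b` is the locus where the section `b` is invertible.
Completeness comes from `Y` being formal, the comparison of topologies from
`IsFormal.exists_nhds_pow_mul_mem`. -/
lemma isChart_chartHom : Spf.IsChart (chartSheaf ha hY hc) (chartHom ha hY hc) where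
  continuous := (Y.topSheaf.continuous_res (map_chartImg_le ha hY hc ⊤)).comp continuous_subtype_val
  isUnit b := by
    rw [res_chartHom]
    refine isUnit_of_le_nonvanishing ?_
    rw [nonvanishing_res]
    exact le_inf le_rfl (map_chartImg_basicOpen ha hY hc b).le
  complete b := hY.isCompleteLinear ((Opens.map (base f)).obj (chartImg ha hY hc (Spf.basicOpen b)))
  exists_nhds b I := by
    have h1 : (I.1 : Set (ring f ha)) ∈ 𝓝 (0 : ring f ha) := I.2.mem_nhds (Ideal.zero_mem _)
    rw [IsInducing.subtypeVal.nhds_eq_comap] at h1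
    obtain ⟨M, hM, hMI⟩ := Filter.mem_comap.mp h1
    obtain ⟨N, hN, h2⟩ := hY.exists_nhds_pow_mul_mem hc b.1 hM
    have e := map_chartImg_basicOpen ha hY hc b
    have h3 : Y.topSheaf.res e.ge ⁻¹' N ∈
        𝓝 (0 : Y.topSheaf.obj ((Opens.map (base f)).obj (chartImg ha hY hc (Spf.basicOpen b)))) := by
      refine (Y.topSheaf.continuous_res e.ge).continuousAt.preimage_mem_nhds ?_
      rw [map_zero]
      exact hN
    refine ⟨Y.topSheaf.res e.ge ⁻¹' N, h3, fun c hcN => ?_⟩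
    rw [res_chartHom] at hcN
    have h4 : Y.topSheaf.res (nonvanishing_le b.1) c.1 ∈ N := by
      have h5 : Y.topSheaf.res e.ge (Y.topSheaf.res (map_chartImg_le ha hY hc _) c.1) ∈ N := hcN
      rwa [TopSheaf.res_res] at h5
    obtain ⟨k, hk⟩ := h2 c.1 h4
    exact ⟨k, hMI hk⟩

lemma res_mem_approx_chart (c : A) (b : ring f ha) :
    (direct f).res (chartImg_toRing ha hY hc c).ge ((chartSheaf ha hY hc).res
      (le_top : Spf.basicOpen (toRing f ha c) ≤ ⊤) (chartHom ha hY hc b)) ∈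
      approx f (ha.img (Spf.D c)) := by
  rw [res_chartHom]
  have hle : (Opens.map (base f)).obj (inter f (ha.img (Spf.D c))) ≤ pre f ha :=
    fun y hy => ha.img_mono le_top hy
  have h1 : Y.topSheaf.res hle b.1 ∈ closure (Set.range (toDirect f (ha.img (Spf.D c)))) := by
    refine map_mem_closure (Y.topSheaf.continuous_res hle) b.2 ?_
    rintro _ ⟨d, rfl⟩
    refine ⟨ha.ofChart (Spf.D c) d, ?_⟩
    rw [← ha.res_ofChart (le_top : Spf.D c ≤ ⊤), ← res_toDirect]
    rfl
  refine (congrArg (· ∈ approx f (ha.img (Spf.D c))) ?_).mp h1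
  exact (Y.topSheaf.res_res (map_chartImg_le ha hY hc _) (fun y hy =>
    (chartImg_toRing ha hY hc c).ge hy) b.1).symm

lemma res_chartHom_toRing (c d : A) :
    (direct f).res (chartImg_toRing ha hY hc c).ge ((chartSheaf ha hY hc).res
      (le_top : Spf.basicOpen (toRing f ha c) ≤ ⊤) (chartHom ha hY hc (toRing f ha d))) =
      toDirect f (ha.img (Spf.D c)) (ha.ofChart (Spf.D c) d) := by
  rw [res_chartHom, ← ha.res_ofChart (le_top : Spf.D c ≤ ⊤), ← res_toDirect]
  exact Y.topSheaf.res_res (map_chartImg_le ha hY hc _) (fun y hy =>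
    (chartImg_toRing ha hY hc c).ge hy) _

include hY hc in
-- The points embed into `Spf A`, so the basic open subsets given by elements of `A` form a basis.
-- Only over these can sections be compared directly with sections of `X`.
lemma exists_basicOpen_toRing_le {U : Opens (SpfTop (ring f ha))} {q : SpfTop (ring f ha)}
    (hq : q ∈ U) : ∃ c : A, q ∈ Spf.basicOpen (toRing f ha c) ∧
      Spf.basicOpen (toRing f ha c) ≤ U := by
  obtain ⟨V, hV, hVU⟩ := (isEmbedding_mapBase ha hY hc).isInducing.isOpen_iff.mp U.isOpen
  obtain ⟨c, hc1, hc2⟩ := Spf.exists_basicOpen_le (U := ⟨V, hV⟩)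
    (p := Spf.mapBase (toRing f ha) (continuous_toRing f ha) q) (hVU.ge hq)
  exact ⟨c, hc1, fun r hr => hVU.le (hc2 hr)⟩

lemma pow_mul_map_mem {R S : Type*} [CommRing R] [CommRing S] (ρ : R →+* S) {P : Subring S}
    {v w : R} {v' : S} {m : ℕ} (hv : ρ v = v') (h : ρ (v ^ m * w) ∈ P) : v' ^ m * ρ w ∈ P := by
  rwa [← hv, ← map_pow, ← map_mul]

/-- Sections over the basic open subset of `c` are limits of fractions. Their numerators are limits
of sections of `X`, and `c` is already invertible in the sections of `X` over its basic open subset,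
so the fractions lie in the closed subring `approx`. -/
lemma thetaHom_mem_sub (U : Opens (SpfTop (ring f ha))) (s : Spf.sections U) :
    (isChart_chartHom ha hY hc).ThetaHom U s ∈ (sub f).subring (chartImg ha hY hc U) := by
  rintro _ ⟨q, hq, rfl⟩
  obtain ⟨c, hqc, hcU⟩ := exists_basicOpen_toRing_le ha hY hc hq
  have hle : inter f (ha.img (Spf.D c)) ≤ chartImg ha hY hc U :=
    (chartImg_toRing ha hY hc c).ge.trans
      ((isOpenEmbedding_chartBase ha hY hc).functor.map (homOfLE hcU)).le
  refine ⟨ha.img (Spf.D c), hle, ha.fn_mem_img.mpr hqc, ?_⟩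
  have h1 := (isChart_chartHom ha hY hc).res_ThetaHom_mem_closure s (toRing f ha c) hcU
  have h2 := map_mem_closure ((direct f).continuous_res (chartImg_toRing ha hY hc c).ge) h1
    (t := approx f (ha.img (Spf.D c))) (by
      rintro w ⟨d, m, hw⟩
      have h3 := res_mem_approx_chart ha hY hc c d
      rw [← hw] at h3
      obtain ⟨v, hv⟩ := (ha.isUnit_ofChart c).exists_left_inv
      have h4 : toDirect f (ha.img (Spf.D c)) (ha.ofChart (Spf.D c) c) ^ m *
          (direct f).res (chartImg_toRing ha hY hc c).ge w ∈ approx f (ha.img (Spf.D c)) := by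
        exact pow_mul_map_mem ((direct f).res (chartImg_toRing ha hY hc c).ge)
          (res_chartHom_toRing ha hY hc c c) h3
      -- The inverse `v` of `c` is a section of `X`; multiplying by the pullback of `v ^ m` cancels
      -- the denominator without leaving `approx`.
      have h5 := mul_mem (pow_mem (toDirect_mem_approx f (ha.img (Spf.D c)) v) m) h4
      rw [← mul_assoc, ← mul_pow, ← map_mul, hv, map_one, one_pow, one_mul] at h5
      exact h5)
  rw [(isClosed_approx f _).closure_eq] at h2
  refine (congrArg (· ∈ approx f (ha.img (Spf.D c))) ?_).mp h2
  exact (direct f).res_res _ _ _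

/-- Conversely, a local limit of sections of `X` is a limit of fractions, since each section of `X`
over a basic open subset of the chart is such a limit. -/
lemma exists_mem_closure_fractions (U : Opens (SpfTop (ring f ha)))
    (y : (chartSheaf ha hY hc).obj U) (hy : y ∈ (sub f).subring (chartImg ha hY hc U))
    (q : SpfTop (ring f ha)) (hq : q ∈ U) :
    ∃ (b : ring f ha) (hb : Spf.basicOpen b ≤ U), q ∈ Spf.basicOpen b ∧
      (chartSheaf ha hY hc).res hb y ∈ closure
        (Spf.IsChart.fractions (chartSheaf ha hY hc) (chartHom ha hY hc) b) := by
  obtain ⟨V, hV, hqV, hs⟩ := hy (chartBase ha hY hc q) ⟨q, hq, rfl⟩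
  obtain ⟨c, hqc, hcV⟩ := ha.exists_img_basicOpen_le (U := V)
    (p := Spf.mapBase (toRing f ha) (continuous_toRing f ha) q) hqV
  have hcU : Spf.basicOpen (toRing f ha c) ≤ U := by
    intro r hr
    obtain ⟨r', hr', e⟩ := hV (inter_mono f hcV ((chartImg_toRing ha hY hc c).le ⟨r, hr, rfl⟩))
    exact (isOpenEmbedding_chartBase ha hY hc).injective e ▸ hr'
  refine ⟨toRing f ha c, hcU, hqc, ?_⟩
  have h1 := res_mem_approx f hcV hs
  have key (d : A) : (direct f).res (chartImg_toRing ha hY hc c).le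
      (toDirect f (ha.img (Spf.D c)) (ha.ofChart (Spf.D c) d)) = (chartSheaf ha hY hc).res
      (le_top : Spf.basicOpen (toRing f ha c) ≤ ⊤) (chartHom ha hY hc (toRing f ha d)) := by
    rw [← res_chartHom_toRing ha hY hc c d]
    exact ((direct f).res_res (chartImg_toRing ha hY hc c).ge (chartImg_toRing ha hY hc c).le
      _).trans ((direct f).res_refl _)
  have h2 (r : X.topSheaf.obj (ha.img (Spf.D c))) : (direct f).res (chartImg_toRing ha hY hc c).le
      (toDirect f (ha.img (Spf.D c)) r) ∈ closure
        (Spf.IsChart.fractions (chartSheaf ha hY hc) (chartHom ha hY hc) (toRing f ha c)) := by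
    have hcont : Continuous fun r => (direct f).res (chartImg_toRing ha hY hc c).le
        (toDirect f (ha.img (Spf.D c)) r) :=
      ((direct f).continuous_res (chartImg_toRing ha hY hc c).le).comp (continuous_toDirect f _)
    have h := map_mem_closure hcont (ha.mem_closure_fractions c r)
      (t := Spf.IsChart.fractions (chartSheaf ha hY hc) (chartHom ha hY hc) (toRing f ha c)) (by
        rintro w ⟨d, m, hw⟩
        refine ⟨toRing f ha d, m, ?_⟩
        rw [← key, ← key, ← hw, map_mul, map_mul, map_pow, map_pow]
        rfl)
    exact h
  have h3 := map_mem_closure ((direct f).continuous_res (chartImg_toRing ha hY hc c).le) h1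
    (t := closure (Spf.IsChart.fractions (chartSheaf ha hY hc) (chartHom ha hY hc)
      (toRing f ha c))) (by
      rintro _ ⟨r, rfl⟩
      exact h2 r)
  rw [closure_closure] at h3
  refine (congrArg (· ∈ closure _) ?_).mp h3
  exact (congrArg _ ((direct f).res_res hV (inter_mono f hcV) y)).trans
    ((direct f).res_res ((inter_mono f hcV).trans hV) (chartImg_toRing ha hY hc c).le y)

/-- The chart. -/
def openIso : TopSheaf.OpenIso (Spf (ring f ha)).topSheaf (sub f).toTopSheaf :=
  (isChart_chartHom ha hY hc).openIsoSub (sub f) (thetaHom_mem_sub ha hY hc)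
    (exists_mem_closure_fractions ha hY hc)

end Chart

end ImageClosure

end LocallyTopRingedSpace

end

end FormalGeometry

/-! ### The closure as a formal scheme, and morphisms out of it. -/

namespace FormalGeometry

noncomputable section

set_option linter.unusedSectionVars false

open LocallyTopRingedSpace

namespace LocallyTopRingedSpace

namespace ImageClosure

open AffineStrictEmbedding

variable {Y X : LocallyTopRingedSpace.{u}} (f : Y ⟶ X)

/-- The conditions under which the closure of the image is a formal scheme. -/
structure IsAdmissible : Prop where
  source : Y.IsFormal
  target : X.IsFormal
  isCompact : ∀ U : Opens X.carrier, IsCompact (U : Set X.carrier) →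
    IsCompact ((Opens.map f.toLRSHom.base).obj U : Set Y.carrier)

variable {f} (hf : IsAdmissible f)
include hf

lemma IsAdmissible.isCompact_pre {A : Type u} [CommRing A] [TopologicalSpace A]
    [IsAdmissibleRing A] {a : Spf A ⟶ X} (ha : IsOpenImmersion a) :
    IsCompact (pre f ha : Set Y.carrier) :=
  hf.isCompact _ (ha.isCompact_img (U := ⊤) (Spf.isCompact_top (A := A)))

lemma isLocalRing_stalk (z : carrier f) :
    IsLocalRing ((sub f).toTopSheaf.presheaf.stalk z) := by
  obtain ⟨A, _, _, _, a, ha, p, hp⟩ := hf.target (incl f z)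
  have hc := hf.isCompact_pre ha
  have := isAdmissibleRing_ring ha hf.source hc
  obtain ⟨q, -, hq⟩ := exists_chartBase_eq ha hf.source hc hp
  have h := (openIso ha hf.source hc).isLocalRing_stalk (Spf (ring f ha)).isLocalRing q
  exact hq ▸ h

/-- The closure of the image. -/
def space : LocallyTopRingedSpace.{u} := ofTopSheaf (sub f).toTopSheaf (isLocalRing_stalk hf)

lemma isFormal_space : (space hf).IsFormal := by
  intro z
  obtain ⟨A, _, _, _, a, ha, p, hp⟩ := hf.target (incl f z)
  have hc := hf.isCompact_pre ha
  have := isAdmissibleRing_ring ha hf.source hc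
  obtain ⟨q, -, hq⟩ := exists_chartBase_eq ha hf.source hc hp
  exact ⟨ring f ha, _, _, inferInstance,
    homOfOpenIso (T := Spf (ring f ha)) (X := space hf) (openIso ha hf.source hc),
    isOpenImmersion_homOfOpenIso (T := Spf (ring f ha)) (X := space hf)
      (openIso ha hf.source hc), q, hq⟩

/-- A section of the closure of the image as a section of the source. -/
def secVal (W : Opens (space hf).carrier) :
    (space hf).topSheaf.obj W →+* Y.topSheaf.obj ((Opens.map (base f)).obj W) :=
  ((sub f).subring W).subtype

lemma isInducing_secVal (W : Opens (space hf).carrier) : IsInducing (secVal hf W) :=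
  IsInducing.subtypeVal

lemma injective_secVal (W : Opens (space hf).carrier) : Function.Injective (secVal hf W) :=
  Subtype.val_injective

section Desc

variable {T : LocallyTopRingedSpace.{u}} {g : T ⟶ X} {h : Y ⟶ T} (hg : h ≫ g = f)
  {k : carrier f ⟶ T.carrier} (hk : ∀ y, k (base f y) = Hom.fn h y)
  (hgk : ∀ z, Hom.fn g (k z) = incl f z)

omit hf in
include hk in
lemma map_base_le (W : Opens T.carrier) : (Opens.map (base f)).obj ((Opens.map k).obj W) ≤
    (Opens.map h.toLRSHom.base).obj W := by
  intro y hy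
  change Hom.fn h y ∈ W
  rw [← hk]
  exact hy

/-- The pullback of sections to the direct image. -/
def descDirect (hk : ∀ y, k (base f y) = Hom.fn h y) (W : Opens T.carrier) :
    T.topSheaf.obj W →+* (direct f).obj ((Opens.map k).obj W) :=
  Hom.appLE h W ((Opens.map (base f)).obj ((Opens.map k).obj W)) (map_base_le hk W)

variable (hm : ∀ (W : Opens T.carrier) (t : T.topSheaf.obj W),
  descDirect hk W t ∈ (sub f).subring ((Opens.map k).obj W))

/-- The pullback of sections. -/
def descApp (W : Opens T.carrier) :
    T.topSheaf.obj W →+* (space hf).topSheaf.obj ((Opens.map k).obj W) :=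
  (descDirect hk W).codRestrict ((sub f).subring ((Opens.map k).obj W)) (hm W)

include hg hgk in
-- Locality is delicate at points of the closure outside the image. An inverse of the pulled-back
-- `t` is approximated by a section `r` of `X`. If `t` were not invertible at `k z`, then `1 - t *
-- r` would be invertible near `k z`, hence at some point coming from `Y`; but its pullback to `Y`
-- is nowhere invertible.
lemma mem_nonvanishing_of_descApp (W : Opens T.carrier) (t : T.topSheaf.obj W) (z : carrier f)
    (hz : z ∈ nonvanishing (T := space hf) (descApp hf hk hm W t)) : k z ∈ nonvanishing t := by
  let W₀ : Opens (space hf).carrier := nonvanishing (T := space hf) (descApp hf hk hm W t)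
  have hW₀W : W₀ ≤ (Opens.map k).obj W := nonvanishing_le (T := space hf) _
  obtain ⟨s, hs⟩ : ∃ s : (space hf).topSheaf.obj W₀,
      (space hf).topSheaf.res hW₀W (descApp hf hk hm W t) * s = 1 :=
    (isUnit_res_nonvanishing (T := space hf) (descApp hf hk hm W t)).exists_right_inv
  obtain ⟨V, hV, hzV, hsV⟩ := s.2 z hz
  -- A quasi-compact neighbourhood makes the nowhere invertible sections over its preimage an open
  -- ideal, so a limit agrees modulo it with a section of `X`.
  obtain ⟨V', hV'V, hzV', hV'c, -⟩ := hf.target.exists_nhds hzV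
  have hV' : inter f V' ≤ W₀ := (inter_mono f hV'V).trans hV
  let D : Opens Y.carrier := (Opens.map (base f)).obj (inter f V')
  have hD : D ≤ (Opens.map (base f)).obj W₀ := fun _ hy => hV' hy
  have hopen : IsOpen (nilIdeal D : Set (Y.topSheaf.obj D)) :=
    (hf.source.isIdealOfDefinition_nilIdeal (hf.isCompact V' hV'c)).1
  obtain ⟨_, ⟨r, rfl⟩, hr⟩ := exists_sub_mem_of_mem_closure (res_mem_approx f hV'V hsV)
    (hopen.mem_nhds (Ideal.zero_mem _))
  obtain ⟨σ, hσ⟩ : ∃ σ : Y.topSheaf.obj D, σ = Y.topSheaf.res hD (secVal hf W₀ s) := ⟨_, rfl⟩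
  obtain ⟨τ, hτ⟩ : ∃ τ : Y.topSheaf.obj D,
    τ = Y.topSheaf.res (hD.trans fun _ hy => hW₀W hy)
      (Hom.appLE h W ((Opens.map (base f)).obj ((Opens.map k).obj W)) (map_base_le hk W) t) := ⟨_, rfl⟩
  obtain ⟨ρ, hρ⟩ : ∃ ρ : Y.topSheaf.obj D, ρ = toDirect f V' r := ⟨_, rfl⟩
  replace hr : ρ - σ ∈ nilIdeal D := by
    have e : (direct f).res (inter_mono f hV'V) ((direct f).res hV (secVal hf W₀ s)) = σ :=
      ((direct f).res_res _ _ _).trans hσ.symm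
    rw [hρ, ← e]
    exact hr
  have hst : τ * σ = 1 := by
    have h1 := congrArg (fun x => Y.topSheaf.res hD (secVal hf W₀ x)) hs
    simp only [map_mul, map_one] at h1
    rw [hσ, hτ]
    refine Eq.trans (congrArg (· * _) ?_) h1
    exact (Y.topSheaf.res_res (V := (Opens.map (base f)).obj W₀) (fun _ hy => hW₀W hy) hD _).symm
  let N : Opens T.carrier := W ⊓ (Opens.map g.toLRSHom.base).obj V'
  let u : T.topSheaf.obj N := T.topSheaf.res inf_le_left t *
    Hom.appLE g V' N inf_le_right r
  have hkzN : k z ∈ N := ⟨hW₀W hz, by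
    change Hom.fn g (k z) ∈ V'
    rw [hgk]
    exact hzV'⟩
  by_contra hkz
  -- As `t` is not invertible at `k z`, neither is its multiple `u`, so in the local ring there `1 -
  -- u` is.
  have h1 : k z ∈ nonvanishing (1 - u) := by
    have h2 : k z ∈ nonvanishing (u + (1 - u)) := by
      rw [add_sub_cancel, nonvanishing_one]
      exact hkzN
    refine (mem_nonvanishing_or h2).resolve_left fun h3 => hkz ?_
    have h4 := (nonvanishing_mul _ _).le h3
    exact ((nonvanishing_res _ _).le h4.1).2
  -- The locus where `1 - u` is invertible is open, so its preimage in the closure meets the dense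
  -- image of `Y`.
  obtain ⟨_, h5, y, rfl⟩ := mem_closure_iff.mp (denseRange_base f z)
    ((Opens.map k).obj (nonvanishing (1 - u))) ((Opens.map k).obj _).isOpen h1
  have hyN : Hom.fn h y ∈ nonvanishing (1 - u) := by
    rw [← hk]
    exact h5
  let M : Opens Y.carrier := D ⊓ (Opens.map h.toLRSHom.base).obj N
  have hyM : y ∈ M := by
    have h6 := nonvanishing_le _ hyN
    refine ⟨?_, h6⟩
    have h7 : Hom.fn (h ≫ g) y ∈ V' := h6.2
    rw [hg] at h7
    exact h7
  have h8 := (Hom.mem_nonvanishing_appLE h (V := M) inf_le_right (1 - u) hyM).mpr hyN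
  have h9 : Hom.appLE h N M inf_le_right (1 - u) ∈ nilIdeal M := by
    have e1 : Hom.appLE h N M inf_le_right (T.topSheaf.res inf_le_left t) =
        Y.topSheaf.res inf_le_left τ := by
      rw [Hom.appLE_res, hτ]
      exact ((congrArg _ (Hom.res_appLE h (V' := D)
        (fun y hy => (hV'.trans hW₀W) hy) (map_base_le hk W) t)).trans
        (Hom.res_appLE h (V' := M) inf_le_left _ t)).symm
    have e2 : Hom.appLE h N M inf_le_right (Hom.appLE g V' N inf_le_right r) =
        Y.topSheaf.res inf_le_left ρ := by
      subst hg hρ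
      rw [← Hom.comp_appLE]
      exact (Hom.res_appLE (h ≫ g) (V := D) _ _ r).symm
    -- With `τ * σ = 1` one has `1 - τ * ρ = -τ * (ρ - σ)`, a multiple of a nowhere invertible
    -- section.
    have e3 : Hom.appLE h N M inf_le_right (1 - u) =
        Y.topSheaf.res (inf_le_left : M ≤ D) (-τ * (ρ - σ)) := by
      rw [map_sub, map_one, map_mul, e1, e2, ← map_mul, mul_sub, neg_mul, neg_mul, hst,
        ← map_one (Y.topSheaf.res (inf_le_left : M ≤ D)), ← map_sub, sub_neg_eq_add, neg_add_eq_sub]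
    rw [e3, mem_nilIdeal, nonvanishing_res, mem_nilIdeal.mp (Ideal.mul_mem_left _ _ hr), inf_bot_eq]
  exact (mem_nilIdeal.mp h9).le h8

/-- The morphism from the closure of the image given by a map of spaces. -/
def desc : space hf ⟶ T :=
  homMk (X := space hf) k (descApp hf hk hm)
    (fun W W' hW t => Subtype.ext ((Hom.appLE_res h hW (map_base_le hk W') t).trans
      (Hom.res_appLE h (V := (Opens.map (base f)).obj ((Opens.map k).obj W))
        (V' := (Opens.map (base f)).obj ((Opens.map k).obj W')) (fun _ hy => hW hy)
        (map_base_le hk W) t).symm))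
    (fun W => (Hom.continuous_appLE h W _ (map_base_le hk W)).subtype_mk (hm W))
    (mem_nonvanishing_of_descApp hf hg hk hgk hm)

lemma secVal_desc_appLE (W : Opens T.carrier) (W' : Opens (space hf).carrier)
    (hW' : W' ≤ (Opens.map (desc hf hg hk hgk hm).toLRSHom.base).obj W)
    (hW'' : (Opens.map (base f)).obj W' ≤ (Opens.map h.toLRSHom.base).obj W)
    (t : T.topSheaf.obj W) : secVal hf W' (Hom.appLE (desc hf hg hk hgk hm) W W' hW' t) =
      Hom.appLE h W ((Opens.map (base f)).obj W') hW'' t :=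
  Hom.res_appLE h (V := (Opens.map (base f)).obj ((Opens.map k).obj W))
    (V' := (Opens.map (base f)).obj W') (fun _ hy => hW' hy) (map_base_le hk W) t

end Desc

end ImageClosure

end LocallyTopRingedSpace

end

end FormalGeometry

/-! ### The universal property of the closure, and the source as an open subspace. -/

namespace FormalGeometry

noncomputable section

set_option linter.unusedSectionVars false

open LocallyTopRingedSpace

namespace LocallyTopRingedSpace

open AffineStrictEmbedding

namespace IsPseudoImmersion

variable {Z X : LocallyTopRingedSpace.{u}} {g : Z ⟶ X} (hg : IsPseudoImmersion g)
  (hZ : Z.IsFormal) (hX : X.IsFormal)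
include hg hZ hX

/-- Locally, every section of the source of a pseudo-immersion is a limit of sections of the
target. -/
lemma exists_approx {W : Opens Z.carrier} {z : Z.carrier} (hz : z ∈ W) :
    ∃ V : Opens X.carrier, Hom.fn g z ∈ V ∧ (Opens.map g.toLRSHom.base).obj V ≤ W ∧
      closure (Set.range (Hom.fn g)) ∩ V ⊆ Set.range (Hom.fn g) ∧
      DenseRange (Hom.appLE g V ((Opens.map g.toLRSHom.base).obj V) le_rfl) := by
  obtain ⟨C, _, _, _, c, hc, hzc, hcW⟩ := hZ.exists_affine_subset hz
  -- The chart of `X` is chosen inside `N ∩ N'`: in `N` so that its preimage lies in the chart `c`,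
  -- in `N'` so that the image of `g` is closed over it.
  obtain ⟨N, hN, hNc⟩ := (hg.isEmbedding hZ).isInducing.isOpen_iff.mp hc.isOpenEmbedding.isOpen_range
  obtain ⟨N', F, hN', hF, hNF⟩ := hg.isLocallyClosed hZ
  have hzN' : Hom.fn g z ∈ N' := (hNF.le ⟨z, rfl⟩).1
  obtain ⟨A, _, _, _, a, ha, hza, haN⟩ := hX.exists_affine_subset
    (U := (⟨N, hN⟩ : Opens X.carrier) ⊓ ⟨N', hN'⟩) (x := Hom.fn g z) ⟨hNc.ge hzc, hzN'⟩
  have hac : Hom.fn g ⁻¹' Set.range (Hom.fn a) ⊆ Set.range (Hom.fn c) :=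
    fun x hx => hNc.le (haN hx).1
  have hcl : closure (Set.range (Hom.fn g)) ∩ Set.range (Hom.fn a) ⊆ Set.range (Hom.fn g) := by
    rintro x ⟨hx, hxa⟩
    refine hNF.ge ⟨(haN hxa).2, ?_⟩
    exact closure_minimal (hNF.le.trans Set.inter_subset_right) hF hx
  refine ⟨ha.img ⊤, ?_, fun x hx => hcW (hac (ha.img_subset_range _ hx)), ?_, ?_⟩
  · obtain ⟨p, hp⟩ := hza
    exact hp ▸ ha.fn_mem_img.mpr trivial
  · exact fun x hx => hcl ⟨hx.1, ha.img_subset_range _ hx.2⟩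
  · refine (hg.denseRange_toPre hZ ha hc hac hcl).mono ?_
    rintro _ ⟨x, rfl⟩
    exact ⟨_, rfl⟩

/-- A pseudo-immersion has no nontrivial endomorphisms. -/
lemma eq_id {e : Z ⟶ Z} (he : e ≫ g = g) : e = 𝟙 Z := by
  have hinj := (hg.isEmbedding hZ).injective
  have hfn (z : Z.carrier) : Hom.fn e z = z := hinj (congrArg (fun h => Hom.fn h z) he)
  refine Hom.ext' hfn fun U z hz s => ?_
  obtain ⟨V, hzV, hVU, -, hd⟩ := hg.exists_approx hZ hX hz
  let N : Opens Z.carrier := (Opens.map g.toLRSHom.base).obj V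
  have hNe : N ≤ (Opens.map e.toLRSHom.base).obj N := fun x hx => by
    change Hom.fn e x ∈ N
    rw [hfn]
    exact hx
  refine ⟨N, fun x hx => hVU (hNe hx), hVU, ?_, ?_⟩
  · change Hom.fn g z ∈ V
    rw [hfn] at hzV
    exact hzV
  · have := hZ.t2Space N
    -- The endomorphism fixes the sections pulled back from `X`, which are dense, and the sections
    -- over `N` are Hausdorff.
    have h1 : (Hom.appLE e N N hNe : Z.topSheaf.obj N → _) = id := by
      refine hd.equalizer (Hom.continuous_appLE e N N hNe) continuous_id (funext fun r => ?_)
      have h2 := Hom.comp_appLE e g (U := V) (V := N) (W := N) le_rfl hNe r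
      refine h2.symm.trans ?_
      simp only [he]
      rfl
    have h2 := congrFun h1 (Z.topSheaf.res hVU s)
    rw [Hom.appLE_res] at h2
    rw [Hom.id_appLE]
    exact h2

end IsPseudoImmersion

namespace ImageClosure

variable {Y X : LocallyTopRingedSpace.{u}} {f : Y ⟶ X} (hf : IsAdmissible f)

section Incl

lemma incl_mem_sub (W : Opens X.carrier) (t : X.topSheaf.obj W) :
    descDirect (h := f) (k := incl f) (fun _ => rfl) W t ∈
      (sub f).subring ((Opens.map (incl f)).obj W) :=
  mem_sub_of_mem_approx f (toDirect_mem_approx f W t)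

/-- The inclusion of the closure of the image. -/
def ι : space hf ⟶ X :=
  desc hf (g := 𝟙 X) (h := f) (k := incl f) (Category.comp_id f) (fun _ => rfl) (fun _ => rfl)
    incl_mem_sub

lemma isClosedEmbedding_ι : IsClosedEmbedding (Hom.fn (ι hf)) := isClosedEmbedding_incl f

lemma secVal_ι_appLE (W : Opens X.carrier) (W' : Opens (space hf).carrier)
    (h : W' ≤ (Opens.map (ι hf).toLRSHom.base).obj W) (t : X.topSheaf.obj W) :
    secVal hf W' (Hom.appLE (ι hf) W W' h t) =
      Hom.appLE f W ((Opens.map (base f)).obj W') (fun _ hy => h hy) t :=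
  Hom.res_appLE f (V := (Opens.map (base f)).obj ((Opens.map (incl f)).obj W))
    (V' := (Opens.map (base f)).obj W') (fun _ hy => h hy) le_rfl t

lemma desc_comp {T : LocallyTopRingedSpace.{u}} {g : T ⟶ X} {h : Y ⟶ T} (hg : h ≫ g = f)
    {k : carrier f ⟶ T.carrier} (hk : ∀ y, k (base f y) = Hom.fn h y)
    (hgk : ∀ z, Hom.fn g (k z) = incl f z)
    (hm : ∀ (W : Opens T.carrier) (t : T.topSheaf.obj W),
      descDirect hk W t ∈ (sub f).subring ((Opens.map k).obj W)) :
    desc hf hg hk hgk hm ≫ g = ι hf := by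
  refine Hom.ext' hgk fun U z hz s => ?_
  let W : Opens (space hf).carrier := (Opens.map (ι hf).toLRSHom.base).obj U
  let N : Opens T.carrier := (Opens.map g.toLRSHom.base).obj U
  have hW : W ≤ (Opens.map (desc hf hg hk hgk hm).toLRSHom.base).obj N :=
    fun z hz => (congrArg (· ∈ U) (hgk z)).mpr hz
  have hW' : (Opens.map (base f)).obj W ≤ (Opens.map h.toLRSHom.base).obj N :=
    fun y hy => map_base_le hk N (hW hy)
  refine ⟨W, hW, le_rfl, (congrArg (· ∈ U) (hgk z)).mp hz, injective_secVal hf W ?_⟩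
  have e1 := Hom.comp_appLE (desc hf hg hk hgk hm) g (V := N) le_rfl hW s
  have e2 := secVal_desc_appLE hf hg hk hgk hm N W hW hW' (Hom.appLE g U N le_rfl s)
  have e3 := secVal_ι_appLE hf U W le_rfl s
  have e4 : Hom.appLE h N ((Opens.map (base f)).obj W) hW' (Hom.appLE g U N le_rfl s) =
      Hom.appLE f U ((Opens.map (base f)).obj W) le_rfl s := by
    subst hg
    exact (Hom.comp_appLE h g (V := N) le_rfl hW' s).symm
  exact (congrArg (secVal hf W) e1).trans (e2.trans (e4.trans e3.symm))

/-- Sections of the closure are local limits of sections of `X`. On a quasi-compact open subset of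
an ordinary scheme the sections are discrete, so such limits are attained by pullbacks of actual
sections of `X`. -/
lemma surjStalks_comp_ι {W : LocallyTopRingedSpace.{u}} (hW : IsOrdinaryScheme W)
    {i : W ⟶ space hf} (hi : SurjStalks i) : SurjStalks (i ≫ ι hf) := by
  intro V s x hx
  obtain ⟨U, t, V', hV'U, hV'V, hxV', hst⟩ := hi V s x hx
  obtain ⟨N, hN, hxN, ht⟩ := t.2 (Hom.fn i x) (hV'U hxV')
  let N' : Opens (space hf).carrier := inter f N
  have hNU : N' ≤ U := hN
  obtain ⟨V'', hV'', hxV'', hc⟩ := hW.exists_isCompact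
    (U := V' ⊓ (Opens.map i.toLRSHom.base).obj N') (x := x) ⟨hxV', hxN⟩
  have := hW.discreteTopology hc
  let t' : (space hf).topSheaf.obj N' := (space hf).topSheaf.res hNU t
  have h1 : t' ∈ closure (Set.range (Hom.appLE (ι hf) N N' le_rfl)) := by
    rw [(isInducing_secVal hf N').closure_eq_preimage_closure_image, Set.mem_preimage,
      ← Set.range_comp]
    refine (congrArg (· ∈ closure _) (?_ : (direct f).res hN t.1 = secVal hf N' t')).mp
      (closure_mono ?_ ht)
    · rfl
    · rintro _ ⟨r, rfl⟩
      exact ⟨r, secVal_ι_appLE hf N N' le_rfl r⟩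
  have hiV : V'' ≤ (Opens.map i.toLRSHom.base).obj N' := hV''.trans inf_le_right
  have h2 := map_mem_closure (Hom.continuous_appLE i N' V'' hiV) h1
    (t := Set.range (Hom.appLE (i ≫ ι hf) N V'' hiV)) (by
      rintro _ ⟨r, rfl⟩
      exact ⟨r, Hom.comp_appLE i (ι hf) (V := N') le_rfl hiV r⟩)
  rw [closure_discrete] at h2
  obtain ⟨r, hr⟩ := h2
  refine ⟨N, r, V'', hiV, hV''.trans (inf_le_left.trans hV'V), hxV'', hr.trans ?_⟩
  have h3 := congrArg (W.topSheaf.res (hV''.trans inf_le_left)) hst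
  rw [Hom.res_appLE, TopSheaf.res_res] at h3
  exact (Hom.appLE_res i hNU hiV t).trans h3

/-- For ordinary sources, immersions are strict embeddings, and this property persists under
composition with the closed embedding `ι`. -/
lemma isPseudoImmersion_ι : IsPseudoImmersion (ι hf) := by
  intro W i hW hi
  have h := hi.isStrictEmbedding hW
  refine IsStrictEmbedding.isImmersion ⟨(isClosedEmbedding_ι hf).isEmbedding.comp h.isEmbedding, ?_,
    surjStalks_comp_ι hf hW h.surjStalks⟩ hf.target hW
  have e : Set.range (Hom.fn (i ≫ ι hf)) = Hom.fn (ι hf) '' Set.range (Hom.fn i) := by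
    rw [← Set.range_comp]
    rfl
  rw [e]
  exact h.isLocallyClosed.image (isClosedEmbedding_ι hf).isInducing
    (isClosedEmbedding_ι hf).isClosed_range.isLocallyClosed

end Incl

/-- Sections of a pseudo-subscheme are limits of sections of the target. -/
lemma descDirect_mem_sub {Z : LocallyTopRingedSpace.{u}} {g : Z ⟶ X} (hg : IsPseudoImmersion g)
    (hZ : Z.IsFormal) (hX : X.IsFormal) {h : Y ⟶ Z} (hgf : h ≫ g = f)
    {k : carrier f ⟶ Z.carrier} (hk : ∀ y, k (base f y) = Hom.fn h y)
    (hgk : ∀ z, Hom.fn g (k z) = incl f z) (W : Opens Z.carrier) (t : Z.topSheaf.obj W) :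
    descDirect hk W t ∈ (sub f).subring ((Opens.map k).obj W) := by
  intro z hz
  obtain ⟨V, hzV, hVW, -, hd⟩ := hg.exists_approx hZ hX (W := W) (z := k z) hz
  have hV : inter f V ≤ (Opens.map k).obj W := by
    intro z' hz'
    refine hVW ?_
    change Hom.fn g (k z') ∈ V
    rw [hgk]
    exact hz'
  refine ⟨V, hV, hgk z ▸ hzV, ?_⟩
  let N : Opens Z.carrier := (Opens.map g.toLRSHom.base).obj V
  let M : Opens Y.carrier := (Opens.map (base f)).obj (inter f V)
  have hM : M ≤ (Opens.map h.toLRSHom.base).obj N := by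
    subst hgf
    exact fun y hy => hy
  have h1 := map_mem_closure (Hom.continuous_appLE h N M hM) (hd (Z.topSheaf.res hVW t))
    (t := Set.range (toDirect f V)) (by
      rintro _ ⟨r, rfl⟩
      refine ⟨r, ?_⟩
      subst hgf
      exact Hom.comp_appLE h g (V := N) le_rfl hM r)
  rw [Hom.appLE_res] at h1
  refine (congrArg (· ∈ approx f V) ?_).mp h1
  exact (Hom.res_appLE h (V := (Opens.map (base f)).obj ((Opens.map k).obj W))
    (V' := M) (fun _ hy => hV hy) (map_base_le hk W) t).symm

/-- The closure of the image factors through closed pseudo-subschemes. -/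
lemma exists_factor {Z : LocallyTopRingedSpace.{u}} {g : Z ⟶ X} (hg : IsPseudoImmersion g)
    (hZ : Z.IsFormal) (hgc : IsClosedEmbedding (Hom.fn g)) {h : Y ⟶ Z} (hgf : h ≫ g = f) :
    ∃ e : space hf ⟶ Z, e ≫ g = ι hf := by
  have hcl (z : carrier f) : incl f z ∈ Set.range (Hom.fn g) := by
    refine closure_minimal ?_ hgc.isClosed_range z.2
    subst hgf
    rintro _ ⟨y, rfl⟩
    exact ⟨_, rfl⟩
  choose k hk using hcl
  have hkc : Continuous k := by
    rw [hgc.isInducing.continuous_iff]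
    exact (congrArg Continuous (funext hk)).mpr (incl f).hom.continuous
  let k' : carrier f ⟶ Z.carrier := TopCat.ofHom ⟨k, hkc⟩
  have hk' (y : Y.carrier) : k' (base f y) = Hom.fn h y := by
    refine hgc.injective ((hk _).trans ?_)
    subst hgf
    rfl
  exact ⟨_, desc_comp hf hgf hk' hk (descDirect_mem_sub hg hZ hf.target hgf hk' hk)⟩

section Open

variable (hp : IsPseudoImmersion f)
include hf hp

/-- The image of a pseudo-immersion is locally closed, hence open in its closure. -/
lemma isOpenEmbedding_base : IsOpenEmbedding (base f) := by
  refine ⟨IsEmbedding.of_comp (base f).hom.continuous (incl f).hom.continuous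
    (hp.isEmbedding hf.source), ?_⟩
  obtain ⟨N, F, hN, hF, hNF⟩ := hp.isLocallyClosed hf.source
  have h : Set.range (base f) = incl f ⁻¹' N := by
    ext z
    refine ⟨?_, fun hz => ?_⟩
    · rintro ⟨y, rfl⟩
      exact (hNF.le ⟨y, rfl⟩).1
    · obtain ⟨y, hy⟩ := hNF.ge ⟨hz, closure_minimal (hNF.le.trans Set.inter_subset_right) hF z.2⟩
      exact ⟨y, (isClosedEmbedding_incl f).injective hy⟩
  rw [h]
  exact hN.preimage (incl f).hom.continuous

lemma map_functor_le (U : Opens Y.carrier) :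
    (Opens.map (base f)).obj ((isOpenEmbedding_base hf hp).functor.obj U) ≤ U := by
  rintro y ⟨y', hy', e⟩
  exact (isOpenEmbedding_base hf hp).injective e ▸ hy'

lemma le_map_functor (U : Opens Y.carrier) :
    U ≤ (Opens.map (base f)).obj ((isOpenEmbedding_base hf hp).functor.obj U) :=
  fun y hy => ⟨y, hy, rfl⟩

/-- By density every section of a pseudo-subscheme is locally a limit of sections of `X`, so over
the image of `Y` the subsheaf is the whole direct image. -/
lemma res_mem_sub (U : Opens Y.carrier) (s : Y.topSheaf.obj U) :
    Y.topSheaf.res (map_functor_le hf hp U) s ∈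
      (sub f).subring ((isOpenEmbedding_base hf hp).functor.obj U) := by
  rintro _ ⟨y, hy, rfl⟩
  obtain ⟨V, hyV, hVU, hcl, hd⟩ := hp.exists_approx hf.source hf.target hy
  have hV : inter f V ≤ (isOpenEmbedding_base hf hp).functor.obj U := by
    intro z hz
    obtain ⟨y', hy'⟩ := hcl ⟨z.2, hz⟩
    refine ⟨y', hVU ?_, (isClosedEmbedding_incl f).injective hy'⟩
    change Hom.fn f y' ∈ V
    rw [hy']
    exact hz
  refine ⟨V, hV, hyV, ?_⟩
  refine (congrArg (· ∈ approx f V) ?_).mp (hd (Y.topSheaf.res hVU s))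
  exact (Y.topSheaf.res_res (map_functor_le hf hp U)
    (W := (Opens.map (base f)).obj (inter f V)) (fun _ hy => hV hy) s).symm

/-- The identification of the source with an open subspace of the closure of the image. -/
def openIsoSource : TopSheaf.OpenIso Y.topSheaf (space hf).topSheaf where
  base := base f
  isOpenEmbedding := isOpenEmbedding_base hf hp
  hom U := (Y.topSheaf.res (map_functor_le hf hp U)).codRestrict
    ((sub f).subring ((isOpenEmbedding_base hf hp).functor.obj U)) (res_mem_sub hf hp U)
  hom_res h s := Subtype.ext ((Y.topSheaf.res_res _ _ s).trans (Y.topSheaf.res_res _ _ s).symm)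
  bijective U := by
    refine ⟨fun s t hst => ?_, fun s => ⟨Y.topSheaf.res (le_map_functor hf hp U) s.1, ?_⟩⟩
    · have h1 := congrArg (Y.topSheaf.res (le_map_functor hf hp U)) (congrArg Subtype.val hst)
      exact ((Y.topSheaf.res_refl s).symm.trans ((Y.topSheaf.res_res _ _ s).symm.trans
        (h1.trans (Y.topSheaf.res_res _ _ t)))).trans (Y.topSheaf.res_refl t)
    · exact Subtype.ext ((Y.topSheaf.res_res _ _ _).trans (Y.topSheaf.res_refl _))
  isInducing U := by
    have h1 : IsInducing (Y.topSheaf.res (map_functor_le hf hp U)) := by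
      refine IsInducing.of_comp (g := Y.topSheaf.res (le_map_functor hf hp U))
        (Y.topSheaf.continuous_res _) (Y.topSheaf.continuous_res _) ?_
      convert IsInducing.id using 1
      ext s
      exact (Y.topSheaf.res_res _ _ s).trans (Y.topSheaf.res_refl s)
    exact IsInducing.subtypeVal.of_comp_iff.mp h1

/-- The source as an open subspace of the closure of the image. -/
def source : Y ⟶ space hf := homOfOpenIso (openIsoSource hf hp)

lemma isOpenImmersion_source : IsOpenImmersion (source hf hp) := isOpenImmersion_homOfOpenIso _

lemma source_ι : source hf hp ≫ ι hf = f := by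
  refine Hom.ext' (fun _ => rfl) fun U y hy s => ?_
  let W : Opens (space hf).carrier := (Opens.map (ι hf).toLRSHom.base).obj U
  let V : Opens Y.carrier := (Opens.map f.toLRSHom.base).obj U
  have hV : V ≤ (Opens.map (source hf hp).toLRSHom.base).obj W := fun _ hx => hx
  refine ⟨V, hV, le_rfl, hy, ?_⟩
  rw [Hom.comp_appLE (source hf hp) (ι hf) (V := W) le_rfl hV]
  apply ((openIsoSource hf hp).bijective V).1
  have hle : (isOpenEmbedding_base hf hp).functor.obj V ≤ W := by
    rintro _ ⟨x, hx, rfl⟩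
    exact hx
  refine ((openIsoSource hf hp).hom_appLE hV hle _).trans ?_
  refine injective_secVal hf _ ?_
  have hle' : (Opens.map (base f)).obj ((isOpenEmbedding_base hf hp).functor.obj V) ≤ V :=
    map_functor_le hf hp V
  refine (congrArg (Y.topSheaf.res (U := (Opens.map (base f)).obj W) hle')
    (secVal_ι_appLE hf U W le_rfl s)).trans ?_
  rfl

end Open

end ImageClosure

end LocallyTopRingedSpace

end

end FormalGeometry

/-! ### Passage to equivalence classes and the order on pseudo-subschemes. -/

namespace FormalGeometry

noncomputable section

open LocallyTopRingedSpace

namespace PseudoSubscheme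

variable {X : FormalScheme.{u}}

lemma exists_hom_of_mk_eq {f g : PseudoImmersion X} (h : mk f = mk g) :
    ∃ e : f.dom.toLocallyTopRingedSpace ⟶ g.dom.toLocallyTopRingedSpace, e ≫ g.hom = f.hom := by
  obtain ⟨e, he⟩ := Quotient.exact h
  exact ⟨e.hom, he⟩

lemma mk_le_mk_iff {f g : PseudoImmersion X} : mk f ≤ mk g ↔
    ∃ h : f.dom.toLocallyTopRingedSpace ⟶ g.dom.toLocallyTopRingedSpace, h ≫ g.hom = f.hom := by
  refine ⟨?_, fun ⟨h, hh⟩ => ⟨f, g, rfl, rfl, h, hh⟩⟩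
  rintro ⟨f', g', hf, hg, h, hh⟩
  obtain ⟨e, he⟩ := exists_hom_of_mk_eq hf.symm
  obtain ⟨e', he'⟩ := exists_hom_of_mk_eq hg
  exact ⟨e ≫ h ≫ e', by rw [Category.assoc, Category.assoc, he', hh, he]⟩

/-- The two composites of the factorizations are endomorphisms over `X`, hence identities by
`IsPseudoImmersion.eq_id`. -/
lemma le_antisymm {Y Z : PseudoSubscheme X} (h : Y ≤ Z) (h' : Z ≤ Y) : Y = Z := by
  induction Y using Quotient.ind with | _ f => ?_
  induction Z using Quotient.ind with | _ g => ?_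
  obtain ⟨a, ha⟩ := mk_le_mk_iff.mp h
  obtain ⟨b, hb⟩ := mk_le_mk_iff.mp h'
  refine Quotient.sound ⟨⟨a, b, ?_, ?_⟩, ha⟩
  · refine IsPseudoImmersion.eq_id (g := f.hom) f.isImmersion_comp f.dom.isFormal X.isFormal ?_
    rw [Category.assoc, hb, ha]
  · refine IsPseudoImmersion.eq_id (g := g.hom) g.isImmersion_comp g.dom.isFormal X.isFormal ?_
    rw [Category.assoc, ha, hb]

/-- The pseudo-immersion of the closure of the image. -/
def closureImmersion (f : PseudoImmersion X) (hf : ImageClosure.IsAdmissible f.hom) :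
    PseudoImmersion X where
  dom := { ImageClosure.space hf with exists_affine := ImageClosure.isFormal_space hf }
  hom := ImageClosure.ι hf
  isImmersion_comp := ImageClosure.isPseudoImmersion_ι hf

lemma isLeast_closureImmersion (f : PseudoImmersion X)
    (hf : ImageClosure.IsAdmissible f.hom) :
    IsLeast {Z : PseudoSubscheme X | Z.IsClosed ∧ (mk f).IsOpenSubschemeOf Z}
      (mk (closureImmersion f hf)) := by
  refine ⟨⟨⟨_, rfl, ImageClosure.isClosedEmbedding_ι hf⟩, f, _, rfl, rfl,
    ImageClosure.source hf f.isImmersion_comp, ImageClosure.isOpenImmersion_source hf _,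
    ImageClosure.source_ι hf _⟩, ?_⟩
  rintro Z ⟨⟨g, rfl, hg⟩, f', g', hf', hg', h, -, hh⟩
  -- The containment is witnessed on other representatives `f'` and `g'`; the equivalences move it
  -- to `f` and to the representative `g` with closed image.
  obtain ⟨e, he⟩ := exists_hom_of_mk_eq hf'.symm
  obtain ⟨e', he'⟩ := exists_hom_of_mk_eq hg'
  exact mk_le_mk_iff.mpr (ImageClosure.exists_factor hf g.isImmersion_comp g.dom.isFormal hg
    (h := e ≫ h ≫ e') (by rw [Category.assoc, Category.assoc, he', hh, he]))

end PseudoSubscheme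

end

end FormalGeometry
theorem mainTheorem6 (X : FormalGeometry.FormalScheme.{u}) (Y : FormalGeometry.PseudoSubscheme X)
    (hY : Y.IsQuasiCompact) :
    ∃! Z : FormalGeometry.PseudoSubscheme X,
      IsLeast {Z : FormalGeometry.PseudoSubscheme X | Z.IsClosed ∧ Y.IsOpenSubschemeOf Z} Z := by
  obtain ⟨f, rfl, hf⟩ := hY
  have h := FormalGeometry.PseudoSubscheme.isLeast_closureImmersion f
    ⟨f.dom.isFormal, X.isFormal, hf⟩
  -- Only the relation `≤` is declared on pseudo-subschemes, so uniqueness of the least element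
  -- rests on the antisymmetry just proved.
  exact ⟨_, h, fun Z hZ => FormalGeometry.PseudoSubscheme.le_antisymm (hZ.2 h.1) (h.2 hZ.1)⟩
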